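/- **Setting.** Let $N\ge 1$, $a_0<a_1<\dots<a_N$ be real numbers, $\Omega=(a_0,a_N)$, $\Omega_i=(a_{i-1},a_i)$ for $1\le i\le N$, $T>0$ and $\mathcal Q_i=\Omega_i\times(0,T)$. For every $i$ let $\phi_i\in(0,1)$; let $\pi_i\in C^1([0,1],\mathbb R)$ with $\pi_i'>0$ on $(0,1)$; let $\eta_{o,i},\eta_{w,i}\in C([0,1],\mathbb R_+)$ with $\eta_{o,i}$ strictly increasing, $\eta_{o,i}(0)=0$, and $\eta_{w,i}$ strictly decreasing, $\eta_{w,i}(1)=0$. Put $$\lambda_i=\frac{\eta_{o,i}\,\eta_{w,i}}{\eta_{o,i}+\eta_{w,i}},\qquad \varphi_i(s)=\int_0^s\lambda_i(a)\,\pi_i'(a)\,da\quad(s\in[0,1]),$$ and let $\tilde\pi_i$ be the monotone graph $\tilde\pi_i(0)=(-\infty,\pi_i(0)]$, $\tilde\pi_i(s)=\{\pi_i(s)\}$ for $0<s<1$, $\tilde\pi_i(1)=[\pi_i(1),+\infty)$. **Weak solutions.** Let $u_0\in L^\infty(\Omega)$ with $0\le u_0\le1$ a.e. A weak solution to problem $(\mathcal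 P)$ with initial datum $u_0$ is a function $u\in L^\infty(\Omega\times(0,T))$, with restrictions $u_i=u|_{\mathcal Q_i}$, such that 1. $0\le u\le 1$ a.e. in $\Omega\times(0,T)$; 2. $\varphi_i(u_i)\in L^2(0,T;H^1(\Omega_i))$ for all $i$; 3. for all $1\le i<N$ and a.e. $t\in(0,T)$, $\tilde\pi_i(u_i(a_i,t))\cap\tilde\pi_{i+1}(u_{i+1}(a_i,t))\ne\emptyset$, where the trace $u_k(a_i,t)\in[0,1]$ is $\varphi_k^{-1}$ of the trace at $a_i$ of $\varphi_k(u_k(\cdot,t))\in H^1(\Omega_k)$; 4. for all $\psi\in\mathcal D(\overline\Omega\times[0,T))$, $$\sum_{i=1}^N\int_0^T\!\!\int_{\Omega_i}\phi_i u_i\,\partial_t\psi\,dx\,dt+\sum_{i=1}^N\int_{\Omega_i}\phi_i u_0\,\psi(x,0)\,dx-\sum_{i=1}^N\int_0^T\!\!\int_{\Omega_i}\partial_x\varphi_i(u_i)\,\partial_x\psi\,dx\,dt=0.$$ **Theorem** ($L^1$-contraction principle for bounded flux solutions). Let $u$ and $v$ be weak solutions to $(\mathcal P)$ with initial data $u_0$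 and $v_0$ (both in $L^\infty(\Omega)$ with values in $[0,1]$ a.e.), and suppose that $\partial_x\varphi_i(u_i)$ and $\partial_x\varphi_i(v_i)$ belong to $L^\infty(\mathcal Q_i)$ for every $i$. Then $u$ and $v$ have representatives in $C([0,T];L^1(\Omega))$, and, for these representatives, for every $t\in[0,T]$, $$\sum_{i=1}^N\int_{\Omega_i}\phi_i\,(u(x,t)-v(x,t))^{\pm}\,dx\le\sum_{i=1}^N\int_{\Omega_i}\phi_i\,(u_0(x)-v_0(x))^{\pm}\,dx .$$ -/

import Mathlib

open MeasureTheory Set Filter Topology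
open scoped ContDiff

noncomputable section

namespace CapillaryFlow

/-- A one-dimensional heterogeneous medium made of `N` homogeneous layers, listed from left to
right, with the physical data of every layer. The functions of the saturation are only relevant on
`[0,1]`. Nonnegativity of the mobilities on `[0,1]` follows from the other fields. -/
structure Medium (N : ℕ) where
  /-- end points of the layers -/
  node : Fin (N + 1) → ℝ
  node_strictMono : StrictMono node
  /-- porosities -/
  porosity : Fin N → ℝ
  porosity_mem : ∀ i, porosity i ∈ Ioo (0 : ℝ) 1
  /-- capillary pressures -/
  capPressure : Fin N → ℝ → ℝ
  capPressure_contDiffOn : ∀ i, ContDiffOn ℝ 1 (capPressure i) (Icc 0 1)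
  capPressure_deriv_pos :
    ∀ i, ∀ s ∈ Ioo (0 : ℝ) 1, 0 < derivWithin (capPressure i) (Icc 0 1) s
  /-- oil mobilities -/
  oilMobility : Fin N → ℝ → ℝ
  oilMobility_continuousOn : ∀ i, ContinuousOn (oilMobility i) (Icc 0 1)
  oilMobility_strictMonoOn : ∀ i, StrictMonoOn (oilMobility i) (Icc 0 1)
  oilMobility_zero : ∀ i, oilMobility i 0 = 0
  /-- water mobilities -/
  waterMobility : Fin N → ℝ → ℝ
  waterMobility_continuousOn : ∀ i, ContinuousOn (waterMobility i) (Icc 0 1)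
  waterMobility_strictAntiOn : ∀ i, StrictAntiOn (waterMobility i) (Icc 0 1)
  waterMobility_one : ∀ i, waterMobility i 1 = 0

/-- `v` is a weak derivative of `f` on the open set `I` of the real line. -/
def IsWeakDeriv (I : Set ℝ) (f v : ℝ → ℝ) : Prop :=
  ∀ ζ : ℝ → ℝ, ContDiff ℝ ∞ ζ → HasCompactSupport ζ → tsupport ζ ⊆ I →
    ∫ x in I, f x * deriv ζ x = - ∫ x in I, v x * ζ x

/-- `g` is the weak space derivative `∂ₓ w` of a function `w` of `(x, t) ∈ I × (0,T)`:
for almost every time `t`, the function `g(·,t)` is the weak derivative of `w(·,t)` on `I`. -/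
def IsWeakSpaceDeriv (I : Set ℝ) (T : ℝ) (w g : ℝ × ℝ → ℝ) : Prop :=
  ∀ᵐ t ∂(volume.restrict (Ioo 0 T)), IsWeakDeriv I (fun x => w (x, t)) (fun x => g (x, t))

/-- `c` is the trace at the point `x` of the closure of the interval `I` of a function `f`, given
up to null sets on `I`: the value at `x` of its representative that is continuous on the closure
(such a representative exists when `f ∈ H¹(I)`, and it is unique). -/
def IsTrace (I : Set ℝ) (f : ℝ → ℝ) (x c : ℝ) : Prop :=
  ∃ F : ℝ → ℝ, ContinuousOn F (closure I) ∧ F =ᵐ[volume.restrict I] f ∧ F x = c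

/-- The test functions `𝒟(Ω̄ × [0,T))`, given through smooth extensions to `ℝ × ℝ`. -/
def IsTestFunction (T : ℝ) (ψ : ℝ × ℝ → ℝ) : Prop :=
  ContDiff ℝ ∞ ψ ∧ HasCompactSupport ψ ∧ tsupport ψ ⊆ univ ×ˢ Iio T

namespace Medium

variable {N : ℕ} (M : Medium N)

/-- The whole domain `Ω`. -/
def domain : Set ℝ := Ioo (M.node 0) (M.node (Fin.last N))

/-- The layer `Ωᵢ`. -/
def layer (i : Fin N) : Set ℝ := Ioo (M.node i.castSucc) (M.node i.succ)

/-- The space-time domain `Ω × (0,T)`. -/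
def cylinder (T : ℝ) : Set (ℝ × ℝ) := M.domain ×ˢ Ioo 0 T

/-- The space-time domain `Qᵢ = Ωᵢ × (0,T)` of a layer. -/
def layerCylinder (T : ℝ) (i : Fin N) : Set (ℝ × ℝ) := M.layer i ×ˢ Ioo 0 T

/-- The global mobility `λᵢ`. -/
def globalMobility (i : Fin N) (s : ℝ) : ℝ :=
  M.oilMobility i s * M.waterMobility i s / (M.oilMobility i s + M.waterMobility i s)

/-- The function `φᵢ(s) = ∫₀ˢ λᵢ(a) πᵢ'(a) da`. -/
def kirchhoff (i : Fin N) (s : ℝ) : ℝ :=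
  ∫ a in (0 : ℝ)..s, M.globalMobility i a * derivWithin (M.capPressure i) (Icc 0 1) a

/-- The monotone capillary pressure graph of the layer `Ωᵢ`. -/
def pressureGraph (i : Fin N) (s : ℝ) : Set ℝ :=
  {p | (0 < s ∧ s < 1 ∧ p = M.capPressure i s) ∨
    (s = 0 ∧ p ≤ M.capPressure i 0) ∨ (s = 1 ∧ M.capPressure i 1 ≤ p)}

/-- `s` is the trace at `x` of a saturation profile `f` on the layer `Ωᵢ`: it is obtained by
inverting the function `φᵢ` on the trace of `φᵢ(f)`. -/
def IsSaturationTrace (i : Fin N) (f : ℝ → ℝ) (x s : ℝ) : Prop :=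
  s ∈ Icc (0 : ℝ) 1 ∧ IsTrace (M.layer i) (fun y => M.kirchhoff i (f y)) x (M.kirchhoff i s)

/-- Initial data: `u₀ ∈ L^∞(Ω)` with `0 ≤ u₀ ≤ 1`. -/
def IsInitialDatum (u₀ : ℝ → ℝ) : Prop :=
  AEStronglyMeasurable u₀ (volume.restrict M.domain) ∧
    ∀ᵐ x ∂(volume.restrict M.domain), u₀ x ∈ Icc (0 : ℝ) 1

/-- `u` is a weak solution on `Ω × (0,T)` with initial datum `u₀`. -/
structure IsWeakSolution (T : ℝ) (u₀ : ℝ → ℝ) (u : ℝ × ℝ → ℝ) : Prop where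
  aestronglyMeasurable : AEStronglyMeasurable u (volume.restrict (M.cylinder T))
  mem_Icc : ∀ᵐ p ∂(volume.restrict (M.cylinder T)), u p ∈ Icc (0 : ℝ) 1
  /-- `φᵢ(uᵢ) ∈ L²(0,T;H¹(Ωᵢ))` -/
  memL2H1 : ∀ i, MemLp (fun p => M.kirchhoff i (u p)) 2 (volume.restrict (M.layerCylinder T i)) ∧
    ∃ g : ℝ × ℝ → ℝ, MemLp g 2 (volume.restrict (M.layerCylinder T i)) ∧
      IsWeakSpaceDeriv (M.layer i) T (fun p => M.kirchhoff i (u p)) g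
  /-- connection of the capillary pressures at the common end point of two neighbouring layers -/
  transmission : ∀ i j : Fin N, i.succ = j.castSucc → ∀ᵐ t ∂(volume.restrict (Ioo 0 T)),
    ∃ sᵢ sⱼ : ℝ, M.IsSaturationTrace i (fun x => u (x, t)) (M.node i.succ) sᵢ ∧
      M.IsSaturationTrace j (fun x => u (x, t)) (M.node i.succ) sⱼ ∧
      (M.pressureGraph i sᵢ ∩ M.pressureGraph j sⱼ).Nonempty
  /-- the weak formulation; `g i` is the (almost everywhere unique) derivative `∂ₓ φᵢ(uᵢ)` -/
  weak_formulation : ∀ g : Fin N → ℝ × ℝ → ℝ,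
    (∀ i, MemLp (g i) 2 (volume.restrict (M.layerCylinder T i)) ∧
      IsWeakSpaceDeriv (M.layer i) T (fun p => M.kirchhoff i (u p)) (g i)) →
    ∀ ψ : ℝ × ℝ → ℝ, IsTestFunction T ψ →
      (∑ i, ∫ p in M.layerCylinder T i,
          M.porosity i * u p * deriv (fun t => ψ (p.1, t)) p.2)
        + (∑ i, ∫ x in M.layer i, M.porosity i * u₀ x * ψ (x, 0))
        - (∑ i, ∫ p in M.layerCylinder T i, g i p * deriv (fun x => ψ (x, p.2)) p.1) = 0

/-- Bounded flux: `∂ₓ φᵢ(uᵢ) ∈ L^∞(Qᵢ)` for every layer. -/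
def HasBoundedFlux (T : ℝ) (u : ℝ × ℝ → ℝ) : Prop :=
  ∀ i, ∃ g : ℝ × ℝ → ℝ, MemLp g ⊤ (volume.restrict (M.layerCylinder T i)) ∧
    IsWeakSpaceDeriv (M.layer i) T (fun p => M.kirchhoff i (u p)) g

/-- `U` is the representative of (the almost everywhere class of) `u` that belongs to
`C([0,T]; L¹(Ω))`. -/
structure IsTimeContinuousRep (T : ℝ) (u U : ℝ × ℝ → ℝ) : Prop where
  ae_eq : U =ᵐ[volume.restrict (M.cylinder T)] u
  integrableOn : ∀ t ∈ Icc 0 T, IntegrableOn (fun x => U (x, t)) M.domain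
  continuous : ∀ t₀ ∈ Icc 0 T,
    Tendsto (fun t => ∫ x in M.domain, |U (x, t) - U (x, t₀)|) (𝓝[Icc 0 T] t₀) (𝓝 0)

end Medium

end CapillaryFlow

end

/-! The weak problem is first put in integrated form. Because the flux `∂ₓφ(u)` is bounded by some
`L`, the saturation has on every layer a representative continuous in `(x,t)` for which `φ(u(·,t))`
is `L`-Lipschitz. The time integral of the flux, `W(x,t) = ∫₀ᵗ ∂ₓφ(u)`, has a continuous version,
the same for all layers, that is `L`-Lipschitz in time and satisfies `∂ₓW = m(u(t) - u(0))` and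
`∂ₓ∫₀ᵗ φ(u) = W` in each layer, and `W = 0` at both ends of the domain. `IsFlow` records this in
integrated form; `exists_isFlow` produces it from the weak formulation, and the boundary conditions,
the initial datum and the mass balance at the interfaces are all contained in `W`.

The contraction is proved by doubling the time variable but not the space variable. With `v(·,s)`
frozen, convexity of the entropy `∫_c^p S(φ(α) - φ(c)) dα` in `p` gives an inequality for the
evolution of `u` in `t`, although `u` itself has no time derivative. The symmetric inequality for
`v` in `s` is added. As both solutions sit at the same point `x`, the flux terms combine into `∂ₓr`
with `r = φ(u(x,t)) - φ(v(x,s))`, the dissipation `∂ₓS(r) ∂ₓr` has a sign, and only a cut-off term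
remains (`doubled_rectangle_le`). Letting `S` tend to the indicator of `(0,∞)` gives a Kato
inequality for `(u - v)⁺` in which the cut-off term is a pair of difference quotients of `r⁺` at the
two ends of the layer (`excess_rectangle_le`).

At an interface the capillary condition orders the traces of `u(t)` and `v(s)` in the same way on
both sides. Hence on both sides `r⁺` is controlled by `r` times one and the same indicator of
`(t,s)` (`gap_sub_le`). The space difference quotients of `φ(u)` at a node converge weakly-* in time
to `∂ₜW` (`tendsto_integral_mul_slope`), which does not depend on the side. So the boundary terms
cancel at interior nodes and vanish at the ends of the domain: the doubled functional `Σ ∫ m (u(t) -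
v(s))⁺` has nonpositive divergence in `(t,s)`. A continuous function with this property decreases
along the diagonal `t = s` (`diagonal_antitone`), which is the contraction for the positive part;
exchanging the solutions gives the negative part. -/

namespace CapillaryFlow

/-! ### Flow on one layer: saturation, flux and potential. -/

/-- A function all of whose primitives over subintervals vanish is zero almost everywhere. -/
theorem ae_eq_zero_of_forall_intervalIntegral_eq_zero {a b : ℝ} {h : ℝ → ℝ}
    (hh : IntervalIntegrable h volume a b) (hz : ∀ x ∈ Icc a b, ∫ z in a..x, h z = 0) :
    ∀ᵐ x, x ∈ Ioo a b → h x = 0 := by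
  filter_upwards [hh.ae_hasDerivAt_integral] with x hx hxab
  have hab : a ≤ b := (hxab.1.trans hxab.2).le
  have h1 := hx (by rw [uIcc_of_le hab]; exact Ioo_subset_Icc_self hxab) a (by simp)
  have h2 : (fun x => ∫ z in a..x, h z) =ᶠ[𝓝 x] fun _ => 0 := by
    filter_upwards [isOpen_Ioo.mem_nhds hxab] with y hy
    exact hz y (Ioo_subset_Icc_self hy)
  exact (h1.congr_of_eventuallyEq h2.symm).unique (hasDerivAt_const x 0)

theorem intervalIntegrable_of_measurable_of_bounded {f : ℝ → ℝ} (hf : Measurable f) {C : ℝ}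
    (hC : ∀ x, |f x| ≤ C) (a b : ℝ) : IntervalIntegrable f volume a b :=
  (intervalIntegrable_const (c := C)).mono_fun hf.aestronglyMeasurable
    (Eventually.of_forall fun x => (hC x).trans (le_abs_self C))

/-- A solution on a single layer `[a,b]`: the saturation `u`, the porosity `m`, the Kirchhoff
function `φ`, the bound `L` on the flux, and the time integral `W` of the flux. -/
structure IsLayerFlow (a b T m L : ℝ) (φ : ℝ → ℝ) (u W : ℝ → ℝ → ℝ) : Prop where
  cont : Continuous (Function.uncurry u)
  mem : ∀ x t, u x t ∈ Icc (0 : ℝ) 1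
  lip : ∀ t x y, |φ (u x t) - φ (u y t)| ≤ L * |x - y|
  contW : Continuous (Function.uncurry W)
  lipW : ∀ x ∈ Icc a b, ∀ t s, |W x t - W x s| ≤ L * |t - s|
  balance : ∀ t ∈ Icc 0 T, ∀ x ∈ Icc a b, W x t - W a t = ∫ z in a..x, m * (u z t - u z 0)
  flux : ∀ t ∈ Icc 0 T, ∀ x ∈ Icc a b,
    ∫ z in a..x, W z t = ∫ τ in (0 : ℝ)..t, (φ (u x τ) - φ (u a τ))

/-- The flux `∂ₓ φ(u)`. -/
noncomputable def fluxOf (φ : ℝ → ℝ) (u : ℝ → ℝ → ℝ) (x t : ℝ) : ℝ :=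
  deriv (fun y => φ (u y t)) x

theorem measurable_fluxOf {φ : ℝ → ℝ} {u : ℝ → ℝ → ℝ} (hφ : Continuous φ)
    (hu : Continuous (Function.uncurry u)) :
    Measurable (fun p : ℝ × ℝ => fluxOf φ u p.2 p.1) := by
  have : Continuous (Function.uncurry (fun t y => φ (u y t))) := by
    change Continuous (fun p : ℝ × ℝ => φ (Function.uncurry u (p.2, p.1)))
    fun_prop
  exact measurable_deriv_with_param this

theorem lipschitzWith_of_abs {f : ℝ → ℝ} {L : ℝ} (hL : 0 ≤ L)
    (h : ∀ x y, |f x - f y| ≤ L * |x - y|) : LipschitzWith ⟨L, hL⟩ f :=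
  LipschitzWith.of_dist_le_mul fun x y => h x y

theorem abs_deriv_le_of_lip {f : ℝ → ℝ} {L : ℝ} (hL : 0 ≤ L) (h : ∀ x y, |f x - f y| ≤ L * |x - y|)
    (x : ℝ) : |deriv f x| ≤ L := by
  exact norm_deriv_le_of_lipschitz (x₀ := x) (lipschitzWith_of_abs hL h)

theorem integral_deriv_of_lip {f : ℝ → ℝ} {L : ℝ} (hL : 0 ≤ L)
    (h : ∀ x y, |f x - f y| ≤ L * |x - y|) (a b : ℝ) :
    ∫ x in a..b, deriv f x = f b - f a :=
  ((lipschitzWith_of_abs hL h).lipschitzOnWith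
    (s := uIcc a b)).absolutelyContinuousOnInterval.integral_deriv_eq_sub

namespace IsLayerFlow

variable {a b T m L : ℝ} {φ : ℝ → ℝ} {u W : ℝ → ℝ → ℝ}

theorem nonneg_lip (h : IsLayerFlow a b T m L φ u W) : 0 ≤ L := by
  have := (abs_nonneg _).trans (h.lip 0 1 0)
  simpa using this

theorem abs_fluxOf_le (h : IsLayerFlow a b T m L φ u W) (x t : ℝ) : |fluxOf φ u x t| ≤ L :=
  abs_deriv_le_of_lip h.nonneg_lip (h.lip t) x

theorem integral_fluxOf (h : IsLayerFlow a b T m L φ u W) (x y t : ℝ) :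
    ∫ z in x..y, fluxOf φ u z t = φ (u y t) - φ (u x t) :=
  integral_deriv_of_lip h.nonneg_lip (h.lip t) x y

theorem continuous_saturation_left (h : IsLayerFlow a b T m L φ u W) (t : ℝ) :
    Continuous (fun x => u x t) := h.cont.comp (by fun_prop : Continuous fun x : ℝ => (x, t))

theorem continuous_saturation_right (h : IsLayerFlow a b T m L φ u W) (x : ℝ) :
    Continuous (fun t => u x t) := h.cont.comp (by fun_prop : Continuous fun t : ℝ => (x, t))

theorem continuous_potential_left (h : IsLayerFlow a b T m L φ u W) (t : ℝ) :
    Continuous (fun x => W x t) := h.contW.comp (by fun_prop : Continuous fun x : ℝ => (x, t))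

theorem continuous_potential_right (h : IsLayerFlow a b T m L φ u W) (x : ℝ) :
    Continuous (fun t => W x t) := h.contW.comp (by fun_prop : Continuous fun t : ℝ => (x, t))

/-- At almost every point, `W` is the time integral of the flux. -/
theorem ae_potential_eq (h : IsLayerFlow a b T m L φ u W) (hφ : Continuous φ)
    (hT : 0 < T) : ∀ᵐ x, x ∈ Ioo a b → ∀ t ∈ Icc 0 T, W x t = ∫ τ in (0 : ℝ)..t, fluxOf φ u x τ := by
  have hm := measurable_fluxOf hφ h.cont
  have hint : ∀ x s t, IntervalIntegrable (fun τ => fluxOf φ u x τ) volume s t := fun x s t =>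
    intervalIntegrable_of_measurable_of_bounded (hm.comp measurable_prodMk_right)
      (fun τ => h.abs_fluxOf_le x τ) s t
  -- For fixed `t` both sides have the same primitive in `x`: for `W` this is the field `flux`, for
  -- the time integral it is Fubini and `integral_fluxOf`.
  have key : ∀ t ∈ Icc 0 T, ∀ᵐ x, x ∈ Ioo a b →
      W x t - ∫ τ in (0 : ℝ)..t, fluxOf φ u x τ = 0 := by
    intro t ht
    have hmeas : Measurable fun x => ∫ τ in (0 : ℝ)..t, fluxOf φ u x τ := by
      simp_rw [intervalIntegral.integral_of_le ht.1]
      exact (hm.stronglyMeasurable.integral_prod_left' (μ := volume.restrict (Ioc 0 t))).measurable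
    have hb : ∀ x, |∫ τ in (0 : ℝ)..t, fluxOf φ u x τ| ≤ L * |t - 0| := fun x => by
      simpa using intervalIntegral.norm_integral_le_of_norm_le_const (a := 0) (b := t)
        (f := fun τ => fluxOf φ u x τ) (C := L) (fun τ _ => h.abs_fluxOf_le x τ)
    have hi := fun x y => intervalIntegrable_of_measurable_of_bounded hmeas hb x y
    apply ae_eq_zero_of_forall_intervalIntegral_eq_zero
    · exact ((h.continuous_potential_left t).intervalIntegrable _ _).sub (hi _ _)
    · intro x hx
      rw [intervalIntegral.integral_sub ((h.continuous_potential_left t).intervalIntegrable _ _)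
        (hi _ _), h.flux t ht x hx, intervalIntegral_intervalIntegral_swap, sub_eq_zero]
      · refine intervalIntegral.integral_congr fun τ _ => ?_
        exact (h.integral_fluxOf a x τ).symm
      · refine Measure.integrableOn_of_bounded (M := L) ?_
          (hm.comp measurable_swap).aestronglyMeasurable
          (Eventually.of_forall fun p => h.abs_fluxOf_le _ _)
        rw [Measure.volume_eq_prod, Measure.prod_prod]
        simp [uIoc, ENNReal.mul_eq_top]
  -- Rational times share one null set of `x`; continuity in `t` of both sides then gives all of
  -- `[0,T]`.
  have key2 : ∀ᵐ x, ∀ r : ℚ, x ∈ Ioo a b → (r : ℝ) ∈ Ioo 0 T →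
      W x r - ∫ τ in (0 : ℝ)..r, fluxOf φ u x τ = 0 := by
    rw [ae_all_iff]
    intro r
    by_cases hr : (r : ℝ) ∈ Ioo 0 T
    · filter_upwards [key r (Ioo_subset_Icc_self hr)] with x hx h1 _ using hx h1
    · exact Eventually.of_forall fun x _ h2 => absurd h2 hr
  filter_upwards [key2] with x hx hxab t ht
  have hc : Continuous fun t => W x t - ∫ τ in (0 : ℝ)..t, fluxOf φ u x τ :=
    (h.continuous_potential_right x).sub
      (intervalIntegral.continuous_primitive (fun s t => hint x s t) 0)
  have hcl : IsClosed {t | W x t - ∫ τ in (0 : ℝ)..t, fluxOf φ u x τ = 0} :=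
    isClosed_eq hc continuous_const
  have hsub : Ioo 0 T ∩ range ((↑) : ℚ → ℝ) ⊆
      {t | W x t - ∫ τ in (0 : ℝ)..t, fluxOf φ u x τ = 0} := by
    rintro _ ⟨hr, r, rfl⟩
    exact hx r hxab hr
  have h2 := hcl.closure_subset_iff.2 hsub
  have h3 : Icc 0 T ⊆ closure (Ioo 0 T ∩ range ((↑) : ℚ → ℝ)) := by
    rw [← closure_Ioo hT.ne]
    exact closure_minimal (Rat.denseRange_cast.open_subset_closure_inter isOpen_Ioo)
      isClosed_closure
  exact sub_eq_zero.1 (h2 (h3 ht))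

/-- Almost everywhere, the time derivative of `W` is the flux. -/
theorem ae_hasDerivAt_potential (h : IsLayerFlow a b T m L φ u W) (hφ : Continuous φ)
    (hT : 0 < T) : ∀ᵐ x, x ∈ Ioo a b → ∀ᵐ t, t ∈ Ioo 0 T →
      HasDerivAt (fun τ => W x τ) (fluxOf φ u x t) t := by
  have hm := measurable_fluxOf hφ h.cont
  filter_upwards [h.ae_potential_eq hφ hT] with x hx hxab
  have hl : LocallyIntegrable (fun τ => fluxOf φ u x τ) volume := by
    rw [locallyIntegrable_iff]
    intro K hK
    exact Measure.integrableOn_of_bounded (M := L) hK.measure_lt_top.ne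
      (hm.comp measurable_prodMk_right).aestronglyMeasurable
      (Eventually.of_forall fun p => h.abs_fluxOf_le _ _)
  filter_upwards [LocallyIntegrable.ae_hasDerivAt_integral hl] with t ht htT
  refine (ht 0).congr_of_eventuallyEq ?_
  filter_upwards [isOpen_Ioo.mem_nhds htT] with s hs
  exact hx hxab s (Ioo_subset_Icc_self hs)

/-- Almost everywhere in `(0,T) × (a,b)`, backward difference quotients of `W` converge to the
flux. -/
theorem ae_tendsto_quotient (h : IsLayerFlow a b T m L φ u W) (hφ : Continuous φ)
    (hT : 0 < T) : ∀ᵐ t, t ∈ Ioo 0 T → ∀ᵐ x, x ∈ Ioo a b →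
      Tendsto (fun n : ℕ => (W x t - W x (t - 1 / (n + 1 : ℝ))) * (n + 1 : ℝ)) atTop
        (𝓝 (fluxOf φ u x t)) := by
  have hm := measurable_fluxOf hφ h.cont
  -- Differentiability of `W` is known for almost every `x` and then almost every `t`. Measurability
  -- of the set where the quotients converge is what permits the exchange of these two quantifiers.
  have hmeas : MeasurableSet {p : ℝ × ℝ | p.1 ∈ Ioo a b → p.2 ∈ Ioo 0 T →
      Tendsto (fun n : ℕ => (W p.1 p.2 - W p.1 (p.2 - 1 / (n + 1 : ℝ))) * (n + 1 : ℝ)) atTop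
        (𝓝 (fluxOf φ u p.1 p.2))} := by
    have hs : MeasurableSet {p : ℝ × ℝ |
      Tendsto (fun n : ℕ => (W p.1 p.2 - W p.1 (p.2 - 1 / (n + 1 : ℝ))) * (n + 1 : ℝ)) atTop
        (𝓝 (fluxOf φ u p.1 p.2))} := by
      refine measurableSet_tendsto_fun (fun n => ?_) (hm.comp measurable_swap)
      have h1 : Continuous fun p : ℝ × ℝ => W p.1 p.2 := h.contW
      have h2 : Continuous fun p : ℝ × ℝ => W p.1 (p.2 - 1 / (n + 1 : ℝ)) :=
        h.contW.comp (by fun_prop : Continuous fun p : ℝ × ℝ => (p.1, p.2 - 1 / (n + 1 : ℝ)))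
      exact ((h1.sub h2).mul continuous_const).measurable
    have e1 : MeasurableSet {p : ℝ × ℝ | p.1 ∈ Ioo a b} := measurable_fst measurableSet_Ioo
    have e2 : MeasurableSet {p : ℝ × ℝ | p.2 ∈ Ioo 0 T} := measurable_snd measurableSet_Ioo
    exact e1.imp (e2.imp hs)
  have key : ∀ᵐ p : ℝ × ℝ, p.1 ∈ Ioo a b → p.2 ∈ Ioo 0 T →
      Tendsto (fun n : ℕ => (W p.1 p.2 - W p.1 (p.2 - 1 / (n + 1 : ℝ))) * (n + 1 : ℝ)) atTop
        (𝓝 (fluxOf φ u p.1 p.2)) := by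
    rw [Measure.volume_eq_prod, Measure.ae_prod_iff_ae_ae hmeas]
    filter_upwards [h.ae_hasDerivAt_potential hφ hT] with x hx
    by_cases hxab : x ∈ Ioo a b
    · filter_upwards [hx hxab] with t ht _ htT
      have h1 := (hasDerivAt_iff_tendsto_slope_zero.1 (ht htT))
      have h2 : Tendsto (fun n : ℕ => -(1 / (n + 1 : ℝ))) atTop (𝓝[≠] 0) := by
        rw [tendsto_nhdsWithin_iff]
        constructor
        · simpa using (tendsto_one_div_add_atTop_nhds_zero_nat (𝕜 := ℝ)).neg
        · exact Eventually.of_forall fun n => by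
            have : (0 : ℝ) < 1 / (n + 1 : ℝ) := by positivity
            simp only [mem_compl_iff, mem_singleton_iff]; linarith
      refine (h1.comp h2).congr fun n => ?_
      have : (n + 1 : ℝ) ≠ 0 := by positivity
      simp only [Function.comp, smul_eq_mul, ← sub_eq_add_neg]
      field_simp
      ring
    · exact Eventually.of_forall fun t h1 => absurd h1 hxab
  have h3 : ∀ᵐ p : ℝ × ℝ, p.2 ∈ Ioo a b → p.1 ∈ Ioo 0 T →
      Tendsto (fun n : ℕ => (W p.2 p.1 - W p.2 (p.1 - 1 / (n + 1 : ℝ))) * (n + 1 : ℝ)) atTop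
        (𝓝 (fluxOf φ u p.2 p.1)) := by
    rw [Measure.volume_eq_prod] at key ⊢
    exact (Measure.measurePreserving_swap (μ := (volume : Measure ℝ))
      (ν := (volume : Measure ℝ))).quasiMeasurePreserving.ae key
  rw [Measure.volume_eq_prod] at h3
  filter_upwards [Measure.ae_ae_of_ae_prod h3] with t ht htT
  filter_upwards [ht] with x hx hxab using hx hxab htT

/-- Integration by parts of an increment in time of the saturation against a test function. -/
theorem integral_increment (h : IsLayerFlow a b T m L φ u W) (hab : a ≤ b) {t s : ℝ}
    (ht : t ∈ Icc 0 T) (hs : s ∈ Icc 0 T) {ζ : ℝ → ℝ} {K : ℝ} (hK : 0 ≤ K)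
    (hζ : ∀ x y, |ζ x - ζ y| ≤ K * |x - y|) (ha : ζ a = 0) (hb : ζ b = 0) :
    ∫ x in a..b, m * (u x t - u x s) * ζ x =
      - ∫ x in a..b, deriv ζ x * (W x t - W x s) := by
  -- `Y` coincides with `W(·,t) - W(·,s)` on `[a,b]` only, but it is differentiable on the whole
  -- line, including at the end points.
  set Y : ℝ → ℝ := fun x => W a t - W a s + ∫ z in a..x, m * (u z t - u z s) with hY
  have hcu : Continuous fun z => m * (u z t - u z s) := continuous_const.mul
    ((h.continuous_saturation_left t).sub (h.continuous_saturation_left s))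
  have hYd : ∀ x, HasDerivAt Y (m * (u x t - u x s)) x := fun x =>
    (hcu.integral_hasStrictDerivAt a x).hasDerivAt.const_add _
  have hYe : ∀ x ∈ Icc a b, Y x = W x t - W x s := by
    intro x hx
    have e1 := h.balance t ht x hx
    have e2 := h.balance s hs x hx
    have e3 : ∫ z in a..x, m * (u z t - u z s) =
        (∫ z in a..x, m * (u z t - u z 0)) - ∫ z in a..x, m * (u z s - u z 0) := by
      rw [← intervalIntegral.integral_sub]
      · congr 1; ext z; ring
      · exact (continuous_const.mul ((h.continuous_saturation_left t).sub
          (h.continuous_saturation_left 0))).intervalIntegrable _ _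
      · exact (continuous_const.mul ((h.continuous_saturation_left s).sub
          (h.continuous_saturation_left 0))).intervalIntegrable _ _
    simp only [hY, e3]; linarith
  have hYac : AbsolutelyContinuousOnInterval Y a b := by
    have := hcu.intervalIntegrable (μ := volume) a b
    have h2 : LipschitzOnWith ⟨|m|, abs_nonneg m⟩ Y (uIcc a b) := by
      refine Convex.lipschitzOnWith_of_nnnorm_hasDerivWithin_le (convex_uIcc a b)
        (fun x _ => (hYd x).hasDerivWithinAt) fun x _ => ?_
      refine NNReal.coe_le_coe.1 (show |m * (u x t - u x s)| ≤ |m| from ?_)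
      rw [abs_mul]
      have h1 := h.mem x t
      have h2 := h.mem x s
      exact mul_le_of_le_one_right (abs_nonneg _)
        (abs_le.2 ⟨by linarith [h1.1, h2.2], by linarith [h1.2, h2.1]⟩)
    exact h2.absolutelyContinuousOnInterval
  have hζac : AbsolutelyContinuousOnInterval ζ a b :=
    ((lipschitzWith_of_abs hK hζ).lipschitzOnWith (s := uIcc a b)).absolutelyContinuousOnInterval
  have e := AbsolutelyContinuousOnInterval.integral_mul_deriv_eq_deriv_mul hζac hYac
  rw [ha, hb] at e
  calc ∫ x in a..b, m * (u x t - u x s) * ζ x = ∫ x in a..b, ζ x * deriv Y x := by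
        refine intervalIntegral.integral_congr fun x _ => ?_
        simp only [(hYd x).deriv]; ring
    _ = - ∫ x in a..b, deriv ζ x * Y x := by rw [e]; ring
    _ = _ := by
        congr 1
        refine intervalIntegral.integral_congr fun x hx => ?_
        rw [uIcc_of_le hab] at hx
        simp only [hYe x hx]

end IsLayerFlow

/-! ### Differentiation of functionals in time by backward differences. -/

/-- After a translation the integral is the mean of `A` over a window of length `1/(n+1)` ending at
`t₂`, minus the same mean at `t₁`. Continuity of `A` is enough, so functionals without a time
derivative can be treated. -/
theorem tendsto_backward_average {A : ℝ → ℝ} (hA : Continuous A) (t₁ t₂ : ℝ) :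
    Tendsto (fun n : ℕ => ∫ t in t₁..t₂, (A t - A (t - 1 / (n + 1 : ℝ))) * (n + 1 : ℝ)) atTop
      (𝓝 (A t₂ - A t₁)) := by
  have hi : ∀ x y, IntervalIntegrable A volume x y := fun x y => hA.intervalIntegrable x y
  have hd : ∀ c, HasDerivAt (fun h => ∫ t in (0 : ℝ)..c + h, A t) (A c) 0 := by
    intro c
    have h1 : HasDerivAt (fun x => ∫ t in (0 : ℝ)..x, A t) (A c) (c + 0) := by
      simpa using (hA.integral_hasStrictDerivAt 0 c).hasDerivAt
    exact h1.comp_const_add c 0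
  have hd2 := (hd t₂).sub (hd t₁)
  have h1 := hasDerivAt_iff_tendsto_slope_zero.1 hd2
  have h2 : Tendsto (fun n : ℕ => -(1 / (n + 1 : ℝ))) atTop (𝓝[≠] 0) := by
    rw [tendsto_nhdsWithin_iff]
    constructor
    · simpa using (tendsto_one_div_add_atTop_nhds_zero_nat (𝕜 := ℝ)).neg
    · exact Eventually.of_forall fun n => by
        have : (0 : ℝ) < 1 / (n + 1 : ℝ) := by positivity
        simp only [mem_compl_iff, mem_singleton_iff]; linarith
  refine (h1.comp h2).congr fun n => ?_
  have hA2 : IntervalIntegrable (fun t => A (t - 1 / (n + 1 : ℝ))) volume t₁ t₂ :=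
    Continuous.intervalIntegrable (by fun_prop) _ _
  rw [intervalIntegral.integral_mul_const, intervalIntegral.integral_sub (hi _ _) hA2,
    intervalIntegral.integral_comp_sub_right (fun x => A x)]
  change (-(1 / (n + 1 : ℝ)))⁻¹ * (((∫ t in (0 : ℝ)..t₂ + (0 + -(1 / (n + 1 : ℝ))), A t) -
    ∫ t in (0 : ℝ)..t₁ + (0 + -(1 / (n + 1 : ℝ))), A t) -
    ((∫ t in (0 : ℝ)..t₂ + 0, A t) - ∫ t in (0 : ℝ)..t₁ + 0, A t)) = _
  rw [zero_add, add_zero, add_zero, ← sub_eq_add_neg, ← sub_eq_add_neg]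
  rw [← intervalIntegral.integral_interval_sub_left (hi 0 t₂) (hi 0 t₁),
    ← intervalIntegral.integral_interval_sub_left (hi 0 (t₂ - 1 / (n + 1 : ℝ)))
      (hi 0 (t₁ - 1 / (n + 1 : ℝ)))]
  generalize (∫ t in (0 : ℝ)..t₂ - 1 / (n + 1 : ℝ), A t) = x₁
  generalize (∫ t in (0 : ℝ)..t₁ - 1 / (n + 1 : ℝ), A t) = x₂
  field_simp
  ring

namespace IsLayerFlow

variable {a b T m L : ℝ} {φ : ℝ → ℝ} {u W : ℝ → ℝ → ℝ}

/-- A functional `A` whose increments are dominated by the increments of the saturation tested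
against `ζ` decreases at least at the rate given by the flux. -/
theorem functional_increment_le (h : IsLayerFlow a b T m L φ u W) (hφ : Continuous φ) (hab : a ≤ b)
    {ζ : ℝ → ℝ → ℝ} (hζc : Continuous (Function.uncurry ζ)) {K : ℝ} (hK : 0 ≤ K)
    (hζ : ∀ t x y, |ζ x t - ζ y t| ≤ K * |x - y|) (ha : ∀ t, ζ a t = 0) (hb : ∀ t, ζ b t = 0)
    {A : ℝ → ℝ} (hA : Continuous A) (hAζ : ∀ t ∈ Icc 0 T, ∀ s ∈ Icc 0 T,
      A t - A s ≤ ∫ x in a..b, m * (u x t - u x s) * ζ x t)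
    {t₁ t₂ : ℝ} (h1 : 0 < t₁) (h12 : t₁ ≤ t₂) (h2 : t₂ < T) :
    A t₂ - A t₁ ≤
      - ∫ t in t₁..t₂, ∫ x in a..b, deriv (fun y => ζ y t) x * fluxOf φ u x t := by
  have hT : 0 < T := by linarith
  have hdm : Measurable fun p : ℝ × ℝ => deriv (fun y => ζ y p.1) p.2 := by
    have : Continuous (Function.uncurry (fun t y => ζ y t)) := by
      change Continuous (fun p : ℝ × ℝ => Function.uncurry ζ (p.2, p.1))
      fun_prop
    exact measurable_deriv_with_param this
  have hdb : ∀ t x, |deriv (fun y => ζ y t) x| ≤ K := fun t x => abs_deriv_le_of_lip hK (hζ t) x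
  have hqm : ∀ n : ℕ, Measurable fun p : ℝ × ℝ => deriv (fun y => ζ y p.1) p.2 *
      ((W p.2 p.1 - W p.2 (p.1 - 1 / (n + 1 : ℝ))) * (n + 1 : ℝ)) := by
    intro n
    have h1 : Continuous fun p : ℝ × ℝ => W p.2 p.1 := h.contW.comp (by fun_prop :
      Continuous fun p : ℝ × ℝ => (p.2, p.1))
    have h2 : Continuous fun p : ℝ × ℝ => W p.2 (p.1 - 1 / (n + 1 : ℝ)) :=
      h.contW.comp (by fun_prop : Continuous fun p : ℝ × ℝ => (p.2, p.1 - 1 / (n + 1 : ℝ)))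
    exact hdm.mul ((h1.sub h2).mul continuous_const).measurable
  have hlim0 : Tendsto (fun n : ℕ => 1 / (n + 1 : ℝ)) atTop (𝓝 0) :=
    tendsto_one_div_add_atTop_nhds_zero_nat
  have hsmall : ∀ᶠ n : ℕ in atTop, 1 / (n + 1 : ℝ) < t₁ := hlim0.eventually (gt_mem_nhds h1)
  have hbound : ∀ᶠ n : ℕ in atTop, ∀ t ∈ Icc t₁ t₂, ∀ x ∈ Icc a b,
      |deriv (fun y => ζ y t) x * ((W x t - W x (t - 1 / (n + 1 : ℝ))) * (n + 1 : ℝ))|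
        ≤ K * L := by
    filter_upwards [hsmall] with n hn t ht x hx
    have hn0 : (0 : ℝ) < 1 / (n + 1 : ℝ) := by positivity
    have hn1 : (0 : ℝ) < n + 1 := by positivity
    have := h.lipW x hx t (t - 1 / (n + 1 : ℝ))
    rw [sub_sub_cancel, abs_of_pos hn0] at this
    rw [abs_mul]
    refine mul_le_mul (hdb t x) ?_ (abs_nonneg _) hK
    rw [abs_mul, abs_of_pos hn1]
    calc |W x t - W x (t - 1 / (n + 1 : ℝ))| * (n + 1 : ℝ)
        ≤ L * (1 / (n + 1 : ℝ)) * (n + 1 : ℝ) := by gcongr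
      _ = L := by field_simp
  -- The test function is taken at the later time `t`, so `n` enters only through the backward
  -- quotient of `W`. That quotient is bounded by `L` and converges to the flux almost everywhere,
  -- so dominated convergence applies in `x` and then in `t`.
  have hinner : ∀ᵐ t, t ∈ Ioc t₁ t₂ → Tendsto (fun n : ℕ => ∫ x in a..b,
      deriv (fun y => ζ y t) x * ((W x t - W x (t - 1 / (n + 1 : ℝ))) * (n + 1 : ℝ))) atTop
      (𝓝 (∫ x in a..b, deriv (fun y => ζ y t) x * fluxOf φ u x t)) := by
    filter_upwards [h.ae_tendsto_quotient hφ hT] with t ht htm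
    have ht' := ht ⟨h1.trans htm.1, htm.2.trans_lt h2⟩
    refine intervalIntegral.tendsto_integral_filter_of_dominated_convergence (fun _ => K * L)
      ?_ ?_ intervalIntegrable_const ?_
    · exact Eventually.of_forall fun n =>
        ((hqm n).comp (measurable_prodMk_left (x := t))).aestronglyMeasurable
    · filter_upwards [hbound] with n hn
      refine Eventually.of_forall fun x hx => ?_
      rw [uIoc_of_le hab] at hx
      exact hn t (Ioc_subset_Icc_self htm) x (Ioc_subset_Icc_self hx)
    · have hbne : ∀ᵐ x : ℝ, x ≠ b := by simp [ae_iff, measure_singleton]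
      filter_upwards [ht', hbne] with x hx hxb hxm
      rw [uIoc_of_le hab] at hxm
      exact (hx ⟨hxm.1, lt_of_le_of_ne hxm.2 hxb⟩).const_mul _
  have houter : Tendsto (fun n : ℕ => ∫ t in t₁..t₂, ∫ x in a..b,
      deriv (fun y => ζ y t) x * ((W x t - W x (t - 1 / (n + 1 : ℝ))) * (n + 1 : ℝ))) atTop
      (𝓝 (∫ t in t₁..t₂, ∫ x in a..b, deriv (fun y => ζ y t) x * fluxOf φ u x t)) := by
    refine intervalIntegral.tendsto_integral_filter_of_dominated_convergence
      (fun _ => K * L * |b - a|) ?_ ?_ intervalIntegrable_const ?_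
    · refine Eventually.of_forall fun n => ?_
      simp_rw [intervalIntegral.integral_of_le hab]
      exact ((hqm n).stronglyMeasurable.integral_prod_right'
        (ν := volume.restrict (Ioc a b))).aestronglyMeasurable
    · filter_upwards [hbound] with n hn
      refine Eventually.of_forall fun t htm => ?_
      rw [uIoc_of_le h12] at htm
      refine intervalIntegral.norm_integral_le_of_norm_le_const fun x hx => ?_
      rw [uIoc_of_le hab] at hx
      exact hn t (Ioc_subset_Icc_self htm) x (Ioc_subset_Icc_self hx)
    · filter_upwards [hinner] with t ht htm
      rw [uIoc_of_le h12] at htm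
      exact ht htm
  refine le_of_tendsto_of_tendsto (tendsto_backward_average hA t₁ t₂) houter.neg ?_
  filter_upwards [hsmall, hbound] with n hn hbn
  have hn0 : (0 : ℝ) < 1 / (n + 1 : ℝ) := by positivity
  have hn1 : (0 : ℝ) < n + 1 := by positivity
  rw [← intervalIntegral.integral_neg]
  refine intervalIntegral.integral_mono_on h12 ?_ ?_ fun t ht => ?_
  · exact ((hA.sub (hA.comp (by fun_prop))).mul continuous_const).intervalIntegrable _ _
  · refine IntervalIntegrable.neg ?_
    rw [intervalIntegrable_iff_integrableOn_Ioc_of_le h12]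
    refine Measure.integrableOn_of_bounded (M := K * L * |b - a|) measure_Ioc_lt_top.ne ?_ ?_
    · simp_rw [intervalIntegral.integral_of_le hab]
      exact ((hqm n).stronglyMeasurable.integral_prod_right'
        (ν := volume.restrict (Ioc a b))).aestronglyMeasurable
    · rw [ae_restrict_iff' measurableSet_Ioc]
      refine Eventually.of_forall fun t htm => ?_
      refine intervalIntegral.norm_integral_le_of_norm_le_const fun x hx => ?_
      rw [uIoc_of_le hab] at hx
      exact hbn t (Ioc_subset_Icc_self htm) x (Ioc_subset_Icc_self hx)
  · have htT : t ∈ Icc 0 T := ⟨by linarith [ht.1], by linarith [ht.2]⟩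
    have hsT : t - 1 / (n + 1 : ℝ) ∈ Icc 0 T := ⟨by linarith [ht.1], by linarith [ht.2]⟩
    have e1 := hAζ t htT _ hsT
    rw [h.integral_increment hab htT hsT hK (hζ t) (ha t) (hb t)] at e1
    calc (A t - A (t - 1 / (n + 1 : ℝ))) * (n + 1 : ℝ)
        ≤ (- ∫ x in a..b, deriv (fun y => ζ y t) x * (W x t - W x (t - 1 / (n + 1 : ℝ)))) *
          (n + 1 : ℝ) := by gcongr
      _ = _ := by
        rw [neg_mul, ← intervalIntegral.integral_mul_const]
        congr 1
        refine intervalIntegral.integral_congr fun x _ => ?_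
        ring

end IsLayerFlow

/-! ### Entropies relative to a frozen profile. -/

/-- The semi-Kruzhkov type function `∫_c^p S(φ(α) - φ(c)) dα`. -/
noncomputable def entropy (φ S : ℝ → ℝ) (p c : ℝ) : ℝ := ∫ α in c..p, S (φ α - φ c)

theorem continuous_entropy {φ S : ℝ → ℝ} (hφ : Continuous φ) (hS : Continuous S) :
    Continuous (fun q : ℝ × ℝ => entropy φ S q.1 q.2) := by
  have h1 : Continuous (Function.uncurry fun (q : ℝ × ℝ) (α : ℝ) => S (φ α - φ q.2)) := by
    change Continuous fun z : (ℝ × ℝ) × ℝ => S (φ z.2 - φ z.1.2)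
    fun_prop
  have e : (fun q : ℝ × ℝ => entropy φ S q.1 q.2) = fun q : ℝ × ℝ =>
      (∫ α in (0 : ℝ)..q.1, S (φ α - φ q.2)) - ∫ α in (0 : ℝ)..q.2, S (φ α - φ q.2) := by
    ext q
    have hi : ∀ x y, IntervalIntegrable (fun α => S (φ α - φ q.2)) volume x y := fun x y =>
      (by fun_prop : Continuous fun α => S (φ α - φ q.2)).intervalIntegrable x y
    exact (intervalIntegral.integral_interval_sub_left (hi _ _) (hi _ _)).symm
  rw [e]
  exact (intervalIntegral.continuous_parametric_intervalIntegral_of_continuous h1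
    continuous_fst).sub (intervalIntegral.continuous_parametric_intervalIntegral_of_continuous h1
    continuous_snd)

/-- The entropy is convex in `p`, with derivative `S(φ(p) - φ(c))`, and lies above its tangent at
`p'`. This replaces the chain rule in time, which is not available for `u`. -/
theorem entropy_sub_le {φ S : ℝ → ℝ} (hφ : Continuous φ) (hφm : Monotone φ) (hS : Continuous S)
    (hSm : Monotone S) (p p' c : ℝ) :
    entropy φ S p' c - entropy φ S p c ≤ (p' - p) * S (φ p' - φ c) := by
  have hc : Continuous fun α => S (φ α - φ c) := by fun_prop
  have hi : ∀ x y, IntervalIntegrable (fun α => S (φ α - φ c)) volume x y := fun x y =>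
    hc.intervalIntegrable x y
  rw [entropy, entropy, intervalIntegral.integral_interval_sub_left (hi _ _) (hi _ _)]
  have e : (p' - p) * S (φ p' - φ c) = ∫ _ in p..p', S (φ p' - φ c) := by simp
  rw [e]
  rcases le_total p p' with hp | hp
  · exact intervalIntegral.integral_mono_on hp (hi _ _) intervalIntegrable_const fun x hx =>
      hSm (sub_le_sub_right (hφm hx.2) _)
  · rw [intervalIntegral.integral_symm, intervalIntegral.integral_symm p' p, neg_le_neg_iff]
    exact intervalIntegral.integral_mono_on hp intervalIntegrable_const (hi _ _) fun x hx =>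
      hSm (sub_le_sub_right (hφm hx.1) _)

theorem lip_mul {f g : ℝ → ℝ} {Kf Kg : ℝ} (hf : ∀ x y, |f x - f y| ≤ Kf * |x - y|)
    (hg : ∀ x y, |g x - g y| ≤ Kg * |x - y|) (hf1 : ∀ x, |f x| ≤ 1) (hg1 : ∀ x, |g x| ≤ 1)
    (x y : ℝ) : |f x * g x - f y * g y| ≤ (Kf + Kg) * |x - y| := by
  have e : f x * g x - f y * g y = (f x - f y) * g x + f y * (g x - g y) := by ring
  rw [e, add_mul]
  refine (abs_add_le _ _).trans (add_le_add ?_ ?_)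
  · rw [abs_mul]
    exact (mul_le_of_le_one_right (abs_nonneg _) (hg1 x)).trans (hf x y)
  · rw [abs_mul]
    exact (mul_le_of_le_one_left (abs_nonneg _) (hf1 y)).trans (hg x y)

theorem continuous_of_lip {f : ℝ → ℝ} {K : ℝ} (hf : ∀ x y, |f x - f y| ≤ K * |x - y|) :
    Continuous f := by
  have hK : 0 ≤ K := by simpa using (abs_nonneg _).trans (hf 0 1)
  exact (lipschitzWith_of_abs hK hf).continuous

namespace IsLayerFlow

variable {a b T m L : ℝ} {φ : ℝ → ℝ} {u W : ℝ → ℝ → ℝ}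

/-- The entropy inequality for a solution on a layer, relative to a fixed profile `k`. -/
theorem entropy_increment_le (h : IsLayerFlow a b T m L φ u W) (hφ : Continuous φ)
    (hφm : Monotone φ) (hab : a ≤ b) (hm : 0 ≤ m) {k : ℝ → ℝ} (hk : Continuous k)
    (hkl : ∀ x y, |φ (k x) - φ (k y)| ≤ L * |x - y|)
    {ξ S : ℝ → ℝ} {Kξ KS : ℝ} (hξ : ∀ x y, |ξ x - ξ y| ≤ Kξ * |x - y|)
    (hξ0 : ∀ x, 0 ≤ ξ x) (hξ1 : ∀ x, |ξ x| ≤ 1) (hξa : ξ a = 0) (hξb : ξ b = 0)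
    (hS : ∀ x y, |S x - S y| ≤ KS * |x - y|) (hSm : Monotone S) (hS1 : ∀ x, |S x| ≤ 1)
    {t₁ t₂ : ℝ} (h1 : 0 < t₁) (h12 : t₁ ≤ t₂) (h2 : t₂ < T) :
    (∫ x in a..b, ξ x * (m * entropy φ S (u x t₂) (k x))) -
        (∫ x in a..b, ξ x * (m * entropy φ S (u x t₁) (k x))) ≤
      - ∫ t in t₁..t₂, ∫ x in a..b,
        deriv (fun y => ξ y * S (φ (u y t) - φ (k y))) x * fluxOf φ u x t := by
  have hξc := continuous_of_lip hξ
  have hSc := continuous_of_lip hS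
  have hKξ : 0 ≤ Kξ := by simpa using (abs_nonneg _).trans (hξ 0 1)
  have hKS : 0 ≤ KS := by simpa using (abs_nonneg _).trans (hS 0 1)
  have hL := h.nonneg_lip
  have huc := h.cont
  have hIc : Continuous (Function.uncurry fun t x => ξ x * (m * entropy φ S (u x t) (k x))) := by
    have : Continuous fun p : ℝ × ℝ => (Function.uncurry u (p.2, p.1), k p.2) := by fun_prop
    have h3 := (continuous_entropy hφ hSc).comp this
    exact (hξc.comp continuous_snd).mul (continuous_const.mul h3)
  have hζc : Continuous (Function.uncurry fun y t => ξ y * S (φ (u y t) - φ (k y))) := by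
    change Continuous fun p : ℝ × ℝ => ξ p.1 * S (φ (Function.uncurry u p) - φ (k p.1))
    fun_prop
  -- The test function is admissible because `φ(u)` and `φ(k)`, though not `u` and `k`, are
  -- `L`-Lipschitz in space; the constant comes from the product rule.
  refine h.functional_increment_le hφ hab (ζ := fun y t => ξ y * S (φ (u y t) - φ (k y)))
    (K := Kξ + KS * (L + L)) hζc (by positivity) (fun t => ?_) (by simp [hξa]) (by simp [hξb])
    (A := fun t => ∫ x in a..b, ξ x * (m * entropy φ S (u x t) (k x)))
    (intervalIntegral.continuous_parametric_intervalIntegral_of_continuous' hIc a b) ?_ h1 h12 h2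
  · refine lip_mul hξ (fun x y => ?_) hξ1 (fun x => hS1 _)
    refine (hS _ _).trans ?_
    rw [mul_assoc]
    refine mul_le_mul_of_nonneg_left ?_ hKS
    have e : φ (u x t) - φ (k x) - (φ (u y t) - φ (k y)) =
      (φ (u x t) - φ (u y t)) - (φ (k x) - φ (k y)) := by ring
    rw [e, add_mul]
    exact (abs_sub _ _).trans (add_le_add (h.lip t x y) (hkl x y))
  · intro t _ s _
    have hc : ∀ t, Continuous fun x => ξ x * (m * entropy φ S (u x t) (k x)) := fun t =>
      hIc.comp (by fun_prop : Continuous fun x : ℝ => (t, x))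
    rw [← intervalIntegral.integral_sub ((hc t).intervalIntegrable _ _)
      ((hc s).intervalIntegrable _ _)]
    refine intervalIntegral.integral_mono_on hab (((hc t).sub (hc s)).intervalIntegrable _ _)
      (Continuous.intervalIntegrable (by fun_prop) _ _) fun x _ => ?_
    have e := entropy_sub_le hφ hφm hSc hSm (u x s) (u x t) (k x)
    have e2 := mul_le_mul_of_nonneg_left e (mul_nonneg (hξ0 x) hm)
    calc _ = ξ x * m * (entropy φ S (u x t) (k x) - entropy φ S (u x s) (k x)) := by ring
      _ ≤ _ := e2
      _ = _ := by ring

end IsLayerFlow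

/-! ### Doubling of the time variable on a layer. -/

theorem measurable_intervalIntegral {α : Type*} [MeasurableSpace α] {F : α → ℝ → ℝ}
    (hF : Measurable (Function.uncurry F)) (c d : ℝ) : Measurable fun p => ∫ x in c..d, F p x := by
  unfold intervalIntegral
  exact ((hF.stronglyMeasurable.integral_prod_right' (ν := volume.restrict (Ioc c d))).sub
    (hF.stronglyMeasurable.integral_prod_right' (ν := volume.restrict (Ioc d c)))).measurable

theorem abs_intervalIntegral_le {f : ℝ → ℝ} {C : ℝ} (hf : ∀ x, |f x| ≤ C) (c d : ℝ) :
    |∫ x in c..d, f x| ≤ C * |d - c| :=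
  (Real.norm_eq_abs _).symm.trans_le
    (intervalIntegral.norm_integral_le_of_norm_le_const fun x _ => hf x)

theorem intervalIntegral_swap_of_bounded {F : ℝ → ℝ → ℝ} (hF : Measurable (Function.uncurry F))
    {C : ℝ} (hC : ∀ x y, |F x y| ≤ C) (a b c d : ℝ) :
    ∫ x in a..b, ∫ y in c..d, F x y = ∫ y in c..d, ∫ x in a..b, F x y := by
  refine intervalIntegral_intervalIntegral_swap ?_
  refine Measure.integrableOn_of_bounded (M := C) ?_ hF.aestronglyMeasurable
    (Eventually.of_forall fun p => hC _ _)
  rw [Measure.volume_eq_prod, Measure.prod_prod]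
  simp [uIoc, ENNReal.mul_eq_top]

/-- The derivative of a composition with a monotone function has the sign of the derivative. -/
theorem deriv_comp_mul_deriv_nonneg {S r : ℝ → ℝ} (hS : Monotone S) {x : ℝ}
    (hr : DifferentiableAt ℝ r x) (hSr : DifferentiableAt ℝ (fun y => S (r y)) x) :
    0 ≤ deriv (fun y => S (r y)) x * deriv r x := by
  have h1 := hasDerivAt_iff_tendsto_slope.1 hr.hasDerivAt
  have h2 := hasDerivAt_iff_tendsto_slope.1 hSr.hasDerivAt
  refine ge_of_tendsto' (h2.mul h1) fun y => ?_
  simp only [slope_def_field]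
  rw [div_mul_div_comm]
  refine div_nonneg ?_ (mul_self_nonneg _)
  rcases le_total (r y) (r x) with h | h
  · exact mul_nonneg_of_nonpos_of_nonpos (sub_nonpos.2 (hS h)) (sub_nonpos.2 h)
  · exact mul_nonneg (sub_nonneg.2 (hS h)) (sub_nonneg.2 h)

/-- The doubled functional `∫ ξ m ∫_c^p S(φ(α) - φ(c)) dα` with `p = u(x,t)`, `c = v(x,s)`. -/
noncomputable def doubled (a b m : ℝ) (φ ξ S : ℝ → ℝ) (u v : ℝ → ℝ → ℝ) (t s : ℝ) : ℝ :=
  ∫ x in a..b, ξ x * (m * entropy φ S (u x t) (v x s))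

theorem continuous_doubled {a b m : ℝ} {φ ξ S : ℝ → ℝ} {u v : ℝ → ℝ → ℝ} (hφ : Continuous φ)
    (hξ : Continuous ξ) (hS : Continuous S) (hu : Continuous (Function.uncurry u))
    (hv : Continuous (Function.uncurry v)) :
    Continuous fun p : ℝ × ℝ => doubled a b m φ ξ S u v p.1 p.2 := by
  refine intervalIntegral.continuous_parametric_intervalIntegral_of_continuous' ?_ a b
  have : Continuous fun p : (ℝ × ℝ) × ℝ =>
    (Function.uncurry u (p.2, p.1.1), Function.uncurry v (p.2, p.1.2)) := by fun_prop
  have h3 := (continuous_entropy hφ hS).comp this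
  exact (hξ.comp continuous_snd).mul (continuous_const.mul h3)

namespace IsLayerFlow

variable {a b T m L : ℝ} {φ : ℝ → ℝ} {u W v V : ℝ → ℝ → ℝ}

/-- Entropy inequality in doubled time variables, integrated over a rectangle. -/
theorem doubled_rectangle_le (h : IsLayerFlow a b T m L φ u W) (h' : IsLayerFlow a b T m L φ v V)
    (hφ : Continuous φ) (hφm : Monotone φ) (hab : a ≤ b) (hm : 0 ≤ m)
    {ξ S : ℝ → ℝ} {Kξ KS : ℝ} (hξ : ∀ x y, |ξ x - ξ y| ≤ Kξ * |x - y|)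
    (hξ0 : ∀ x, 0 ≤ ξ x) (hξ1 : ∀ x, |ξ x| ≤ 1) (hξa : ξ a = 0) (hξb : ξ b = 0)
    (hS : ∀ x y, |S x - S y| ≤ KS * |x - y|) (hSm : Monotone S) (hS1 : ∀ x, |S x| ≤ 1)
    {t₁ t₂ s₁ s₂ : ℝ} (ht1 : 0 < t₁) (ht12 : t₁ ≤ t₂) (ht2 : t₂ < T)
    (hs1 : 0 < s₁) (hs12 : s₁ ≤ s₂) (hs2 : s₂ < T) :
    (∫ s in s₁..s₂, (doubled a b m φ ξ S u v t₂ s - doubled a b m φ ξ S u v t₁ s)) +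
      (∫ t in t₁..t₂, (doubled a b m φ ξ (fun r => -S (-r)) v u s₂ t -
        doubled a b m φ ξ (fun r => -S (-r)) v u s₁ t)) ≤
      ∫ t in t₁..t₂, ∫ s in s₁..s₂, - ∫ x in a..b,
        deriv ξ x * deriv (fun y => ∫ ρ in (0 : ℝ)..φ (u y t) - φ (v y s), S ρ) x := by
  have hξc := continuous_of_lip hξ
  have hSc := continuous_of_lip hS
  have hKξ : 0 ≤ Kξ := by simpa using (abs_nonneg _).trans (hξ 0 1)
  have hKS : 0 ≤ KS := by simpa using (abs_nonneg _).trans (hS 0 1)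
  have hL := h.nonneg_lip
  have huc := h.cont
  have hvc := h'.cont
  have hrl : ∀ t s x y, |(φ (u x t) - φ (v x s)) - (φ (u y t) - φ (v y s))| ≤
      (L + L) * |x - y| := fun t s x y => by
    have e : φ (u x t) - φ (v x s) - (φ (u y t) - φ (v y s)) =
      (φ (u x t) - φ (u y t)) - (φ (v x s) - φ (v y s)) := by ring
    rw [e, add_mul]
    exact (abs_sub _ _).trans (add_le_add (h.lip t x y) (h'.lip s x y))
  have hSrl : ∀ t s x y, |S (φ (u x t) - φ (v x s)) - S (φ (u y t) - φ (v y s))| ≤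
      KS * (L + L) * |x - y| := fun t s x y => by
    refine (hS _ _).trans ?_
    rw [mul_assoc]
    exact mul_le_mul_of_nonneg_left (hrl t s x y) hKS
  set D : ℝ → ℝ → ℝ → ℝ := fun t s x =>
    deriv (fun y => ξ y * S (φ (u y t) - φ (v y s))) x with hD
  have hDb : ∀ t s x, |D t s x| ≤ Kξ + KS * (L + L) := fun t s x =>
    abs_deriv_le_of_lip (by positivity)
      (lip_mul hξ (hSrl t s) hξ1 fun x => hS1 _) x
  have hDm : Measurable fun p : (ℝ × ℝ) × ℝ => D p.1.1 p.1.2 p.2 := by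
    have : Continuous (Function.uncurry fun (p : ℝ × ℝ) y =>
        ξ y * S (φ (u y p.1) - φ (v y p.2))) := by
      change Continuous fun q : (ℝ × ℝ) × ℝ => ξ q.2 *
        S (φ (Function.uncurry u (q.2, q.1.1)) - φ (Function.uncurry v (q.2, q.1.2)))
      fun_prop
    exact measurable_deriv_with_param this
  have hgu : Measurable fun p : (ℝ × ℝ) × ℝ => fluxOf φ u p.2 p.1.1 :=
    (measurable_fluxOf hφ h.cont).comp
      (by fun_prop : Measurable fun p : (ℝ × ℝ) × ℝ => (p.1.1, p.2))
  have hgv : Measurable fun p : (ℝ × ℝ) × ℝ => fluxOf φ v p.2 p.1.2 :=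
    (measurable_fluxOf hφ h'.cont).comp
      (by fun_prop : Measurable fun p : (ℝ × ℝ) × ℝ => (p.1.2, p.2))
  set X : ℝ → ℝ → ℝ := fun t s => ∫ x in a..b, D t s x * fluxOf φ u x t with hX
  set Y : ℝ → ℝ → ℝ := fun t s => ∫ x in a..b, D t s x * fluxOf φ v x s with hY
  have hXm : Measurable (Function.uncurry X) := measurable_intervalIntegral
    (F := fun (p : ℝ × ℝ) x => D p.1 p.2 x * fluxOf φ u x p.1) (hDm.mul hgu) a b
  have hYm : Measurable (Function.uncurry Y) := measurable_intervalIntegral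
    (F := fun (p : ℝ × ℝ) x => D p.1 p.2 x * fluxOf φ v x p.2) (hDm.mul hgv) a b
  set C : ℝ := (Kξ + KS * (L + L)) * L * |b - a|
  have hXb : ∀ t s, |X t s| ≤ C := fun t s => abs_intervalIntegral_le (fun x => by
    rw [abs_mul]
    exact mul_le_mul (hDb t s x) (h.abs_fluxOf_le x t) (abs_nonneg _) (by positivity)) a b
  have hYb : ∀ t s, |Y t s| ≤ C := fun t s => abs_intervalIntegral_le (fun x => by
    rw [abs_mul]
    exact mul_le_mul (hDb t s x) (h'.abs_fluxOf_le x s) (abs_nonneg _) (by positivity)) a b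
  have hXs : Measurable (Function.uncurry fun s t => X t s) := hXm.comp measurable_swap
  -- For each `s` the profile `v(·,s)` is frozen while `u` evolves in `t`.
  have hfirst : (∫ s in s₁..s₂, (doubled a b m φ ξ S u v t₂ s - doubled a b m φ ξ S u v t₁ s)) ≤
      ∫ s in s₁..s₂, - ∫ t in t₁..t₂, X t s := by
    have hc := continuous_doubled (a := a) (b := b) (m := m) hφ hξc hSc huc hvc
    refine intervalIntegral.integral_mono_on hs12 ?_ ?_ fun s _ => ?_
    · exact ((hc.comp (by fun_prop : Continuous fun s : ℝ => (t₂, s))).sub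
        (hc.comp (by fun_prop : Continuous fun s : ℝ => (t₁, s)))).intervalIntegrable _ _
    · exact (intervalIntegrable_of_measurable_of_bounded (measurable_intervalIntegral hXs t₁ t₂)
        (fun s => abs_intervalIntegral_le (fun t => hXb t s) t₁ t₂) _ _).neg
    · exact h.entropy_increment_le hφ hφm hab hm (h'.continuous_saturation_left s)
        (fun x y => h'.lip s x y) hξ hξ0 hξ1 hξa hξb hS hSm hS1 ht1 ht12 ht2
  have hS' : ∀ x y, |-S (-x) - -S (-y)| ≤ KS * |x - y| := fun x y => by
    have := hS (-y) (-x)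
    rw [neg_sub_neg] at this ⊢
    exact this
  have hSm' : Monotone fun r => -S (-r) := fun x y hxy => neg_le_neg (hSm (neg_le_neg hxy))
  have hS1' : ∀ x, |-S (-x)| ≤ 1 := fun x => by rw [abs_neg]; exact hS1 _
  -- The reflected function is again monotone, and at `φ(v) - φ(u)` it equals `-S(φ(u) - φ(v))`. The
  -- same integrand `D` therefore appears with the opposite sign, and the two fluxes combine into a
  -- difference.
  have hsecond : (∫ t in t₁..t₂, (doubled a b m φ ξ (fun r => -S (-r)) v u s₂ t -
        doubled a b m φ ξ (fun r => -S (-r)) v u s₁ t)) ≤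
      ∫ t in t₁..t₂, ∫ s in s₁..s₂, Y t s := by
    have hc := continuous_doubled (a := a) (b := b) (m := m) hφ hξc (continuous_of_lip hS')
      hvc huc
    refine intervalIntegral.integral_mono_on ht12 ?_ ?_ fun t _ => ?_
    · exact ((hc.comp (by fun_prop : Continuous fun s : ℝ => (s₂, s))).sub
        (hc.comp (by fun_prop : Continuous fun s : ℝ => (s₁, s)))).intervalIntegrable _ _
    · exact (intervalIntegrable_of_measurable_of_bounded (measurable_intervalIntegral hYm s₁ s₂)
        (fun t => abs_intervalIntegral_le (fun s => hYb t s) s₁ s₂) _ _)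
    · refine (h'.entropy_increment_le hφ hφm hab hm (h.continuous_saturation_left t)
        (fun x y => h.lip t x y) hξ hξ0 hξ1 hξa hξb hS' hSm' hS1' hs1 hs12 hs2).trans_eq ?_
      rw [← intervalIntegral.integral_neg]
      refine intervalIntegral.integral_congr fun s _ => ?_
      simp only [hY, hD]
      rw [← intervalIntegral.integral_neg]
      refine intervalIntegral.integral_congr fun x _ => ?_
      have e : (fun y => ξ y * -S (-(φ (v y s) - φ (u y t)))) =
          fun y => -(ξ y * S (φ (u y t) - φ (v y s))) := by
        ext y; rw [neg_sub]; ring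
      simp only [e, deriv.fun_neg]
      ring
  have hXi : IntervalIntegrable (fun t => ∫ s in s₁..s₂, X t s) volume t₁ t₂ :=
    intervalIntegrable_of_measurable_of_bounded (measurable_intervalIntegral hXm s₁ s₂)
        (fun t => abs_intervalIntegral_le (fun s => hXb t s) s₁ s₂) _ _
  have hYi : IntervalIntegrable (fun t => ∫ s in s₁..s₂, Y t s) volume t₁ t₂ :=
    intervalIntegrable_of_measurable_of_bounded (measurable_intervalIntegral hYm s₁ s₂)
        (fun t => abs_intervalIntegral_le (fun s => hYb t s) s₁ s₂) _ _
  refine (add_le_add hfirst hsecond).trans ?_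
  rw [intervalIntegral.integral_neg, ← intervalIntegral_swap_of_bounded hXm hXb, add_comm,
    ← sub_eq_add_neg, ← intervalIntegral.integral_sub hYi hXi]
  set Z : ℝ → ℝ → ℝ := fun t s => ∫ x in a..b,
    deriv ξ x * deriv (fun y => ∫ ρ in (0 : ℝ)..φ (u y t) - φ (v y s), S ρ) x with hZ
  have hPd : ∀ z, HasDerivAt (fun z => ∫ ρ in (0 : ℝ)..z, S ρ) (S z) z := fun z =>
    (hSc.integral_hasStrictDerivAt 0 z).hasDerivAt
  have hPl : ∀ z w, |(∫ ρ in (0 : ℝ)..z, S ρ) - ∫ ρ in (0 : ℝ)..w, S ρ| ≤ 1 * |z - w| := by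
    intro z w
    rw [intervalIntegral.integral_interval_sub_left (hSc.intervalIntegrable _ _)
      (hSc.intervalIntegrable _ _)]
    exact abs_intervalIntegral_le hS1 w z
  have hPrl : ∀ t s x y, |(∫ ρ in (0 : ℝ)..φ (u x t) - φ (v x s), S ρ) -
      ∫ ρ in (0 : ℝ)..φ (u y t) - φ (v y s), S ρ| ≤ (L + L) * |x - y| := fun t s x y =>
    (hPl _ _).trans (by rw [one_mul]; exact hrl t s x y)
  have hZm : Measurable (Function.uncurry Z) := by
    refine measurable_intervalIntegral (F := fun (p : ℝ × ℝ) x =>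
      deriv ξ x * deriv (fun y => ∫ ρ in (0 : ℝ)..φ (u y p.1) - φ (v y p.2), S ρ) x) ?_ a b
    refine ((measurable_deriv ξ).comp measurable_snd).mul ?_
    have hPc : Continuous fun z => ∫ ρ in (0 : ℝ)..z, S ρ := continuous_of_lip hPl
    have : Continuous (Function.uncurry fun (p : ℝ × ℝ) y =>
        ∫ ρ in (0 : ℝ)..φ (u y p.1) - φ (v y p.2), S ρ) := by
      refine hPc.comp ?_
      change Continuous fun q : (ℝ × ℝ) × ℝ =>
        φ (Function.uncurry u (q.2, q.1.1)) - φ (Function.uncurry v (q.2, q.1.2))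
      fun_prop
    exact measurable_deriv_with_param this
  have hdξb : ∀ x, |deriv ξ x| ≤ Kξ := abs_deriv_le_of_lip hKξ hξ
  have hdPb : ∀ t s x, |deriv (fun y => ∫ ρ in (0 : ℝ)..φ (u y t) - φ (v y s), S ρ) x| ≤ L + L :=
    fun t s x => abs_deriv_le_of_lip (by positivity) (hPrl t s) x
  have hZb : ∀ t s, |Z t s| ≤ Kξ * (L + L) * |b - a| := fun t s =>
    abs_intervalIntegral_le (fun x => by
      rw [abs_mul]
      exact mul_le_mul (hdξb x) (hdPb t s x) (abs_nonneg _) hKξ) a b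
  have hsl : ∀ {G : ℝ → ℝ → ℝ}, Measurable (Function.uncurry G) → ∀ t, Measurable (G t) :=
    fun hG t => hG.comp measurable_prodMk_left
  refine intervalIntegral.integral_mono_on ht12 (hYi.sub hXi) ?_ fun t _ => ?_
  · simp_rw [intervalIntegral.integral_neg]
    exact (intervalIntegrable_of_measurable_of_bounded (measurable_intervalIntegral hZm s₁ s₂)
        (fun t => abs_intervalIntegral_le (fun s => hZb t s) s₁ s₂) _ _).neg
  have hXi' := intervalIntegrable_of_measurable_of_bounded (hsl hXm t) (hXb t) s₁ s₂
  have hYi' := intervalIntegrable_of_measurable_of_bounded (hsl hYm t) (hYb t) s₁ s₂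
  rw [← intervalIntegral.integral_sub hYi' hXi']
  refine intervalIntegral.integral_mono_on hs12 (hYi'.sub hXi')
    (intervalIntegrable_of_measurable_of_bounded (hsl hZm t) (hZb t) s₁ s₂).neg fun s _ => ?_
  have hDm' : Measurable (D t s) := measurable_deriv _
  have hgu' : Measurable fun x => fluxOf φ u x t := measurable_deriv _
  have hgv' : Measurable fun x => fluxOf φ v x s := measurable_deriv _
  have i1 : IntervalIntegrable (fun x => D t s x * fluxOf φ u x t) volume a b :=
    intervalIntegrable_of_measurable_of_bounded (hDm'.mul hgu')
      (C := (Kξ + KS * (L + L)) * L) (fun x =>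
        (abs_mul _ _).trans_le (mul_le_mul (hDb t s x) (h.abs_fluxOf_le x t) (abs_nonneg _) (by positivity))) _ _
  have i2 : IntervalIntegrable (fun x => D t s x * fluxOf φ v x s) volume a b :=
    intervalIntegrable_of_measurable_of_bounded (hDm'.mul hgv')
      (C := (Kξ + KS * (L + L)) * L) (fun x =>
        (abs_mul _ _).trans_le (mul_le_mul (hDb t s x) (h'.abs_fluxOf_le x s) (abs_nonneg _) (by positivity))) _ _
  have i3 : IntervalIntegrable (fun x => deriv ξ x *
      deriv (fun y => ∫ ρ in (0 : ℝ)..φ (u y t) - φ (v y s), S ρ) x) volume a b :=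
    intervalIntegrable_of_measurable_of_bounded ((measurable_deriv _).mul (measurable_deriv _))
      (C := Kξ * (L + L)) (fun x =>
        (abs_mul _ _).trans_le (mul_le_mul (hdξb x) (hdPb t s x) (abs_nonneg _) hKξ)) _ _
  simp only [hX, hY]
  rw [← intervalIntegral.integral_sub i2 i1, ← intervalIntegral.integral_neg]
  refine intervalIntegral.integral_mono_ae hab (i2.sub i1) i3.neg ?_
  have dξ := (lipschitzWith_of_abs hKξ hξ).ae_differentiableAt_real
  have du := (lipschitzWith_of_abs hL (h.lip t)).ae_differentiableAt_real
  have dv := (lipschitzWith_of_abs hL (h'.lip s)).ae_differentiableAt_real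
  have dS := (lipschitzWith_of_abs (by positivity) (hSrl t s)).ae_differentiableAt_real
  filter_upwards [dξ, du, dv, dS] with x hx1 hx2 hx3 hx4
  have er : deriv (fun y => φ (u y t) - φ (v y s)) x = fluxOf φ u x t - fluxOf φ v x s :=
    deriv_fun_sub hx2 hx3
  have e1 : D t s x = deriv ξ x * S (φ (u x t) - φ (v x s)) +
      ξ x * deriv (fun y => S (φ (u y t) - φ (v y s))) x := deriv_fun_mul hx1 hx4
  have e2 : deriv (fun y => ∫ ρ in (0 : ℝ)..φ (u y t) - φ (v y s), S ρ) x =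
      S (φ (u x t) - φ (v x s)) * (fluxOf φ u x t - fluxOf φ v x s) := by
    rw [← er]
    exact ((hPd _).comp x (hx2.sub hx3).hasDerivAt).deriv
  -- With `r = φ(u(·,t)) - φ(v(·,s))`, the dissipation `ξ ∂ₓS(r) ∂ₓr` is nonnegative and is
  -- discarded. The remaining term `ξ' S(r) ∂ₓr` is `ξ'` times the derivative of a primitive of `S`
  -- along `r`.
  have e3 := deriv_comp_mul_deriv_nonneg hSm (hx2.sub hx3) hx4
  change 0 ≤ deriv (fun y => S (φ (u y t) - φ (v y s))) x *
    deriv (fun y => φ (u y t) - φ (v y s)) x at e3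
  rw [er] at e3
  have e4 := mul_nonneg (hξ0 x) e3
  rw [e1, e2]
  linarith

end IsLayerFlow

/-! ### Ramps, trapezoidal cut-offs and the limit to the positive part. -/

theorem tendsto_intervalIntegral_of_bounded {F : ℕ → ℝ → ℝ} {f : ℝ → ℝ} {C : ℝ} {a b : ℝ}
    (hF : ∀ n, Measurable (F n)) (hC : ∀ n x, |F n x| ≤ C)
    (hlim : ∀ᵐ x, x ∈ uIoc a b → Tendsto (fun n => F n x) atTop (𝓝 (f x))) :
    Tendsto (fun n => ∫ x in a..b, F n x) atTop (𝓝 (∫ x in a..b, f x)) :=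
  intervalIntegral.tendsto_integral_filter_of_dominated_convergence (fun _ => C)
    (Eventually.of_forall fun n => (hF n).aestronglyMeasurable)
    (Eventually.of_forall fun n => Eventually.of_forall fun x _ => hC n x)
    intervalIntegrable_const hlim

theorem tendsto_doubleIntegral_of_bounded {F : ℕ → ℝ → ℝ → ℝ} {f : ℝ → ℝ → ℝ} {C : ℝ}
    {a b c d : ℝ} (hF : ∀ n, Measurable (Function.uncurry (F n))) (hC : ∀ n x y, |F n x y| ≤ C)
    (hlim : ∀ x y, Tendsto (fun n => F n x y) atTop (𝓝 (f x y))) :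
    Tendsto (fun n => ∫ x in a..b, ∫ y in c..d, F n x y) atTop
      (𝓝 (∫ x in a..b, ∫ y in c..d, f x y)) :=
  tendsto_intervalIntegral_of_bounded (fun n => measurable_intervalIntegral (hF n) c d)
    (fun n x => abs_intervalIntegral_le (hC n x) c d)
    (Eventually.of_forall fun x _ => tendsto_intervalIntegral_of_bounded
      (fun n => (hF n).comp measurable_prodMk_left) (fun n y => hC n x y)
      (Eventually.of_forall fun y _ => hlim x y))

/-- A Lipschitz approximation of the indicator function of `(0,∞)`. -/
noncomputable def ramp (n : ℕ) (r : ℝ) : ℝ := max 0 (min 1 ((n + 1 : ℝ) * r))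

theorem ramp_monotone (n : ℕ) : Monotone (ramp n) := fun x y hxy => by
  unfold ramp
  have : (0 : ℝ) ≤ n + 1 := by positivity
  gcongr

theorem ramp_nonneg (n : ℕ) (r : ℝ) : 0 ≤ ramp n r := le_max_left _ _

theorem ramp_le_one (n : ℕ) (r : ℝ) : ramp n r ≤ 1 := max_le zero_le_one (min_le_left _ _)

theorem abs_ramp_le_one (n : ℕ) (r : ℝ) : |ramp n r| ≤ 1 := by
  rw [abs_of_nonneg (ramp_nonneg n r)]; exact ramp_le_one n r

theorem abs_clamp_sub_le (x y : ℝ) : |max 0 (min 1 x) - max 0 (min 1 y)| ≤ |x - y| := by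
  refine (abs_max_sub_max_le_max _ _ _ _).trans ?_
  rw [sub_self, abs_zero]
  refine max_le (abs_nonneg _) ((abs_min_sub_min_le_max _ _ _ _).trans ?_)
  rw [sub_self, abs_zero]
  exact max_le (abs_nonneg _) le_rfl

theorem ramp_lip (n : ℕ) (x y : ℝ) : |ramp n x - ramp n y| ≤ (n + 1 : ℝ) * |x - y| := by
  refine (abs_clamp_sub_le _ _).trans_eq ?_
  rw [← mul_sub, abs_mul, abs_of_pos (by positivity)]

theorem ramp_of_nonpos (n : ℕ) {r : ℝ} (hr : r ≤ 0) : ramp n r = 0 := by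
  have : (n + 1 : ℝ) * r ≤ 0 := mul_nonpos_of_nonneg_of_nonpos (by positivity) hr
  unfold ramp
  rw [min_eq_right (by linarith), max_eq_left this]

theorem tendsto_ramp_of_pos {r : ℝ} (hr : 0 < r) :
    Tendsto (fun n => ramp n r) atTop (𝓝 1) := by
  refine tendsto_const_nhds.congr' ?_
  obtain ⟨k, hk⟩ := exists_nat_gt (1 / r)
  filter_upwards [eventually_ge_atTop k] with n hn
  have h1 : (1 : ℝ) ≤ (n + 1 : ℝ) * r := by
    have : (k : ℝ) ≤ n := by exact_mod_cast hn
    rw [div_lt_iff₀ hr] at hk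
    nlinarith
  unfold ramp
  rw [min_eq_left h1, max_eq_right zero_le_one]

theorem continuous_ramp (n : ℕ) : Continuous (ramp n) := continuous_of_lip (ramp_lip n)

theorem tendsto_primitive_ramp (z : ℝ) :
    Tendsto (fun n => ∫ ρ in (0 : ℝ)..z, ramp n ρ) atTop (𝓝 (max z 0)) := by
  rcases le_or_gt z 0 with hz | hz
  · have : ∀ n, ∫ ρ in (0 : ℝ)..z, ramp n ρ = 0 := fun n => by
      rw [intervalIntegral.integral_congr (g := fun _ => (0 : ℝ)) fun ρ hρ => ?_]
      · simp
      · rw [uIcc_of_ge hz] at hρ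
        exact ramp_of_nonpos n hρ.2
    simp only [this, max_eq_right hz]
    exact tendsto_const_nhds
  · have := tendsto_intervalIntegral_of_bounded (F := ramp) (f := fun _ => 1) (C := 1) (a := 0)
      (b := z) (fun n => (continuous_ramp n).measurable) abs_ramp_le_one
      (Eventually.of_forall fun x hx => by
        rw [uIoc_of_le hz.le] at hx
        exact tendsto_ramp_of_pos hx.1)
    simpa [max_eq_left hz.le] using this

/-- If `c < p`, strict monotonicity makes `φ(α) - φ(c)` positive on the whole interval of
integration, so the ramps tend to `1` there. If `p ≤ c` the ramps vanish identically on it. -/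
theorem tendsto_entropy_ramp {φ : ℝ → ℝ} (hφ : Continuous φ) (hφm : Monotone φ)
    (hφs : StrictMonoOn φ (Icc 0 1)) {p c : ℝ} (hp : p ∈ Icc (0 : ℝ) 1) (hc : c ∈ Icc (0 : ℝ) 1) :
    Tendsto (fun n => entropy φ (ramp n) p c) atTop (𝓝 (max (p - c) 0)) := by
  unfold entropy
  rcases le_or_gt p c with h | h
  · have : ∀ n, ∫ α in c..p, ramp n (φ α - φ c) = 0 := fun n => by
      rw [intervalIntegral.integral_congr (g := fun _ => (0 : ℝ)) fun α hα => ?_]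
      · simp
      · rw [uIcc_of_ge h] at hα
        exact ramp_of_nonpos n (sub_nonpos.2 (hφm hα.2))
    simp only [this, max_eq_right (sub_nonpos.2 h)]
    exact tendsto_const_nhds
  · have := tendsto_intervalIntegral_of_bounded (F := fun n α => ramp n (φ α - φ c))
      (f := fun _ => 1) (C := 1) (a := c) (b := p)
      (fun n => ((continuous_ramp n).comp (by fun_prop)).measurable) (fun n _ => abs_ramp_le_one n _)
      (Eventually.of_forall fun x hx => by
        rw [uIoc_of_le h.le] at hx
        exact tendsto_ramp_of_pos (sub_pos.2 (hφs hc ⟨hc.1.trans hx.1.le, hx.2.trans hp.2⟩ hx.1)))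
    simpa [max_eq_left (sub_pos.2 h).le] using this

/-- Counterpart of `tendsto_entropy_ramp` for the reflected ramps: with `p` taken from `v` and `c`
from `u`, both halves of the doubled inequality have the same limit `(u - v)⁺`. -/
theorem tendsto_entropy_ramp_neg {φ : ℝ → ℝ} (hφ : Continuous φ) (hφm : Monotone φ)
    (hφs : StrictMonoOn φ (Icc 0 1)) {p c : ℝ} (hp : p ∈ Icc (0 : ℝ) 1) (hc : c ∈ Icc (0 : ℝ) 1) :
    Tendsto (fun n => entropy φ (fun r => -ramp n (-r)) p c) atTop (𝓝 (max (c - p) 0)) := by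
  unfold entropy
  rcases le_or_gt c p with h | h
  · have : ∀ n, ∫ α in c..p, -ramp n (-(φ α - φ c)) = 0 := fun n => by
      rw [intervalIntegral.integral_congr (g := fun _ => (0 : ℝ)) fun α hα => ?_]
      · simp
      · rw [uIcc_of_le h] at hα
        simp only
        rw [ramp_of_nonpos n (neg_nonpos.2 (sub_nonneg.2 (hφm hα.1))), neg_zero]
    simp only [this, max_eq_right (sub_nonpos.2 h)]
    exact tendsto_const_nhds
  · have hne : ∀ᵐ x : ℝ, x ≠ c := by simp [ae_iff, measure_singleton]
    have := tendsto_intervalIntegral_of_bounded (F := fun n α => -ramp n (-(φ α - φ c)))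
      (f := fun _ => -1) (C := 1) (a := c) (b := p)
      (fun n => ((continuous_ramp n).comp (by fun_prop)).neg.measurable)
      (fun n _ => by rw [abs_neg]; exact abs_ramp_le_one n _)
      (by
        filter_upwards [hne] with x hxc hx
        rw [uIoc_of_ge h.le] at hx
        refine (tendsto_ramp_of_pos ?_).neg
        rw [neg_sub, sub_pos]
        exact hφs ⟨hp.1.trans hx.1.le, hx.2.trans hc.2⟩ hc (lt_of_le_of_ne hx.2 hxc))
    simpa [max_eq_left (sub_pos.2 h).le] using this

/-- The trapezoidal cut-off function of the interval `[a,b]`, with slopes `± 1/ε`. -/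
noncomputable def trapezoid (a b ε x : ℝ) : ℝ :=
  max 0 (min 1 (min ((x - a) / ε) ((b - x) / ε)))

theorem trapezoid_lip {a b ε : ℝ} (hε : 0 < ε) (x y : ℝ) :
    |trapezoid a b ε x - trapezoid a b ε y| ≤ (1 / ε) * |x - y| := by
  refine (abs_clamp_sub_le _ _).trans ((abs_min_sub_min_le_max _ _ _ _).trans ?_)
  refine max_le (le_of_eq ?_) (le_of_eq ?_)
  · rw [← sub_div, abs_div, abs_of_pos hε, sub_sub_sub_cancel_right]; ring
  · rw [← sub_div, abs_div, abs_of_pos hε, sub_sub_sub_cancel_left, abs_sub_comm]; ring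

theorem trapezoid_nonneg (a b ε x : ℝ) : 0 ≤ trapezoid a b ε x := le_max_left _ _

theorem abs_trapezoid_le (a b ε x : ℝ) : |trapezoid a b ε x| ≤ 1 := by
  rw [abs_of_nonneg (trapezoid_nonneg a b ε x)]; exact max_le zero_le_one (min_le_left _ _)

theorem trapezoid_left {a b ε : ℝ} (hε : 0 < ε) (hab : a ≤ b) : trapezoid a b ε a = 0 := by
  have : 0 ≤ (b - a) / ε := div_nonneg (by linarith) hε.le
  simp [trapezoid, this]

theorem trapezoid_right {a b ε : ℝ} (hε : 0 < ε) (hab : a ≤ b) : trapezoid a b ε b = 0 := by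
  have : 0 ≤ (b - a) / ε := div_nonneg (by linarith) hε.le
  simp [trapezoid, this]

/-- The slope of the cut-off is `1/ε`, `0`, `-1/ε` on three consecutive pieces, so the cut-off term
reduces to increments of `P` over the two boundary strips, which do not overlap because `2ε ≤ b -
a`. -/
theorem integral_deriv_trapezoid_mul {a b ε : ℝ} (hε : 0 < ε) (hab : 2 * ε ≤ b - a) {P : ℝ → ℝ}
    {K : ℝ} (hK : 0 ≤ K) (hP : ∀ x y, |P x - P y| ≤ K * |x - y|) :
    ∫ x in a..b, deriv (trapezoid a b ε) x * deriv P x =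
      (P (a + ε) - P a - (P b - P (b - ε))) / ε := by
  have hε' : 0 ≤ 1 / ε := by positivity
  have hint : ∀ c d, IntervalIntegrable (fun x => deriv (trapezoid a b ε) x * deriv P x)
      volume c d := fun c d => intervalIntegrable_of_measurable_of_bounded
    ((measurable_deriv _).mul (measurable_deriv _)) (C := (1 / ε) * K) (fun x =>
      (abs_mul _ _).trans_le (mul_le_mul (abs_deriv_le_of_lip hε' (trapezoid_lip hε) x)
        (abs_deriv_le_of_lip hK hP x) (abs_nonneg _) hε')) c d
  have piece : ∀ c d σ, c ≤ d → (∀ x ∈ Ioo c d, deriv (trapezoid a b ε) x = σ) →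
      ∫ x in c..d, deriv (trapezoid a b ε) x * deriv P x = σ * (P d - P c) := by
    intro c d σ hcd hσ
    have hne : ∀ᵐ x : ℝ, x ≠ d := by simp [ae_iff, measure_singleton]
    rw [← integral_deriv_of_lip hK hP c d, ← intervalIntegral.integral_const_mul]
    refine intervalIntegral.integral_congr_ae ?_
    filter_upwards [hne] with x hxd hx
    rw [uIoc_of_le hcd] at hx
    rw [hσ x ⟨hx.1, lt_of_le_of_ne hx.2 hxd⟩]
  have d1 : ∀ x ∈ Ioo a (a + ε), deriv (trapezoid a b ε) x = 1 / ε := by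
    intro x hx
    have : trapezoid a b ε =ᶠ[𝓝 x] fun y => (y - a) / ε := by
      filter_upwards [isOpen_Ioo.mem_nhds hx] with y hy
      have h1 : (y - a) / ε ≤ (b - y) / ε := 
        div_le_div_of_nonneg_right (by linarith [hy.2]) hε.le
      have h2 : (y - a) / ε ≤ 1 := by rw [div_le_one hε]; linarith [hy.2]
      have h3 : 0 ≤ (y - a) / ε := div_nonneg (by linarith [hy.1]) hε.le
      rw [trapezoid, min_eq_left h1, min_eq_right h2, max_eq_right h3]
    rw [this.deriv_eq]
    exact (((hasDerivAt_id x).sub_const a).div_const ε).deriv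
  have d2 : ∀ x ∈ Ioo (a + ε) (b - ε), deriv (trapezoid a b ε) x = 0 := by
    intro x hx
    have : trapezoid a b ε =ᶠ[𝓝 x] fun y => 1 := by
      filter_upwards [isOpen_Ioo.mem_nhds hx] with y hy
      have h1 : 1 ≤ (b - y) / ε := by rw [one_le_div hε]; linarith [hy.2]
      have h2 : 1 ≤ (y - a) / ε := by rw [one_le_div hε]; linarith [hy.1]
      rw [trapezoid, min_eq_left (le_min h2 h1), max_eq_right zero_le_one]
    rw [this.deriv_eq, deriv_const]
  have d3 : ∀ x ∈ Ioo (b - ε) b, deriv (trapezoid a b ε) x = -1 / ε := by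
    intro x hx
    have : trapezoid a b ε =ᶠ[𝓝 x] fun y => (b - y) / ε := by
      filter_upwards [isOpen_Ioo.mem_nhds hx] with y hy
      have h1 : (b - y) / ε ≤ (y - a) / ε := 
        div_le_div_of_nonneg_right (by linarith [hy.1]) hε.le
      have h2 : (b - y) / ε ≤ 1 := by rw [div_le_one hε]; linarith [hy.1]
      have h3 : 0 ≤ (b - y) / ε := div_nonneg (by linarith [hy.2]) hε.le
      rw [trapezoid, min_eq_right h1, min_eq_right h2, max_eq_right h3]
    rw [this.deriv_eq]
    exact (((hasDerivAt_id x).const_sub b).div_const ε).deriv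
  rw [← intervalIntegral.integral_add_adjacent_intervals (hint a (a + ε)) (hint (a + ε) b),
    ← intervalIntegral.integral_add_adjacent_intervals (hint (a + ε) (b - ε)) (hint (b - ε) b),
    piece _ _ _ (by linarith) d1, piece _ _ _ (by linarith) d2, piece _ _ _ (by linarith) d3]
  ring

/-! ### Kato inequality on one layer. -/

/-- The weighted positive part `∫ ξ m (u(x,t) - v(x,s))⁺`. -/
noncomputable def excess (a b m : ℝ) (ξ : ℝ → ℝ) (u v : ℝ → ℝ → ℝ) (t s : ℝ) : ℝ :=
  ∫ x in a..b, ξ x * (m * max (u x t - v x s) 0)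

/-- The positive part of the difference of the Kirchhoff transforms. -/
noncomputable def gap (φ : ℝ → ℝ) (u v : ℝ → ℝ → ℝ) (x t s : ℝ) : ℝ :=
  max (φ (u x t) - φ (v x s)) 0

theorem abs_entropy_le {φ S : ℝ → ℝ} (hS : ∀ x, |S x| ≤ 1) {p c : ℝ} (hp : p ∈ Icc (0 : ℝ) 1)
    (hc : c ∈ Icc (0 : ℝ) 1) : |entropy φ S p c| ≤ 1 := by
  refine (abs_intervalIntegral_le (fun _ => hS _) _ _).trans ?_
  rw [one_mul, abs_le]
  exact ⟨by linarith [hp.1, hc.2], by linarith [hp.2, hc.1]⟩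

namespace IsLayerFlow

variable {a b T m L : ℝ} {φ : ℝ → ℝ} {u W v V : ℝ → ℝ → ℝ}

/-- Kato inequality in doubled time variables on a layer, integrated over a rectangle. -/
theorem excess_rectangle_le (h : IsLayerFlow a b T m L φ u W) (h' : IsLayerFlow a b T m L φ v V)
    (hφ : Continuous φ) (hφm : Monotone φ) (hφs : StrictMonoOn φ (Icc 0 1)) (hm : 0 ≤ m)
    {ε : ℝ} (hε : 0 < ε) (hab : 2 * ε ≤ b - a) {t₁ t₂ s₁ s₂ : ℝ}
    (ht1 : 0 < t₁) (ht12 : t₁ ≤ t₂) (ht2 : t₂ < T)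
    (hs1 : 0 < s₁) (hs12 : s₁ ≤ s₂) (hs2 : s₂ < T) :
    (∫ s in s₁..s₂, (excess a b m (trapezoid a b ε) u v t₂ s -
        excess a b m (trapezoid a b ε) u v t₁ s)) +
      (∫ t in t₁..t₂, (excess a b m (trapezoid a b ε) u v t s₂ -
        excess a b m (trapezoid a b ε) u v t s₁)) ≤
      ∫ t in t₁..t₂, ∫ s in s₁..s₂, (gap φ u v a t s - gap φ u v (a + ε) t s +
        (gap φ u v b t s - gap φ u v (b - ε) t s)) / ε := by
  have hab' : a ≤ b := by linarith
  have hξc := continuous_of_lip (trapezoid_lip (a := a) (b := b) hε)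
  have hL := h.nonneg_lip
  have hSl : ∀ n x y, |-ramp n (-x) - -ramp n (-y)| ≤ (n + 1 : ℝ) * |x - y| := fun n x y => by
    have := ramp_lip n (-y) (-x)
    rw [neg_sub_neg] at this ⊢
    exact this
  have key := fun n => h.doubled_rectangle_le h' hφ hφm hab' hm (trapezoid_lip hε)
    (trapezoid_nonneg a b ε) (abs_trapezoid_le a b ε) (trapezoid_left hε hab')
    (trapezoid_right hε hab') (ramp_lip n) (ramp_monotone n) (abs_ramp_le_one n)
    ht1 ht12 ht2 hs1 hs12 hs2
  have hb : ∀ {S : ℝ → ℝ} {f g : ℝ → ℝ → ℝ}, (∀ x, |S x| ≤ 1) → (∀ x t, f x t ∈ Icc (0 : ℝ) 1) →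
      (∀ x t, g x t ∈ Icc (0 : ℝ) 1) → ∀ t s x,
      |trapezoid a b ε x * (m * entropy φ S (f x t) (g x s))| ≤ m := by
    intro S f g hS hf hg t s x
    rw [abs_mul, abs_mul, abs_of_nonneg hm]
    calc _ ≤ 1 * (m * 1) := by
          gcongr
          · exact abs_trapezoid_le _ _ _ _
          · exact abs_entropy_le hS (hf x t) (hg x s)
      _ = m := by ring
  have hd1 : ∀ n t s, |doubled a b m φ (trapezoid a b ε) (ramp n) u v t s| ≤ m * |b - a| :=
    fun n t s => abs_intervalIntegral_le (hb (abs_ramp_le_one n) h.mem h'.mem t s) a b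
  have hd2 : ∀ n t s, |doubled a b m φ (trapezoid a b ε) (fun r => -ramp n (-r)) v u t s| ≤
      m * |b - a| := fun n t s => abs_intervalIntegral_le
    (hb (fun r => by rw [abs_neg]; exact abs_ramp_le_one n _) h'.mem h.mem t s) a b
  have hslice : ∀ {S : ℝ → ℝ} {f g : ℝ → ℝ → ℝ}, Continuous S → Continuous (Function.uncurry f) →
      Continuous (Function.uncurry g) → ∀ t s, Measurable fun x =>
        trapezoid a b ε x * (m * entropy φ S (f x t) (g x s)) := by
    intro S f g hS hf hg t s
    have : Continuous fun x : ℝ => (Function.uncurry f (x, t), Function.uncurry g (x, s)) := by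
      fun_prop
    exact (hξc.mul (continuous_const.mul ((continuous_entropy hφ hS).comp this))).measurable
  have hSc : ∀ n, Continuous fun r => -ramp n (-r) := fun n => continuous_of_lip (hSl n)
  have hl1 : ∀ t s, Tendsto (fun n => doubled a b m φ (trapezoid a b ε) (ramp n) u v t s) atTop
      (𝓝 (excess a b m (trapezoid a b ε) u v t s)) := fun t s =>
    tendsto_intervalIntegral_of_bounded (fun n => hslice (continuous_ramp n) h.cont h'.cont t s)
      (fun n => hb (abs_ramp_le_one n) h.mem h'.mem t s) (Eventually.of_forall fun x _ =>
        ((tendsto_entropy_ramp hφ hφm hφs (h.mem x t) (h'.mem x s)).const_mul m).const_mul _)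
  have hl2 : ∀ t s, Tendsto (fun n => doubled a b m φ (trapezoid a b ε)
      (fun r => -ramp n (-r)) v u s t) atTop (𝓝 (excess a b m (trapezoid a b ε) u v t s)) :=
    fun t s => tendsto_intervalIntegral_of_bounded
      (fun n => hslice (hSc n) h'.cont h.cont s t)
      (fun n => hb (fun r => by rw [abs_neg]; exact abs_ramp_le_one n _) h'.mem h.mem s t)
      (Eventually.of_forall fun x _ => ((tendsto_entropy_ramp_neg hφ hφm hφs (h'.mem x s)
        (h.mem x t)).const_mul m).const_mul _)
  have hc1 := fun n => continuous_doubled (a := a) (b := b) (m := m) hφ hξc (continuous_ramp n)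
    h.cont h'.cont
  have hc2 := fun n => continuous_doubled (a := a) (b := b) (m := m) hφ hξc (hSc n) h'.cont h.cont
  have hPl : ∀ n z w, |(∫ ρ in (0 : ℝ)..z, ramp n ρ) - ∫ ρ in (0 : ℝ)..w, ramp n ρ| ≤ |z - w| := by
    intro n z w
    rw [intervalIntegral.integral_interval_sub_left ((continuous_ramp n).intervalIntegrable _ _)
      ((continuous_ramp n).intervalIntegrable _ _)]
    exact (abs_intervalIntegral_le (abs_ramp_le_one n) w z).trans_eq (one_mul _)
  set P : ℕ → ℝ → ℝ → ℝ → ℝ := fun n x t s =>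
    ∫ ρ in (0 : ℝ)..φ (u x t) - φ (v x s), ramp n ρ with hPdef
  have hPx : ∀ n t s x y, |P n x t s - P n y t s| ≤ (L + L) * |x - y| := fun n t s x y => by
    refine (hPl n _ _).trans ?_
    have e : φ (u x t) - φ (v x s) - (φ (u y t) - φ (v y s)) =
      (φ (u x t) - φ (u y t)) - (φ (v x s) - φ (v y s)) := by ring
    rw [e, add_mul]
    exact (abs_sub _ _).trans (add_le_add (h.lip t x y) (h'.lip s x y))
  have hPc : ∀ n x, Continuous fun p : ℝ × ℝ => P n x p.1 p.2 := fun n x => by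
    have h1 : Continuous fun z => ∫ ρ in (0 : ℝ)..z, ramp n ρ :=
      continuous_of_lip (K := 1) fun z w => by rw [one_mul]; exact hPl n z w
    have h2 := h.continuous_saturation_right x
    have h3 := h'.continuous_saturation_right x
    exact h1.comp (by fun_prop)
  -- The space integral is evaluated before the limit in `n`, so that only point values, and no
  -- derivatives, have to converge.
  have hrhs : ∀ n, (∫ t in t₁..t₂, ∫ s in s₁..s₂, - ∫ x in a..b, deriv (trapezoid a b ε) x *
      deriv (fun y => ∫ ρ in (0 : ℝ)..φ (u y t) - φ (v y s), ramp n ρ) x) =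
      ∫ t in t₁..t₂, ∫ s in s₁..s₂, (P n a t s - P n (a + ε) t s +
        (P n b t s - P n (b - ε) t s)) / ε := by
    intro n
    refine intervalIntegral.integral_congr fun t _ => intervalIntegral.integral_congr fun s _ => ?_
    rw [integral_deriv_trapezoid_mul hε hab (by positivity) (hPx n t s)]
    ring
  simp only [hrhs] at key
  refine le_of_tendsto_of_tendsto' (b := atTop) (Tendsto.add ?_ ?_) ?_ key
  · refine tendsto_intervalIntegral_of_bounded (C := m * |b - a| + m * |b - a|)
      (fun n => ?_) (fun n s => (abs_sub _ _).trans (add_le_add (hd1 n _ _) (hd1 n _ _)))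
      (Eventually.of_forall fun s _ => (hl1 _ _).sub (hl1 _ _))
    exact (((hc1 n).comp (by fun_prop : Continuous fun s : ℝ => (t₂, s))).sub
      ((hc1 n).comp (by fun_prop : Continuous fun s : ℝ => (t₁, s)))).measurable
  · refine tendsto_intervalIntegral_of_bounded (C := m * |b - a| + m * |b - a|)
      (fun n => ?_) (fun n s => (abs_sub _ _).trans (add_le_add (hd2 n _ _) (hd2 n _ _)))
      (Eventually.of_forall fun s _ => (hl2 _ _).sub (hl2 _ _))
    exact (((hc2 n).comp (by fun_prop : Continuous fun s : ℝ => (s₂, s))).sub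
      ((hc2 n).comp (by fun_prop : Continuous fun s : ℝ => (s₁, s)))).measurable
  -- Each increment of `P n` over a strip of width `ε` is at most `2Lε`, uniformly in `n`, `t` and
  -- `s`.
  · refine tendsto_doubleIntegral_of_bounded (C := ((L + L) * ε + (L + L) * ε) / ε)
      (fun n => ?_) (fun n t s => ?_) (fun t s => ?_)
    · exact ((((hPc n a).sub (hPc n (a + ε))).add
        ((hPc n b).sub (hPc n (b - ε)))).div_const ε).measurable
    · rw [abs_div, abs_of_pos hε]
      gcongr
      refine (abs_add_le _ _).trans (add_le_add ((hPx n t s _ _).trans_eq ?_)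
        ((hPx n t s _ _).trans_eq ?_))
      · rw [sub_add_cancel_left, abs_neg, abs_of_pos hε]
      · rw [sub_sub_cancel, abs_of_pos hε]
    · exact (((tendsto_primitive_ramp _).sub (tendsto_primitive_ramp _)).add
        ((tendsto_primitive_ramp _).sub (tendsto_primitive_ramp _))).div_const ε

end IsLayerFlow

/-! ### Weak-* convergence of space difference quotients to the boundary flux. -/

/-- A bounded sequence whose primitives converge to zero converges weakly-* to zero. -/
theorem tendsto_integral_mul_of_tendsto_primitive {e : ℕ → ℝ → ℝ} {C B t₁ t₂ : ℝ} (h12 : t₁ ≤ t₂)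
    (hm : ∀ n, Measurable (e n)) (hC : ∀ n t, |e n t| ≤ C)
    (hlim : ∀ t ∈ Icc t₁ t₂, Tendsto (fun n => ∫ τ in t₁..t, e n τ) atTop (𝓝 0))
    {K : ℝ → ℝ} (hK : Measurable K) (hB : ∀ t, |K t| ≤ B) :
    Tendsto (fun n => ∫ t in t₁..t₂, K t * e n t) atTop (𝓝 0) := by
  have hC0 : 0 ≤ C := (abs_nonneg _).trans (hC 0 0)
  have hei : ∀ n a b, IntervalIntegrable (e n) volume a b := fun n a b =>
    intervalIntegrable_of_measurable_of_bounded (hm n) (hC n) a b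
  -- Against a polynomial, integration by parts transfers the integral to the primitives of `e n`,
  -- which tend to zero and are uniformly bounded. General kernels follow by density in `L¹`.
  have hpoly : ∀ p : Polynomial ℝ,
      Tendsto (fun n => ∫ t in t₁..t₂, p.eval t * e n t) atTop (𝓝 0) := by
    intro p
    have hpc : ContDiff ℝ 1 fun t : ℝ => p.eval t := by
      simpa only [Polynomial.coe_aeval_eq_eval] using Polynomial.contDiff_aeval (𝕜 := ℝ) p 1
    have hpac : AbsolutelyContinuousOnInterval (fun t : ℝ => p.eval t) t₁ t₂ :=
      hpc.contDiffOn.absolutelyContinuousOnInterval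
    have heq : ∀ n, ∫ t in t₁..t₂, p.eval t * e n t =
        p.eval t₂ * (∫ τ in t₁..t₂, e n τ) -
          ∫ t in t₁..t₂, p.derivative.eval t * ∫ τ in t₁..t, e n τ := by
      intro n
      have hE := (hei n t₁ t₂).absolutelyContinuousOnInterval_intervalIntegral
        (c := t₁) left_mem_uIcc
      have h1 := AbsolutelyContinuousOnInterval.integral_mul_deriv_eq_deriv_mul hpac hE
      rw [intervalIntegral.integral_same, mul_zero, sub_zero] at h1
      have h2 : ∫ t in t₁..t₂, p.eval t * e n t =
          ∫ t in t₁..t₂, p.eval t * deriv (fun t => ∫ τ in t₁..t, e n τ) t := by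
        refine intervalIntegral.integral_congr_ae ?_
        filter_upwards [(hei n t₁ t₂).ae_hasDerivAt_integral] with t ht htm
        rw [(ht (uIoc_subset_uIcc htm) t₁ left_mem_uIcc).deriv]
      rw [h2, h1]
      congr 1
      refine intervalIntegral.integral_congr fun t _ => ?_
      simp only [Polynomial.deriv]
    simp only [heq]
    have l1 : Tendsto (fun n => p.eval t₂ * (∫ τ in t₁..t₂, e n τ)) atTop (𝓝 0) := by
      simpa using (hlim t₂ (right_mem_Icc.2 h12)).const_mul (p.eval t₂)
    have l2 : Tendsto (fun n => ∫ t in t₁..t₂, p.derivative.eval t * ∫ τ in t₁..t, e n τ) atTop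
        (𝓝 (∫ t in t₁..t₂, (0 : ℝ))) := by
      have hpd : Continuous fun t : ℝ => p.derivative.eval t := p.derivative.continuous
      refine intervalIntegral.tendsto_integral_filter_of_dominated_convergence
        (fun t => |p.derivative.eval t| * (C * |t - t₁|)) ?_ ?_ ?_ ?_
      · refine Eventually.of_forall fun n => (hpd.mul ?_).aestronglyMeasurable
        exact intervalIntegral.continuous_primitive (fun a b => hei n a b) t₁
      · refine Eventually.of_forall fun n => Eventually.of_forall fun t _ => ?_
        rw [norm_mul]
        exact mul_le_mul_of_nonneg_left (abs_intervalIntegral_le (hC n) _ _) (norm_nonneg _)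
      · exact Continuous.intervalIntegrable (by fun_prop) _ _
      · refine Eventually.of_forall fun t ht => ?_
        rw [uIoc_of_le h12] at ht
        simpa using (hlim t (Ioc_subset_Icc_self ht)).const_mul (p.derivative.eval t)
    simpa using l1.sub l2
  rw [Metric.tendsto_atTop]
  intro η hη
  -- Approximating `K` by a continuous `g` in `L¹`, and `g` by a polynomial uniformly, costs at most
  -- `θ` each. After multiplication by the bound `C` this is at most `η/2`, and the polynomial part
  -- contributes less than `η/4`.
  set θ := η / (4 * (C + 1)) with hθ
  have hθ0 : 0 < θ := by positivity
  have hKi : Integrable ((Ioc t₁ t₂).indicator K) := by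
    rw [integrable_indicator_iff measurableSet_Ioc]
    exact Measure.integrableOn_of_bounded (M := B) measure_Ioc_lt_top.ne
      hK.aestronglyMeasurable (Eventually.of_forall hB)
  obtain ⟨g, -, hg, hgc, hgi⟩ := hKi.exists_hasCompactSupport_integral_sub_le hθ0
  obtain ⟨p, hp⟩ := exists_polynomial_near_of_continuousOn t₁ t₂ g hgc.continuousOn
    (θ / (t₂ - t₁ + 1)) (by have : 0 ≤ t₂ - t₁ := by linarith
                            positivity)
  obtain ⟨n₀, hn₀⟩ := (Metric.tendsto_atTop.1 (hpoly p)) (η / 4) (by positivity)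
  refine ⟨n₀, fun n hn => ?_⟩
  have h1 := hn₀ n hn
  rw [dist_zero_right, Real.norm_eq_abs] at h1 ⊢
  have hpcont : Continuous fun t : ℝ => p.eval t := p.continuous
  have hKint : IntervalIntegrable K volume t₁ t₂ :=
    intervalIntegrable_of_measurable_of_bounded hK hB _ _
  have i1 : IntervalIntegrable (fun t => (K t - p.eval t) * e n t) volume t₁ t₂ := by
    have : IntervalIntegrable (fun t => K t * e n t) volume t₁ t₂ :=
      intervalIntegrable_of_measurable_of_bounded (C := B * C) (hK.mul (hm n)) (fun t =>
        (abs_mul _ _).trans_le (mul_le_mul (hB t) (hC n t) (abs_nonneg _)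
          ((abs_nonneg _).trans (hB t)))) _ _
    simp only [sub_mul]
    exact this.sub ((hei n _ _).continuousOn_mul hpcont.continuousOn)
  have i2 : IntervalIntegrable (fun t => p.eval t * e n t) volume t₁ t₂ :=
    (hei n _ _).continuousOn_mul hpcont.continuousOn
  have hsplit : ∫ t in t₁..t₂, K t * e n t =
      (∫ t in t₁..t₂, (K t - p.eval t) * e n t) + ∫ t in t₁..t₂, p.eval t * e n t := by
    rw [← intervalIntegral.integral_add i1 i2]
    congr 1; ext t; ring
  have i3 : IntervalIntegrable (fun t => |K t - g t|) volume t₁ t₂ :=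
    (hKint.sub (hgc.intervalIntegrable _ _)).abs
  have hdiff : |∫ t in t₁..t₂, (K t - p.eval t) * e n t| ≤
      ∫ t in t₁..t₂, C * (|K t - g t| + θ / (t₂ - t₁ + 1)) := by
    rw [← Real.norm_eq_abs]
    refine intervalIntegral.norm_integral_le_of_norm_le h12 ?_ ?_
    · refine Eventually.of_forall fun t ht => ?_
      rw [norm_mul, mul_comm]
      refine mul_le_mul (hC n t) ?_ (norm_nonneg _) hC0
      have h3 := hp t (Ioc_subset_Icc_self ht)
      rw [abs_sub_comm] at h3
      have e1 : K t - p.eval t = (K t - g t) + (g t - p.eval t) := by ring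
      rw [e1]
      exact (norm_add_le _ _).trans (add_le_add le_rfl h3.le)
    · exact (i3.add intervalIntegrable_const).const_mul C
  have hgap : ∫ t in t₁..t₂, |K t - g t| ≤ θ := by
    rw [intervalIntegral.integral_of_le h12]
    calc ∫ t in Ioc t₁ t₂, |K t - g t|
        = ∫ t in Ioc t₁ t₂, ‖(Ioc t₁ t₂).indicator K t - g t‖ := by
          refine setIntegral_congr_fun measurableSet_Ioc fun t ht => ?_
          simp only [indicator_of_mem ht, Real.norm_eq_abs]
      _ ≤ ∫ t, ‖(Ioc t₁ t₂).indicator K t - g t‖ :=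
          setIntegral_le_integral (hKi.sub hgi).norm (Eventually.of_forall fun _ => norm_nonneg _)
      _ ≤ θ := hg
  have htot : ∫ t in t₁..t₂, C * (|K t - g t| + θ / (t₂ - t₁ + 1)) ≤ C * (θ + θ) := by
    rw [intervalIntegral.integral_const_mul, intervalIntegral.integral_add i3
      intervalIntegrable_const, intervalIntegral.integral_const, smul_eq_mul]
    have h3 : (t₂ - t₁) * (θ / (t₂ - t₁ + 1)) ≤ θ := by
      have : 0 < t₂ - t₁ + 1 := by linarith
      rw [mul_div_assoc', div_le_iff₀ this]
      nlinarith
    gcongr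
  have hfin : C * (θ + θ) ≤ η / 2 := by
    rw [hθ]
    have : 0 < C + 1 := by linarith
    rw [show C * (η / (4 * (C + 1)) + η / (4 * (C + 1))) = (η / 2) * (C / (C + 1)) by
      field_simp; ring]
    exact mul_le_of_le_one_right (by positivity) ((div_le_one this).2 (by linarith))
  rw [hsplit]
  refine (abs_add_le _ _).trans_lt ?_
  linarith

namespace IsLayerFlow

variable {a b T m L : ℝ} {φ : ℝ → ℝ} {u W : ℝ → ℝ → ℝ}

/-- The field `flux` is differenced in its end point and in its time. In this form the time
integrals of space difference quotients of `φ(u)` become space averages of the continuous function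
`W`. -/
theorem integral_flux_sub (h : IsLayerFlow a b T m L φ u W) (hφ : Continuous φ) {t₁ t x y : ℝ}
    (ht1 : t₁ ∈ Icc 0 T) (ht : t ∈ Icc 0 T) (hx : x ∈ Icc a b) (hy : y ∈ Icc a b) :
    ∫ τ in t₁..t, (φ (u x τ) - φ (u y τ)) = ∫ z in y..x, (W z t - W z t₁) := by
  have hq : ∀ x, Continuous fun τ => φ (u x τ) := fun x =>
    hφ.comp (h.continuous_saturation_right x)
  have hqi : ∀ x c d, IntervalIntegrable (fun τ => φ (u x τ) - φ (u a τ)) volume c d :=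
    fun x c d => ((hq x).sub (hq a)).intervalIntegrable _ _
  have hWi : ∀ t c d, IntervalIntegrable (fun z => W z t) volume c d := fun t c d =>
    (h.continuous_potential_left t).intervalIntegrable _ _
  have base : ∀ x ∈ Icc a b, ∫ τ in t₁..t, (φ (u x τ) - φ (u a τ)) =
      ∫ z in a..x, (W z t - W z t₁) := by
    intro x hx
    rw [← intervalIntegral.integral_interval_sub_left (hqi x 0 t) (hqi x 0 t₁),
      ← h.flux t ht x hx, ← h.flux t₁ ht1 x hx,
      intervalIntegral.integral_sub (hWi _ _ _) (hWi _ _ _)]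
  have e1 : ∫ τ in t₁..t, (φ (u x τ) - φ (u y τ)) =
      (∫ τ in t₁..t, (φ (u x τ) - φ (u a τ))) - ∫ τ in t₁..t, (φ (u y τ) - φ (u a τ)) := by
    rw [← intervalIntegral.integral_sub (hqi _ _ _) (hqi _ _ _)]
    congr 1; ext τ; ring
  rw [e1, base x hx, base y hy, intervalIntegral.integral_interval_sub_left
    ((hWi _ _ _).sub (hWi _ _ _)) ((hWi _ _ _).sub (hWi _ _ _))]

/-- The difference quotients in space of `φ(u)` at a point of the closed layer converge weakly-*
to the time derivative of the potential. -/
theorem tendsto_integral_mul_slope (h : IsLayerFlow a b T m L φ u W) (hφ : Continuous φ)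
    {t₁ t₂ x B : ℝ} (ht1 : 0 < t₁) (h12 : t₁ ≤ t₂) (ht2 : t₂ < T) (hx : x ∈ Icc a b)
    {y : ℕ → ℝ} (hy : ∀ n, y n ∈ Icc a b) (hyx : ∀ n, y n ≠ x) (hlim : Tendsto y atTop (𝓝 x))
    {K : ℝ → ℝ} (hK : Measurable K) (hB : ∀ t, |K t| ≤ B) :
    Tendsto (fun n => ∫ t in t₁..t₂, K t * ((φ (u x t) - φ (u (y n) t)) / (x - y n))) atTop
      (𝓝 (∫ t in t₁..t₂, K t * deriv (fun τ => W x τ) t)) := by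
  have hL := h.nonneg_lip
  have hB0 : 0 ≤ B := (abs_nonneg _).trans (hB 0)
  have hq : ∀ x, Continuous fun τ => φ (u x τ) := fun x =>
    hφ.comp (h.continuous_saturation_right x)
  have hDb : ∀ t, |deriv (fun τ => W x τ) t| ≤ L := abs_deriv_le_of_lip hL (h.lipW x hx)
  have hDm : Measurable (deriv fun τ => W x τ) := measurable_deriv _
  have hsb : ∀ n t, |(φ (u x t) - φ (u (y n) t)) / (x - y n)| ≤ L := fun n t => by
    have : 0 < |x - y n| := abs_pos.2 (sub_ne_zero.2 (hyx n).symm)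
    rw [abs_div, div_le_iff₀ this]
    exact h.lip t x (y n)
  have hsm : ∀ n, Measurable fun t => (φ (u x t) - φ (u (y n) t)) / (x - y n) := fun n =>
    (((hq x).sub (hq (y n))).div_const _).measurable
  have hsi : ∀ n c d, IntervalIntegrable (fun t => (φ (u x t) - φ (u (y n) t)) / (x - y n))
      volume c d := fun n c d => intervalIntegrable_of_measurable_of_bounded (hsm n) (hsb n) c d
  have hDi : ∀ c d, IntervalIntegrable (deriv fun τ => W x τ) volume c d :=
    intervalIntegrable_of_measurable_of_bounded hDm hDb
  -- The time primitive of the quotients is the mean of `W(·,t) - W(·,t₁)` between `y n` and `x`. By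
  -- continuity of `W` it tends to the value at `x`, which is the primitive of `∂ₜW(x,·)`, even if
  -- `x` is an end point of the layer.
  have main := tendsto_integral_mul_of_tendsto_primitive (e := fun n t =>
    (φ (u x t) - φ (u (y n) t)) / (x - y n) - deriv (fun τ => W x τ) t) (C := L + L) h12
    (fun n => (hsm n).sub hDm) (fun n t => (abs_sub _ _).trans (add_le_add (hsb n t) (hDb t)))
    ?_ hK hB
  · have hKs : ∀ n, IntervalIntegrable
        (fun t => K t * ((φ (u x t) - φ (u (y n) t)) / (x - y n))) volume t₁ t₂ := fun n =>
      intervalIntegrable_of_measurable_of_bounded (hK.mul (hsm n)) (C := B * L) (fun t =>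
        (abs_mul _ _).trans_le (mul_le_mul (hB t) (hsb n t) (abs_nonneg _) hB0)) _ _
    have hKD : IntervalIntegrable (fun t => K t * deriv (fun τ => W x τ) t) volume t₁ t₂ :=
      intervalIntegrable_of_measurable_of_bounded (hK.mul hDm) (C := B * L) (fun t =>
        (abs_mul _ _).trans_le (mul_le_mul (hB t) (hDb t) (abs_nonneg _) hB0)) _ _
    simp only [mul_sub] at main
    have e : ∀ n, ∫ t in t₁..t₂, (K t * ((φ (u x t) - φ (u (y n) t)) / (x - y n)) -
        K t * deriv (fun τ => W x τ) t) =
        (∫ t in t₁..t₂, K t * ((φ (u x t) - φ (u (y n) t)) / (x - y n))) -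
          ∫ t in t₁..t₂, K t * deriv (fun τ => W x τ) t := fun n =>
      intervalIntegral.integral_sub (hKs n) hKD
    simp only [e] at main
    exact tendsto_sub_nhds_zero_iff.1 main
  · intro t ht
    have hHc : Continuous fun z => W z t - W z t₁ :=
      (h.continuous_potential_left t).sub (h.continuous_potential_left t₁)
    have hd : HasDerivAt (fun w => ∫ z in x..w, (W z t - W z t₁)) (W x t - W x t₁) x :=
      (hHc.integral_hasStrictDerivAt x x).hasDerivAt
    have hyl : Tendsto y atTop (𝓝[≠] x) :=
      tendsto_nhdsWithin_iff.2 ⟨hlim, Eventually.of_forall fun n => hyx n⟩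
    have hs := (hasDerivAt_iff_tendsto_slope.1 hd).comp hyl
    have hs' := hs.sub_const (W x t - W x t₁)
    rw [sub_self] at hs'
    refine hs'.congr fun n => ?_
    rw [intervalIntegral.integral_sub (hsi n _ _) (hDi _ _),
      integral_deriv_of_lip hL (h.lipW x hx), intervalIntegral.integral_div,
      h.integral_flux_sub hφ (t₁ := t₁) ⟨ht1.le, by linarith⟩
        ⟨by linarith [ht.1], by linarith [ht.2]⟩ hx (hy n)]
    simp only [Function.comp, slope_def_field, intervalIntegral.integral_same, sub_zero]
    congr 1
    rw [intervalIntegral.integral_symm, ← neg_sub x (y n), div_neg, neg_div, neg_neg]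

end IsLayerFlow

/-! ### From doubled times to the diagonal. -/

/-- A continuous function of two time variables with nonpositive divergence decreases along the
diagonal. -/
theorem diagonal_antitone {f : ℝ → ℝ → ℝ} (hf : Continuous (Function.uncurry f)) {T : ℝ}
    (hrect : ∀ t h, 0 < t → 0 < h → t + h < T →
      (∫ s in t..t + h, (f (t + h) s - f t s)) + (∫ τ in t..t + h, (f τ (t + h) - f τ t)) ≤ 0)
    {τ₁ τ₂ : ℝ} (h1 : 0 < τ₁) (h12 : τ₁ ≤ τ₂) (h2 : τ₂ < T) : f τ₂ τ₂ ≤ f τ₁ τ₁ := by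
  have hfl : ∀ t, Continuous fun s => f t s := fun t =>
    hf.comp (by fun_prop : Continuous fun s : ℝ => (t, s))
  have hfr : ∀ s, Continuous fun t => f t s := fun s =>
    hf.comp (by fun_prop : Continuous fun t : ℝ => (t, s))
  have hcB : ∀ h, Continuous fun p : ℝ × ℝ => ∫ s in p.1..p.1 + h, f p.2 s := by
    intro h
    have hu : Continuous (Function.uncurry fun (p : ℝ × ℝ) (s : ℝ) => f p.2 s) :=
      hf.comp (by fun_prop : Continuous fun q : (ℝ × ℝ) × ℝ => (q.1.2, q.2))
    have e : (fun p : ℝ × ℝ => ∫ s in p.1..p.1 + h, f p.2 s) = fun p : ℝ × ℝ =>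
        (∫ s in (0 : ℝ)..p.1 + h, f p.2 s) - ∫ s in (0 : ℝ)..p.1, f p.2 s := by
      ext p
      exact (intervalIntegral.integral_interval_sub_left ((hfl _).intervalIntegrable _ _)
        ((hfl _).intervalIntegrable _ _)).symm
    rw [e]
    exact (intervalIntegral.continuous_parametric_intervalIntegral_of_continuous hu
      (by fun_prop)).sub (intervalIntegral.continuous_parametric_intervalIntegral_of_continuous hu
      (by fun_prop))
  have hcB' : ∀ h, Continuous fun p : ℝ × ℝ => ∫ t in p.1..p.1 + h, f t p.2 := by
    intro h
    have hu : Continuous (Function.uncurry fun (p : ℝ × ℝ) (t : ℝ) => f t p.2) :=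
      hf.comp (by fun_prop : Continuous fun q : (ℝ × ℝ) × ℝ => (q.2, q.1.2))
    have e : (fun p : ℝ × ℝ => ∫ t in p.1..p.1 + h, f t p.2) = fun p : ℝ × ℝ =>
        (∫ t in (0 : ℝ)..p.1 + h, f t p.2) - ∫ t in (0 : ℝ)..p.1, f t p.2 := by
      ext p
      exact (intervalIntegral.integral_interval_sub_left ((hfr _).intervalIntegrable _ _)
        ((hfr _).intervalIntegrable _ _)).symm
    rw [e]
    exact (intervalIntegral.continuous_parametric_intervalIntegral_of_continuous hu
      (by fun_prop)).sub (intervalIntegral.continuous_parametric_intervalIntegral_of_continuous hu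
      (by fun_prop))
  have hwin : ∀ {g : ℝ → ℝ}, Continuous g → ∀ h a,
      HasDerivAt (fun a => ∫ t in a..a + h, g t) (g (a + h) - g a) a := by
    intro g hg h a
    have e : (fun a => ∫ t in a..a + h, g t) = fun a =>
        (∫ t in (0 : ℝ)..a + h, g t) - ∫ t in (0 : ℝ)..a, g t := by
      ext p
      exact (intervalIntegral.integral_interval_sub_left (hg.intervalIntegrable _ _)
        (hg.intervalIntegrable _ _)).symm
    rw [e]
    exact ((hg.integral_hasStrictDerivAt 0 (a + h)).hasDerivAt.comp_add_const a h).sub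
      (hg.integral_hasStrictDerivAt 0 a).hasDerivAt
  have hswap : ∀ h a b, ∫ t in a..a + h, ∫ s in b..b + h, f t s =
      ∫ s in b..b + h, ∫ t in a..a + h, f t s := fun h a b =>
    intervalIntegral_intervalIntegral_swap
      ((hf.continuousOn.integrableOn_compact
        (isCompact_uIcc.prod isCompact_uIcc)).mono_set
        (prod_mono uIoc_subset_uIcc uIoc_subset_uIcc))
  -- When the square `[τ, τ+h]²` slides along the diagonal, the integral of `f` over it changes by
  -- the integrals over its sides, which is the quantity bounded in `hrect`. The integral thus
  -- decreases in `τ`, and small squares recover the values on the diagonal.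
  have hder : ∀ h τ, HasDerivAt (fun τ => ∫ t in τ..τ + h, ∫ s in τ..τ + h, f t s)
      ((∫ s in τ..τ + h, (f (τ + h) s - f τ s)) + (∫ t in τ..τ + h, (f t (τ + h) - f t τ))) τ := by
    intro h τ
    set Φ : ℝ → ℝ → ℝ := fun a b => ∫ t in a..a + h, ∫ s in b..b + h, f t s with hΦ
    set d₁ : ℝ → ℝ → ℝ := fun a b => (∫ s in b..b + h, f (a + h) s) - ∫ s in b..b + h, f a s
    set d₂ : ℝ → ℝ → ℝ := fun a b => (∫ t in a..a + h, f t (b + h)) - ∫ t in a..a + h, f t b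
    have D1 : ∀ a b, HasDerivAt (fun a => Φ a b) (d₁ a b) a := fun a b =>
      hwin ((hcB h).comp (by fun_prop : Continuous fun t : ℝ => (b, t))) h a
    have D2 : ∀ a b, HasDerivAt (fun b => Φ a b) (d₂ a b) b := fun a b => by
      simp only [hΦ, hswap h a]
      exact hwin ((hcB' h).comp (by fun_prop : Continuous fun t : ℝ => (a, t))) h b
    have c1 : Continuous fun p : ℝ × ℝ => d₁ p.1 p.2 :=
      ((hcB h).comp (by fun_prop : Continuous fun p : ℝ × ℝ => (p.2, p.1 + h))).sub
        ((hcB h).comp (by fun_prop : Continuous fun p : ℝ × ℝ => (p.2, p.1)))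
    have c2 : Continuous fun p : ℝ × ℝ => d₂ p.1 p.2 :=
      ((hcB' h).comp (by fun_prop : Continuous fun p : ℝ × ℝ => (p.1, p.2 + h))).sub
        ((hcB' h).comp (by fun_prop : Continuous fun p : ℝ × ℝ => (p.1, p.2)))
    have hF := hasStrictFDerivAt_uncurry_coprod (𝕜 := ℝ) (u := (τ, τ)) (f := Φ)
      (f₁ := fun a b => ContinuousLinearMap.toSpanSingleton ℝ (d₁ a b))
      (f₂ := fun a b => ContinuousLinearMap.toSpanSingleton ℝ (d₂ a b))
      (Eventually.of_forall fun p => (D1 p.1 p.2).hasFDerivAt)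
      (Eventually.of_forall fun p => (D2 p.1 p.2).hasFDerivAt)
      (((ContinuousLinearMap.toSpanSingletonCLE (𝕜 := ℝ) (E := ℝ)).continuous.comp c1).continuousAt)
      (((ContinuousLinearMap.toSpanSingletonCLE (𝕜 := ℝ) (E := ℝ)).continuous.comp c2).continuousAt)
    have hdiag : HasDerivAt (fun τ : ℝ => (τ, τ)) ((1 : ℝ), (1 : ℝ)) τ :=
      (hasDerivAt_id τ).prodMk (hasDerivAt_id τ)
    have := HasFDerivAt.comp_hasDerivAt (l := Function.uncurry Φ) (f := fun τ : ℝ => (τ, τ)) τ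
      hF.hasFDerivAt hdiag
    refine this.congr_deriv ?_
    rw [intervalIntegral.integral_sub ((hfl _).intervalIntegrable _ _)
      ((hfl _).intervalIntegrable _ _), intervalIntegral.integral_sub
      ((hfr _).intervalIntegrable _ _) ((hfr _).intervalIntegrable _ _)]
    simp [d₁, d₂, Function.HasUncurry.uncurry]
  have hanti : ∀ h, 0 < h → τ₂ + h < T →
      (∫ t in τ₂..τ₂ + h, ∫ s in τ₂..τ₂ + h, f t s) ≤
        ∫ t in τ₁..τ₁ + h, ∫ s in τ₁..τ₁ + h, f t s := by
    intro h hh hT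
    have := antitoneOn_of_deriv_nonpos (D := Icc τ₁ τ₂) (convex_Icc _ _)
      (f := fun τ => ∫ t in τ..τ + h, ∫ s in τ..τ + h, f t s)
      (fun τ _ => (hder h τ).continuousAt.continuousWithinAt)
      (fun τ _ => (hder h τ).differentiableAt.differentiableWithinAt)
      (fun τ hτ => by
        rw [(hder h τ).deriv]
        rw [interior_Icc] at hτ
        exact hrect τ h (h1.trans hτ.1) hh (by linarith [hτ.2]))
    exact this (left_mem_Icc.2 h12) (right_mem_Icc.2 h12) h12
  refine le_of_forall_pos_le_add fun η hη => ?_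
  have hcont : ∀ τ, ∃ δ > 0, ∀ t s, |t - τ| < δ → |s - τ| < δ → |f t s - f τ τ| < η / 2 := by
    intro τ
    obtain ⟨δ, hδ, H⟩ := Metric.continuousAt_iff.1 (hf.continuousAt (x := (τ, τ))) (η / 2)
      (by positivity)
    refine ⟨δ, hδ, fun t s ht hs => ?_⟩
    have := H (x := (t, s)) (by
      rw [Prod.dist_eq]; exact max_lt ht hs)
    exact this
  obtain ⟨δ₁, hδ₁, H₁⟩ := hcont τ₁
  obtain ⟨δ₂, hδ₂, H₂⟩ := hcont τ₂
  obtain ⟨h, hh, hlt⟩ := exists_between (lt_min (lt_min hδ₁ hδ₂) (sub_pos.2 h2))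
  have hl1 : h < δ₁ := hlt.trans_le ((min_le_left _ _).trans (min_le_left _ _))
  have hl2 : h < δ₂ := hlt.trans_le ((min_le_left _ _).trans (min_le_right _ _))
  have hl3 : h < T - τ₂ := hlt.trans_le (min_le_right _ _)
  have hA := hanti h hh (by linarith)
  have hci : ∀ τ, Continuous fun t => ∫ s in τ..τ + h, f t s := fun τ =>
    (hcB h).comp (by fun_prop : Continuous fun t : ℝ => (τ, t))
  have hconst : ∀ τ c : ℝ, ∫ _ in τ..τ + h, ∫ _ in τ..τ + h, c = h * (h * c) := by
    intro τ c; simp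
  have lo : h * (h * (f τ₂ τ₂ - η / 2)) ≤ ∫ t in τ₂..τ₂ + h, ∫ s in τ₂..τ₂ + h, f t s := by
    rw [← hconst τ₂]
    refine intervalIntegral.integral_mono_on (by linarith) (by simp)
      ((hci _).intervalIntegrable _ _) fun t ht => ?_
    refine intervalIntegral.integral_mono_on (by linarith) (by simp)
      ((hfl _).intervalIntegrable _ _) fun s hs => ?_
    have := abs_lt.1 (H₂ t s (by rw [abs_lt]; constructor <;> linarith [ht.1, ht.2])
      (by rw [abs_lt]; constructor <;> linarith [hs.1, hs.2]))
    linarith [this.1]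
  have hi : ∫ t in τ₁..τ₁ + h, ∫ s in τ₁..τ₁ + h, f t s ≤ h * (h * (f τ₁ τ₁ + η / 2)) := by
    rw [← hconst τ₁]
    refine intervalIntegral.integral_mono_on (by linarith) ((hci _).intervalIntegrable _ _)
      (by simp) fun t ht => ?_
    refine intervalIntegral.integral_mono_on (by linarith)
      ((hfl _).intervalIntegrable _ _) (by simp) fun s hs => ?_
    have := abs_lt.1 (H₁ t s (by rw [abs_lt]; constructor <;> linarith [ht.1, ht.2])
      (by rw [abs_lt]; constructor <;> linarith [hs.1, hs.2]))
    linarith [this.2]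
  have hfin := (lo.trans hA).trans hi
  have h3 := le_of_mul_le_mul_left (le_of_mul_le_mul_left hfin hh) hh
  linarith

/-! ### Several layers: ordering and boundary terms at the interfaces. -/

/-- A solution on a sequence of layers, with no flux through the end points of the domain. -/
structure IsFlow {N : ℕ} (node : Fin (N + 1) → ℝ) (T : ℝ) (m : Fin N → ℝ) (L : ℝ)
    (φ : Fin N → ℝ → ℝ) (u : Fin N → ℝ → ℝ → ℝ) (W : ℝ → ℝ → ℝ) : Prop where
  layer : ∀ i, IsLayerFlow (node i.castSucc) (node i.succ) T (m i) L (φ i) (u i) W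
  left : ∀ t, W (node 0) t = 0
  right : ∀ t, W (node (Fin.last N)) t = 0

/-- Compatibility of two families of saturations at the interfaces: the traces from both sides are
ordered in the same way. -/
def IsOrderedAtInterfaces {N : ℕ} (node : Fin (N + 1) → ℝ) (T : ℝ) (u v : Fin N → ℝ → ℝ → ℝ) :
    Prop :=
  ∀ i j : Fin N, i.succ = j.castSucc → ∀ᵐ p : ℝ × ℝ, p.1 ∈ Ioo 0 T → p.2 ∈ Ioo 0 T →
    (u i (node i.succ) p.1 < v i (node i.succ) p.2 →
      u j (node i.succ) p.1 ≤ v j (node i.succ) p.2) ∧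
    (v i (node i.succ) p.2 < u i (node i.succ) p.1 →
      v j (node i.succ) p.2 ≤ u j (node i.succ) p.1)

section

variable {N : ℕ} {node : Fin (N + 1) → ℝ} {T L : ℝ} {m : Fin N → ℝ} {φ : Fin N → ℝ → ℝ}
  {u v : Fin N → ℝ → ℝ → ℝ} {W V : ℝ → ℝ → ℝ}

/-- The pairs of times at which `u(t)` exceeds `v(s)` on some side of the node `k`. -/
def exceedSet (node : Fin (N + 1) → ℝ) (u v : Fin N → ℝ → ℝ → ℝ) (k : Fin (N + 1)) :
    Set (ℝ × ℝ) :=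
  {p | ∃ i : Fin N, (i.succ = k ∨ i.castSucc = k) ∧ v i (node k) p.2 < u i (node k) p.1}

theorem measurableSet_exceedSet (hu : ∀ i, Continuous (Function.uncurry (u i)))
    (hv : ∀ i, Continuous (Function.uncurry (v i))) (k : Fin (N + 1)) :
    MeasurableSet (exceedSet node u v k) := by
  have e : exceedSet node u v k = ⋃ i : Fin N, ⋃ _ : (i.succ = k ∨ i.castSucc = k),
      {p : ℝ × ℝ | v i (node k) p.2 < u i (node k) p.1} := by
    ext p; simp [exceedSet]
  rw [e]
  refine (isOpen_iUnion fun i => isOpen_iUnion fun _ => isOpen_lt ?_ ?_).measurableSet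
  · exact (hv i).comp (by fun_prop : Continuous fun p : ℝ × ℝ => (node k, p.2))
  · exact (hu i).comp (by fun_prop : Continuous fun p : ℝ × ℝ => (node k, p.1))

/-- Membership only asks for a strict excess on some side of the node; the ordering at the interface
excludes a strict deficit on the other side. One indicator can therefore serve both adjacent layers.
-/
theorem le_of_mem_exceedSet (hord : IsOrderedAtInterfaces node T u v) :
    ∀ᵐ p : ℝ × ℝ, p.1 ∈ Ioo 0 T → p.2 ∈ Ioo 0 T → ∀ k : Fin (N + 1),
      p ∈ exceedSet node u v k → ∀ i : Fin N, (i.succ = k ∨ i.castSucc = k) →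
        v i (node k) p.2 ≤ u i (node k) p.1 := by
  have h : ∀ᵐ p : ℝ × ℝ, ∀ i j : Fin N, i.succ = j.castSucc → p.1 ∈ Ioo 0 T → p.2 ∈ Ioo 0 T →
    (u i (node i.succ) p.1 < v i (node i.succ) p.2 →
      u j (node i.succ) p.1 ≤ v j (node i.succ) p.2) ∧
    (v i (node i.succ) p.2 < u i (node i.succ) p.1 →
      v j (node i.succ) p.2 ≤ u j (node i.succ) p.1) := by
    rw [ae_all_iff]; intro i
    rw [ae_all_iff]; intro j
    by_cases hij : i.succ = j.castSucc
    · filter_upwards [hord i j hij] with p hp _ using hp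
    · exact Eventually.of_forall fun p hp => absurd hp hij
  filter_upwards [h] with p hp h1 h2 k hk i hi
  obtain ⟨j, hj, hlt⟩ := hk
  rcases hi with rfl | rfl
  · rcases hj with hj | hj
    · obtain rfl := Fin.succ_injective _ hj
      exact hlt.le
    · by_contra hcon
      exact absurd ((hp i j hj.symm h1 h2).1 (not_le.1 hcon)) (not_le.2 hlt)
  · rcases hj with hj | hj
    · have := (hp j i hj h1 h2).2
      rw [hj] at this
      exact this hlt
    · obtain rfl := Fin.castSucc_injective _ hj
      exact hlt.le

/-- On one side of a node, the decrease of the gap is controlled by the decrease of the difference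
of the Kirchhoff transforms, localised to `exceedSet`. -/
theorem gap_sub_le (hφs : ∀ i, StrictMonoOn (φ i) (Icc 0 1))
    (hu : ∀ i x t, u i x t ∈ Icc (0 : ℝ) 1) (hv : ∀ i x t, v i x t ∈ Icc (0 : ℝ) 1)
    {t s : ℝ} {k : Fin (N + 1)} {i : Fin N} (hi : i.succ = k ∨ i.castSucc = k)
    (hle : (t, s) ∈ exceedSet node u v k → v i (node k) s ≤ u i (node k) t) (y : ℝ) :
    gap (φ i) (u i) (v i) (node k) t s - gap (φ i) (u i) (v i) y t s ≤
      (exceedSet node u v k).indicator (fun _ => (1 : ℝ)) (t, s) *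
        ((φ i (u i (node k) t) - φ i (u i y t)) - (φ i (v i (node k) s) - φ i (v i y s))) := by
  -- On the set, the positive part at the node is the difference itself and dominates the difference
  -- at `y`. Off the set it vanishes at the node and is nonnegative at `y`.
  by_cases hmem : (t, s) ∈ exceedSet node u v k
  · rw [indicator_of_mem hmem, one_mul]
    have h1 := (hφs i).monotoneOn (hv i _ s) (hu i _ t) (hle hmem)
    have h2 : φ i (u i y t) - φ i (v i y s) ≤ gap (φ i) (u i) (v i) y t s := le_max_left _ _
    have h3 : gap (φ i) (u i) (v i) (node k) t s = φ i (u i (node k) t) - φ i (v i (node k) s) :=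
      max_eq_left (sub_nonneg.2 h1)
    linarith
  · rw [indicator_of_notMem hmem, zero_mul]
    have h1 : u i (node k) t ≤ v i (node k) s := by
      by_contra hcon
      exact hmem ⟨i, hi, not_le.1 hcon⟩
    have h2 := (hφs i).monotoneOn (hu i _ t) (hv i _ s) h1
    have h3 : gap (φ i) (u i) (v i) (node k) t s = 0 := max_eq_right (sub_nonpos.2 h2)
    have h4 : 0 ≤ gap (φ i) (u i) (v i) y t s := le_max_right _ _
    linarith

end

/-- Weak-* convergence of the difference quotients of `φ(u(·,t)) - φ(v(·,s))`, in doubled time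
variables. -/
theorem tendsto_doubleIntegral_slope {a b T m L : ℝ} {φ : ℝ → ℝ} {u W v V : ℝ → ℝ → ℝ}
    (h : IsLayerFlow a b T m L φ u W) (h' : IsLayerFlow a b T m L φ v V) (hφ : Continuous φ)
    {t₁ t₂ s₁ s₂ x : ℝ} (ht1 : 0 < t₁) (ht12 : t₁ ≤ t₂) (ht2 : t₂ < T)
    (hs1 : 0 < s₁) (hs12 : s₁ ≤ s₂) (hs2 : s₂ < T) (hx : x ∈ Icc a b)
    {y : ℕ → ℝ} (hy : ∀ n, y n ∈ Icc a b) (hyx : ∀ n, y n ≠ x) (hlim : Tendsto y atTop (𝓝 x))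
    {c : ℝ → ℝ → ℝ} (hc : Measurable (Function.uncurry c)) (hc1 : ∀ t s, |c t s| ≤ 1) :
    Tendsto (fun n => ∫ t in t₁..t₂, ∫ s in s₁..s₂, c t s *
      (((φ (u x t) - φ (u (y n) t)) - (φ (v x s) - φ (v (y n) s))) / (x - y n))) atTop
      (𝓝 (∫ t in t₁..t₂, ∫ s in s₁..s₂, c t s *
        (deriv (fun τ => W x τ) t - deriv (fun τ => V x τ) s))) := by
  have hL := h.nonneg_lip
  have hcs : Measurable (Function.uncurry fun s t => c t s) := hc.comp measurable_swap
  have hslope : ∀ {w Z : ℝ → ℝ → ℝ}, IsLayerFlow a b T m L φ w Z → ∀ n t,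
      |(φ (w x t) - φ (w (y n) t)) / (x - y n)| ≤ L := fun hw n t => by
    have : 0 < |x - y n| := abs_pos.2 (sub_ne_zero.2 (hyx n).symm)
    rw [abs_div, div_le_iff₀ this]
    exact hw.lip t x (y n)
  have hsm : ∀ {w Z : ℝ → ℝ → ℝ}, IsLayerFlow a b T m L φ w Z → ∀ n,
      Measurable fun t => (φ (w x t) - φ (w (y n) t)) / (x - y n) := fun hw n =>
    (((hφ.comp (hw.continuous_saturation_right x)).sub
      (hφ.comp (hw.continuous_saturation_right (y n)))).div_const _).measurable
  -- One quotient depends on `t` alone and the other on `s` alone. Integrating the weight in the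
  -- other time leaves a bounded measurable kernel in one variable, to which the one-solution weak-*
  -- convergence applies.
  have split : ∀ {f g : ℝ → ℝ}, Measurable f → Measurable g → (∀ t, |f t| ≤ L) →
      (∀ t, |g t| ≤ L) → ∫ t in t₁..t₂, ∫ s in s₁..s₂, c t s * (f t - g s) =
      (∫ t in t₁..t₂, (∫ s in s₁..s₂, c t s) * f t) -
        ∫ s in s₁..s₂, (∫ t in t₁..t₂, c t s) * g s := by
    intro f g hf hg hfb hgb
    have hcg : Measurable (Function.uncurry fun t s => c t s * g s) :=
      hc.mul (hg.comp measurable_snd)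
    have hcgb : ∀ t s, |c t s * g s| ≤ 1 * L := fun t s =>
      (abs_mul _ _).trans_le (mul_le_mul (hc1 t s) (hgb s) (abs_nonneg _) zero_le_one)
    have hcf : ∀ t, IntervalIntegrable (fun s => c t s * f t) volume s₁ s₂ := fun t =>
      intervalIntegrable_of_measurable_of_bounded
        ((hc.comp measurable_prodMk_left).mul_const _) (C := 1 * |f t|) (fun s =>
          (abs_mul _ _).trans_le (mul_le_mul_of_nonneg_right (hc1 t s) (abs_nonneg _))) _ _
    have hcg' : ∀ t, IntervalIntegrable (fun s => c t s * g s) volume s₁ s₂ := fun t =>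
      intervalIntegrable_of_measurable_of_bounded (hcg.comp measurable_prodMk_left) (hcgb t) _ _
    have e1 : ∀ t, ∫ s in s₁..s₂, c t s * (f t - g s) =
        (∫ s in s₁..s₂, c t s) * f t - ∫ s in s₁..s₂, c t s * g s := fun t => by
      rw [← intervalIntegral.integral_mul_const, ← intervalIntegral.integral_sub (hcf t) (hcg' t)]
      congr 1; ext s; ring
    simp only [e1]
    rw [intervalIntegral.integral_sub, intervalIntegral_swap_of_bounded hcg hcgb]
    · congr 1
      refine intervalIntegral.integral_congr fun s _ => ?_
      exact intervalIntegral.integral_mul_const _ _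
    · exact intervalIntegrable_of_measurable_of_bounded
        ((measurable_intervalIntegral hc s₁ s₂).mul hf) (C := 1 * |s₂ - s₁| * L) (fun t =>
          (abs_mul _ _).trans_le (mul_le_mul (abs_intervalIntegral_le (hc1 t) s₁ s₂) (hfb t)
            (abs_nonneg _) (by positivity))) _ _
    · exact intervalIntegrable_of_measurable_of_bounded (measurable_intervalIntegral hcg s₁ s₂)
        (fun t => abs_intervalIntegral_le (hcgb t) s₁ s₂) _ _
  have e : ∀ n, ∫ t in t₁..t₂, ∫ s in s₁..s₂, c t s *
      (((φ (u x t) - φ (u (y n) t)) - (φ (v x s) - φ (v (y n) s))) / (x - y n)) =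
      (∫ t in t₁..t₂, (∫ s in s₁..s₂, c t s) * ((φ (u x t) - φ (u (y n) t)) / (x - y n))) -
        ∫ s in s₁..s₂, (∫ t in t₁..t₂, c t s) * ((φ (v x s) - φ (v (y n) s)) / (x - y n)) :=
    fun n => by
      rw [← split (hsm h n) (hsm h' n) (hslope h n) (hslope h' n)]
      simp only [sub_div]
  simp only [e]
  rw [split (measurable_deriv _) (measurable_deriv _) (abs_deriv_le_of_lip hL (h.lipW x hx))
    (abs_deriv_le_of_lip hL (h'.lipW x hx))]
  exact (h.tendsto_integral_mul_slope hφ ht1 ht12 ht2 hx hy hyx hlim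
    (measurable_intervalIntegral hc s₁ s₂)
    (fun t => abs_intervalIntegral_le (hc1 t) s₁ s₂)).sub
    (h'.tendsto_integral_mul_slope hφ hs1 hs12 hs2 hx hy hyx hlim
    (measurable_intervalIntegral hcs t₁ t₂)
    (fun s => abs_intervalIntegral_le (fun t => hc1 t s) t₁ t₂))

/-! ### Removal of the cut-off and comparison of double integrals. -/

theorem tendsto_trapezoid {a b x : ℝ} (hx : x ∈ Ioo a b) {ε : ℕ → ℝ} (hε : ∀ n, 0 < ε n)
    (hlim : Tendsto ε atTop (𝓝 0)) : Tendsto (fun n => trapezoid a b (ε n) x) atTop (𝓝 1) := by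
  refine tendsto_const_nhds.congr' ?_
  filter_upwards [hlim.eventually (gt_mem_nhds (sub_pos.2 hx.1)),
    hlim.eventually (gt_mem_nhds (sub_pos.2 hx.2))] with n h1 h2
  rw [trapezoid, min_eq_left (le_min ((one_le_div (hε n)).2 h1.le) ((one_le_div (hε n)).2 h2.le)),
    max_eq_right zero_le_one]

theorem abs_pos_part_le_one {p c : ℝ} (hp : p ∈ Icc (0 : ℝ) 1) (hc : c ∈ Icc (0 : ℝ) 1) :
    |max (p - c) 0| ≤ 1 := by
  rw [abs_of_nonneg (le_max_right _ _)]
  exact max_le (by linarith [hp.2, hc.1]) zero_le_one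

theorem continuous_excess {a b m : ℝ} {ξ : ℝ → ℝ} {u v : ℝ → ℝ → ℝ} (hξ : Continuous ξ)
    (hu : Continuous (Function.uncurry u)) (hv : Continuous (Function.uncurry v)) :
    Continuous fun p : ℝ × ℝ => excess a b m ξ u v p.1 p.2 := by
  refine intervalIntegral.continuous_parametric_intervalIntegral_of_continuous' ?_ a b
  change Continuous fun q : (ℝ × ℝ) × ℝ => ξ q.2 *
    (m * max (Function.uncurry u (q.2, q.1.1) - Function.uncurry v (q.2, q.1.2)) 0)
  fun_prop

theorem tendsto_excess {a b m : ℝ} (hab : a ≤ b) {u v : ℝ → ℝ → ℝ}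
    (hu : Continuous (Function.uncurry u)) (hv : Continuous (Function.uncurry v))
    (hum : ∀ x t, u x t ∈ Icc (0 : ℝ) 1) (hvm : ∀ x t, v x t ∈ Icc (0 : ℝ) 1)
    {ε : ℕ → ℝ} (hε : ∀ n, 0 < ε n) (hlim : Tendsto ε atTop (𝓝 0)) (t s : ℝ) :
    Tendsto (fun n => excess a b m (trapezoid a b (ε n)) u v t s) atTop
      (𝓝 (excess a b m (fun _ => 1) u v t s)) := by
  have hne : ∀ᵐ x : ℝ, x ≠ b := by simp [ae_iff, measure_singleton]
  refine tendsto_intervalIntegral_of_bounded (C := 1 * (|m| * 1)) (fun n => ?_) (fun n x => ?_) ?_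
  · have h1 : Continuous fun x => u x t := hu.comp (by fun_prop : Continuous fun x : ℝ => (x, t))
    have h3 := continuous_of_lip (trapezoid_lip (a := a) (b := b) (hε n))
    exact Continuous.measurable (by fun_prop)
  · rw [abs_mul, abs_mul]
    gcongr
    · exact abs_trapezoid_le _ _ _ _
    · exact abs_pos_part_le_one (hum x t) (hvm x s)
  · filter_upwards [hne] with x hxb hx
    rw [uIoc_of_le hab] at hx
    exact (tendsto_trapezoid ⟨hx.1, lt_of_le_of_ne hx.2 hxb⟩ hε hlim).mul_const _

theorem abs_excess_le {a b m : ℝ} {ξ : ℝ → ℝ} {u v : ℝ → ℝ → ℝ} (hξ : ∀ x, |ξ x| ≤ 1)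
    (hum : ∀ x t, u x t ∈ Icc (0 : ℝ) 1) (hvm : ∀ x t, v x t ∈ Icc (0 : ℝ) 1) (t s : ℝ) :
    |excess a b m ξ u v t s| ≤ 1 * (|m| * 1) * |b - a| :=
  abs_intervalIntegral_le (fun x => by
    rw [abs_mul, abs_mul]
    gcongr
    · exact hξ x
    · exact abs_pos_part_le_one (hum x t) (hvm x s)) a b

theorem doubleIntegral_mono_ae {F G : ℝ → ℝ → ℝ} {CF CG t₁ t₂ s₁ s₂ : ℝ} (ht : t₁ ≤ t₂)
    (hs : s₁ ≤ s₂) (hF : Measurable (Function.uncurry F)) (hG : Measurable (Function.uncurry G))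
    (hFb : ∀ t s, |F t s| ≤ CF) (hGb : ∀ t s, |G t s| ≤ CG)
    (hle : ∀ᵐ t, t ∈ Icc t₁ t₂ → ∀ᵐ s, s ∈ Icc s₁ s₂ → F t s ≤ G t s) :
    ∫ t in t₁..t₂, ∫ s in s₁..s₂, F t s ≤ ∫ t in t₁..t₂, ∫ s in s₁..s₂, G t s := by
  have hi : ∀ {H : ℝ → ℝ → ℝ} {C : ℝ}, Measurable (Function.uncurry H) →
      (∀ t s, |H t s| ≤ C) → IntervalIntegrable (fun t => ∫ s in s₁..s₂, H t s) volume t₁ t₂ :=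
    fun hH hHb => intervalIntegrable_of_measurable_of_bounded (measurable_intervalIntegral hH s₁ s₂)
      (fun t => abs_intervalIntegral_le (hHb t) s₁ s₂) _ _
  rw [intervalIntegral.integral_of_le ht, intervalIntegral.integral_of_le ht]
  refine integral_mono_ae ((hi hF hFb).1) ((hi hG hGb).1) ?_
  refine (ae_restrict_iff' measurableSet_Ioc).2 ?_
  filter_upwards [hle] with t h1 h2
  simp only [intervalIntegral.integral_of_le hs]
  refine integral_mono_ae
    (intervalIntegrable_of_measurable_of_bounded (hF.comp measurable_prodMk_left) (hFb t) s₁ s₂).1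
    (intervalIntegrable_of_measurable_of_bounded (hG.comp measurable_prodMk_left) (hGb t) s₁ s₂).1
    ?_
  refine (ae_restrict_iff' measurableSet_Ioc).2 ?_
  filter_upwards [h1 (Ioc_subset_Icc_self h2)] with s h3 h4 using h3 (Ioc_subset_Icc_self h4)

theorem doubleIntegral_sub {F G : ℝ → ℝ → ℝ} {CF CG t₁ t₂ s₁ s₂ : ℝ}
    (hF : Measurable (Function.uncurry F)) (hG : Measurable (Function.uncurry G))
    (hFb : ∀ t s, |F t s| ≤ CF) (hGb : ∀ t s, |G t s| ≤ CG) :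
    ∫ t in t₁..t₂, ∫ s in s₁..s₂, (F t s - G t s) =
      (∫ t in t₁..t₂, ∫ s in s₁..s₂, F t s) - ∫ t in t₁..t₂, ∫ s in s₁..s₂, G t s := by
  have hi : ∀ {H : ℝ → ℝ → ℝ} {C : ℝ}, Measurable (Function.uncurry H) →
      (∀ t s, |H t s| ≤ C) → IntervalIntegrable (fun t => ∫ s in s₁..s₂, H t s) volume t₁ t₂ :=
    fun hH hHb => intervalIntegrable_of_measurable_of_bounded (measurable_intervalIntegral hH s₁ s₂)
      (fun t => abs_intervalIntegral_le (hHb t) s₁ s₂) _ _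
  rw [← intervalIntegral.integral_sub (hi hF hFb) (hi hG hGb)]
  refine intervalIntegral.integral_congr fun t _ => ?_
  exact intervalIntegral.integral_sub
    (intervalIntegrable_of_measurable_of_bounded (hF.comp measurable_prodMk_left) (hFb t) s₁ s₂)
    (intervalIntegrable_of_measurable_of_bounded (hG.comp measurable_prodMk_left) (hGb t) s₁ s₂)

/-! ### Summation over the layers and contraction for flows. -/

section

variable {N : ℕ} {node : Fin (N + 1) → ℝ} {T L : ℝ} {m : Fin N → ℝ} {φ : Fin N → ℝ → ℝ}
  {u v : Fin N → ℝ → ℝ → ℝ} {W V : ℝ → ℝ → ℝ}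

/-- The total excess `Σᵢ ∫ mᵢ (uᵢ(x,t) - vᵢ(x,s))⁺`. -/
noncomputable def totalExcess (node : Fin (N + 1) → ℝ) (m : Fin N → ℝ) (u v : Fin N → ℝ → ℝ → ℝ)
    (t s : ℝ) : ℝ :=
  ∑ i, excess (node i.castSucc) (node i.succ) (m i) (fun _ => 1) (u i) (v i) t s

theorem continuous_totalExcess (hu : ∀ i, Continuous (Function.uncurry (u i)))
    (hv : ∀ i, Continuous (Function.uncurry (v i))) :
    Continuous (Function.uncurry (totalExcess node m u v)) :=
  continuous_finsetSum Finset.univ fun i _ =>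
    continuous_excess (m := m i) (a := node i.castSucc) (b := node i.succ) (ξ := fun _ => 1)
      continuous_const (hu i) (hv i)

theorem abs_gap_sub_le {a b T m L : ℝ} {φ : ℝ → ℝ} {u W v V : ℝ → ℝ → ℝ}
    (h : IsLayerFlow a b T m L φ u W) (h' : IsLayerFlow a b T m L φ v V) (x y t s : ℝ) :
    |gap φ u v x t s - gap φ u v y t s| ≤ (L + L) * |x - y| := by
  refine (abs_max_sub_max_le_abs _ _ _).trans ?_
  have e : φ (u x t) - φ (v x s) - (φ (u y t) - φ (v y s)) =
    (φ (u x t) - φ (u y t)) - (φ (v x s) - φ (v y s)) := by ring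
  rw [e, add_mul]
  exact (abs_sub _ _).trans (add_le_add (h.lip t x y) (h'.lip s x y))

/-- The total excess has nonpositive divergence in doubled time variables. -/
theorem IsFlow.totalExcess_rectangle_le (hnode : StrictMono node)
    (h : IsFlow node T m L φ u W) (h' : IsFlow node T m L φ v V)
    (hφ : ∀ i, Continuous (φ i)) (hφm : ∀ i, Monotone (φ i))
    (hφs : ∀ i, StrictMonoOn (φ i) (Icc 0 1)) (hm : ∀ i, 0 ≤ m i)
    (hord : IsOrderedAtInterfaces node T u v) {t₁ t₂ s₁ s₂ : ℝ}
    (ht1 : 0 < t₁) (ht12 : t₁ ≤ t₂) (ht2 : t₂ < T)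
    (hs1 : 0 < s₁) (hs12 : s₁ ≤ s₂) (hs2 : s₂ < T) :
    (∫ s in s₁..s₂, (totalExcess node m u v t₂ s - totalExcess node m u v t₁ s)) +
      (∫ t in t₁..t₂, (totalExcess node m u v t s₂ - totalExcess node m u v t s₁)) ≤ 0 := by
  have hlen : ∀ i : Fin N, node i.castSucc < node i.succ := fun i =>
    hnode (Fin.castSucc_lt_succ)
  -- A common width such that the boundary strips of every layer fit without overlap.
  obtain ⟨δ, hδ, hδle⟩ : ∃ δ > 0, ∀ i : Fin N, 2 * δ ≤ node i.succ - node i.castSucc := by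
    rcases isEmpty_or_nonempty (Fin N) with hE | hE
    · exact ⟨1, one_pos, fun i => hE.elim i⟩
    · obtain ⟨j, hj⟩ := Finite.exists_min fun i : Fin N => node i.succ - node i.castSucc
      exact ⟨(node j.succ - node j.castSucc) / 2, by linarith [hlen j], fun i => by
        linarith [hj i]⟩
  set ε : ℕ → ℝ := fun n => δ * (1 / (n + 1 : ℝ)) with hεdef
  have hε : ∀ n, 0 < ε n := fun n => by positivity
  have hεδ : ∀ n, ε n ≤ δ := fun n => by
    refine mul_le_of_le_one_right hδ.le ?_
    rw [div_le_one (by positivity)]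
    have : (0 : ℝ) ≤ n := Nat.cast_nonneg n
    linarith
  have hεlim : Tendsto ε atTop (𝓝 0) := by
    have := (tendsto_one_div_add_atTop_nhds_zero_nat (𝕜 := ℝ)).const_mul δ
    rwa [mul_zero] at this
  set c : Fin (N + 1) → ℝ → ℝ → ℝ := fun k t s =>
    (exceedSet node u v k).indicator (fun _ => (1 : ℝ)) (t, s) with hcdef
  have hcm : ∀ k, Measurable (Function.uncurry (c k)) := fun k =>
    measurable_const.indicator (measurableSet_exceedSet (fun i => (h.layer i).cont)
      (fun i => (h'.layer i).cont) k)
  have hc1 : ∀ k t s, |c k t s| ≤ 1 := fun k t s => by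
    simp only [hcdef, indicator]
    split_ifs <;> simp
  -- This is the limiting boundary term at the node `k`. It is the same from both sides, because the
  -- weight depends on the node only and `W`, `V` are shared by all layers.
  set Λ : Fin (N + 1) → ℝ := fun k => ∫ t in t₁..t₂, ∫ s in s₁..s₂, c k t s *
    (deriv (fun τ => W (node k) τ) t - deriv (fun τ => V (node k) τ) s) with hΛ
  have hΛ0 : Λ 0 = 0 := by
    have e1 : (fun τ => W (node 0) τ) = fun _ => 0 := funext h.left
    have e2 : (fun τ => V (node 0) τ) = fun _ => 0 := funext h'.left
    simp [hΛ, e1, e2]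
  have hΛN : Λ (Fin.last N) = 0 := by
    have e1 : (fun τ => W (node (Fin.last N)) τ) = fun _ => 0 := funext h.right
    have e2 : (fun τ => V (node (Fin.last N)) τ) = fun _ => 0 := funext h'.right
    simp [hΛ, e1, e2]
  have hmeml : ∀ i : Fin N, node i.castSucc ∈ Icc (node i.castSucc) (node i.succ) := fun i =>
    left_mem_Icc.2 (hlen i).le
  have hmemr : ∀ i : Fin N, node i.succ ∈ Icc (node i.castSucc) (node i.succ) := fun i =>
    right_mem_Icc.2 (hlen i).le
  -- At the left end of a layer the denominator is `-ε n`, at the right end it is `ε n`. Both `A`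
  -- and `B` are thus genuine difference quotients, and the boundary contribution of the layer is `B
  -- - A`.
  set A : Fin N → ℕ → ℝ := fun i n => ∫ t in t₁..t₂, ∫ s in s₁..s₂, c i.castSucc t s *
      (((φ i (u i (node i.castSucc) t) - φ i (u i (node i.castSucc + ε n) t)) -
        (φ i (v i (node i.castSucc) s) - φ i (v i (node i.castSucc + ε n) s))) /
        (node i.castSucc - (node i.castSucc + ε n))) with hA
  set B : Fin N → ℕ → ℝ := fun i n => ∫ t in t₁..t₂, ∫ s in s₁..s₂, c i.succ t s *
      (((φ i (u i (node i.succ) t) - φ i (u i (node i.succ - ε n) t)) -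
        (φ i (v i (node i.succ) s) - φ i (v i (node i.succ - ε n) s))) /
        (node i.succ - (node i.succ - ε n))) with hB
  have hAlim : ∀ i, Tendsto (A i) atTop (𝓝 (Λ i.castSucc)) := fun i =>
    tendsto_doubleIntegral_slope (h.layer i) (h'.layer i) (hφ i) ht1 ht12 ht2 hs1 hs12 hs2
      (hmeml i) (y := fun n => node i.castSucc + ε n)
      (fun n => ⟨by linarith [hε n], by linarith [hεδ n, hδle i]⟩)
      (fun n => by simpa using (hε n).ne')
      (by simpa using hεlim.const_add (node i.castSucc)) (hcm _) (hc1 _)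
  have hBlim : ∀ i, Tendsto (B i) atTop (𝓝 (Λ i.succ)) := fun i =>
    tendsto_doubleIntegral_slope (h.layer i) (h'.layer i) (hφ i) ht1 ht12 ht2 hs1 hs12 hs2
      (hmemr i) (y := fun n => node i.succ - ε n)
      (fun n => ⟨by linarith [hεδ n, hδle i], by linarith [hε n]⟩)
      (fun n => by simpa using (hε n).ne')
      (by simpa using hεlim.const_sub (node i.succ)) (hcm _) (hc1 _)
  have hgc : ∀ i x, Measurable (Function.uncurry fun t s => gap (φ i) (u i) (v i) x t s) := by
    intro i x
    have h1 := (h.layer i).continuous_saturation_right x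
    have h2 := (h'.layer i).continuous_saturation_right x
    have h3 := hφ i
    refine Continuous.measurable ?_
    change Continuous fun p : ℝ × ℝ => max (φ i (u i x p.1) - φ i (v i x p.2)) 0
    fun_prop
  have hsm : ∀ i x y k r, Measurable (Function.uncurry fun t s => c k t s *
      (((φ i (u i x t) - φ i (u i y t)) - (φ i (v i x s) - φ i (v i y s))) / r)) := by
    intro i x y k r
    have h1 := (h.layer i).continuous_saturation_right x
    have h2 := (h'.layer i).continuous_saturation_right x
    have h4 := (h.layer i).continuous_saturation_right y
    have h5 := (h'.layer i).continuous_saturation_right y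
    have h3 := hφ i
    refine (hcm k).mul (Continuous.measurable ?_)
    fun_prop
  have hsb : ∀ i x y k r t s, |c k t s *
      (((φ i (u i x t) - φ i (u i y t)) - (φ i (v i x s) - φ i (v i y s))) / r)| ≤
      1 * ((L * |x - y| + L * |x - y|) / |r|) := by
    intro i x y k r t s
    rw [abs_mul, abs_div]
    gcongr
    · exact hc1 k t s
    · exact (abs_sub _ _).trans (add_le_add ((h.layer i).lip t x y) ((h'.layer i).lip s x y))
  have hae : ∀ᵐ t, ∀ᵐ s, t ∈ Ioo 0 T → s ∈ Ioo 0 T → ∀ k : Fin (N + 1),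
      (t, s) ∈ exceedSet node u v k → ∀ i : Fin N, (i.succ = k ∨ i.castSucc = k) →
        v i (node k) s ≤ u i (node k) t := by
    have := le_of_mem_exceedSet hord
    rw [Measure.volume_eq_prod] at this
    exact Measure.ae_ae_of_ae_prod this
  have hstep : ∀ i n, ∫ t in t₁..t₂, ∫ s in s₁..s₂,
      (gap (φ i) (u i) (v i) (node i.castSucc) t s -
        gap (φ i) (u i) (v i) (node i.castSucc + ε n) t s +
        (gap (φ i) (u i) (v i) (node i.succ) t s -
          gap (φ i) (u i) (v i) (node i.succ - ε n) t s)) / ε n ≤ B i n - A i n := by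
    intro i n
    rw [hA, hB, ← doubleIntegral_sub (hsm i _ _ _ _) (hsm i _ _ _ _) (hsb i _ _ _ _)
      (hsb i _ _ _ _)]
    refine doubleIntegral_mono_ae ht12 hs12
      (CF := ((L + L) * |node i.castSucc - (node i.castSucc + ε n)| +
        (L + L) * |node i.succ - (node i.succ - ε n)|) / ε n)
      (((hgc i _).sub (hgc i _)).add ((hgc i _).sub (hgc i _)) |>.div_const _)
      ((hsm i _ _ _ _).sub (hsm i _ _ _ _)) (fun t s => ?_)
      (fun t s => (abs_sub _ _).trans (add_le_add (hsb i _ _ _ _ t s) (hsb i _ _ _ _ t s))) ?_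
    · rw [abs_div, abs_of_pos (hε n)]
      have := (hε n).le
      gcongr
      exact (abs_add_le _ _).trans (add_le_add (abs_gap_sub_le (h.layer i) (h'.layer i) _ _ t s)
        (abs_gap_sub_le (h.layer i) (h'.layer i) _ _ t s))
    · filter_upwards [hae] with t ht htm
      filter_upwards [ht] with s hs hsm
      have hk := hs ⟨by linarith [htm.1], by linarith [htm.2]⟩
        ⟨by linarith [hsm.1], by linarith [hsm.2]⟩
      have g1 := gap_sub_le hφs (fun i => (h.layer i).mem) (fun i => (h'.layer i).mem)
        (Or.inr rfl) (fun hmem => hk i.castSucc hmem i (Or.inr rfl)) (node i.castSucc + ε n)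
      have g2 := gap_sub_le hφs (fun i => (h.layer i).mem) (fun i => (h'.layer i).mem)
        (Or.inl rfl) (fun hmem => hk i.succ hmem i (Or.inl rfl)) (node i.succ - ε n)
      have g3 := div_le_div_of_nonneg_right (add_le_add g1 g2) (hε n).le
      refine g3.trans_eq ?_
      rw [sub_add_cancel_left, sub_sub_cancel, div_neg, mul_neg, sub_neg_eq_add, add_div,
        mul_div_assoc, mul_div_assoc, add_comm]
  have hineq : ∀ n, ∑ i, ((∫ s in s₁..s₂,
      (excess (node i.castSucc) (node i.succ) (m i)
        (trapezoid (node i.castSucc) (node i.succ) (ε n)) (u i) (v i) t₂ s -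
      excess (node i.castSucc) (node i.succ) (m i)
        (trapezoid (node i.castSucc) (node i.succ) (ε n)) (u i) (v i) t₁ s)) +
      (∫ t in t₁..t₂, (excess (node i.castSucc) (node i.succ) (m i)
        (trapezoid (node i.castSucc) (node i.succ) (ε n)) (u i) (v i) t s₂ -
      excess (node i.castSucc) (node i.succ) (m i)
        (trapezoid (node i.castSucc) (node i.succ) (ε n)) (u i) (v i) t s₁))) ≤
      ∑ i, (B i n - A i n) := fun n => Finset.sum_le_sum fun i _ =>
    ((h.layer i).excess_rectangle_le (h'.layer i) (hφ i) (hφm i) (hφs i) (hm i) (hε n)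
      (by linarith [hεδ n, hδle i]) ht1 ht12 ht2 hs1 hs12 hs2).trans (hstep i n)
  -- The sum telescopes to `Λ` at the last node minus `Λ` at the first, and both vanish since there
  -- is no flux through the ends.
  have htel : ∑ i : Fin N, (Λ i.succ - Λ i.castSucc) = 0 := by
    have e1 := Fin.sum_univ_succ Λ
    have e2 := Fin.sum_univ_castSucc Λ
    rw [Finset.sum_sub_distrib]
    linarith
  have hR : Tendsto (fun n => ∑ i, (B i n - A i n)) atTop (𝓝 0) := by
    rw [← htel]
    exact tendsto_finsetSum _ fun i _ => (hBlim i).sub (hAlim i)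
  have hbd : ∀ i n t s, |excess (node i.castSucc) (node i.succ) (m i)
        (trapezoid (node i.castSucc) (node i.succ) (ε n)) (u i) (v i) t s| ≤ _ := fun i n t s =>
    abs_excess_le (fun x => abs_trapezoid_le _ _ _ x) (h.layer i).mem (h'.layer i).mem t s
  have hcx : ∀ i n, Continuous fun p : ℝ × ℝ => excess (node i.castSucc) (node i.succ) (m i)
        (trapezoid (node i.castSucc) (node i.succ) (ε n)) (u i) (v i) p.1 p.2 := fun i n =>
    continuous_excess (continuous_of_lip (trapezoid_lip (hε n))) (h.layer i).cont (h'.layer i).cont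
  have hlx : ∀ i t s, Tendsto (fun n => excess (node i.castSucc) (node i.succ) (m i)
        (trapezoid (node i.castSucc) (node i.succ) (ε n)) (u i) (v i) t s) atTop
        (𝓝 (excess (node i.castSucc) (node i.succ) (m i) (fun _ => 1) (u i) (v i) t s)) :=
    fun i t s => tendsto_excess (hlen i).le (h.layer i).cont (h'.layer i).cont (h.layer i).mem
      (h'.layer i).mem hε hεlim t s
  have hleft := fun t : ℝ => (by fun_prop : Continuous fun s : ℝ => (t, s))
  have hright := fun s : ℝ => (by fun_prop : Continuous fun t : ℝ => (t, s))
  have hLlim := tendsto_finsetSum (f := fun i n => (∫ s in s₁..s₂,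
      (excess (node i.castSucc) (node i.succ) (m i)
        (trapezoid (node i.castSucc) (node i.succ) (ε n)) (u i) (v i) t₂ s -
      excess (node i.castSucc) (node i.succ) (m i)
        (trapezoid (node i.castSucc) (node i.succ) (ε n)) (u i) (v i) t₁ s)) +
      (∫ t in t₁..t₂, (excess (node i.castSucc) (node i.succ) (m i)
        (trapezoid (node i.castSucc) (node i.succ) (ε n)) (u i) (v i) t s₂ -
      excess (node i.castSucc) (node i.succ) (m i)
        (trapezoid (node i.castSucc) (node i.succ) (ε n)) (u i) (v i) t s₁)))
    Finset.univ fun i _ => Tendsto.add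
    (tendsto_intervalIntegral_of_bounded (a := s₁) (b := s₂)
      (fun n => (((hcx i n).comp (hleft t₂)).sub ((hcx i n).comp (hleft t₁))).measurable)
      (fun n s => (abs_sub _ _).trans (add_le_add (hbd i n _ _) (hbd i n _ _)))
      (Eventually.of_forall fun s _ => (hlx i t₂ s).sub (hlx i t₁ s)))
    (tendsto_intervalIntegral_of_bounded (a := t₁) (b := t₂)
      (fun n => (((hcx i n).comp (hright s₂)).sub ((hcx i n).comp (hright s₁))).measurable)
      (fun n t => (abs_sub _ _).trans (add_le_add (hbd i n _ _) (hbd i n _ _)))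
      (Eventually.of_forall fun t _ => (hlx i t s₂).sub (hlx i t s₁)))
  refine le_of_eq_of_le ?_ (le_of_tendsto_of_tendsto' hLlim hR hineq)
  have hcx1 : ∀ i : Fin N, Continuous fun p : ℝ × ℝ => excess (node i.castSucc) (node i.succ) (m i)
        (fun _ => 1) (u i) (v i) p.1 p.2 := fun i =>
    continuous_excess continuous_const (h.layer i).cont (h'.layer i).cont
  rw [Finset.sum_add_distrib]
  unfold totalExcess
  simp only [← Finset.sum_sub_distrib]
  have hI1 : ∀ i : Fin N, IntervalIntegrable (fun s => excess (node i.castSucc) (node i.succ) (m i)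
      (fun _ => 1) (u i) (v i) t₂ s - excess (node i.castSucc) (node i.succ) (m i)
      (fun _ => 1) (u i) (v i) t₁ s) volume s₁ s₂ := fun i =>
    (((hcx1 i).comp (hleft t₂)).sub ((hcx1 i).comp (hleft t₁))).intervalIntegrable _ _
  have hI2 : ∀ i : Fin N, IntervalIntegrable (fun t => excess (node i.castSucc) (node i.succ) (m i)
      (fun _ => 1) (u i) (v i) t s₂ - excess (node i.castSucc) (node i.succ) (m i)
      (fun _ => 1) (u i) (v i) t s₁) volume t₁ t₂ := fun i =>
    (((hcx1 i).comp (hright s₂)).sub ((hcx1 i).comp (hright s₁))).intervalIntegrable _ _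
  rw [intervalIntegral.integral_finsetSum fun i _ => hI1 i,
    intervalIntegral.integral_finsetSum fun i _ => hI2 i]

/-- `L¹` contraction for flows on a sequence of layers. -/
theorem IsFlow.totalExcess_le (hnode : StrictMono node) (hT : 0 < T)
    (h : IsFlow node T m L φ u W) (h' : IsFlow node T m L φ v V)
    (hφ : ∀ i, Continuous (φ i)) (hφm : ∀ i, Monotone (φ i))
    (hφs : ∀ i, StrictMonoOn (φ i) (Icc 0 1)) (hm : ∀ i, 0 ≤ m i)
    (hord : IsOrderedAtInterfaces node T u v) {t : ℝ} (ht : t ∈ Icc 0 T) :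
    totalExcess node m u v t t ≤ totalExcess node m u v 0 0 := by
  have hc := continuous_totalExcess (node := node) (m := m) (fun i => (h.layer i).cont)
    (fun i => (h'.layer i).cont)
  have hd : Continuous fun t => totalExcess node m u v t t :=
    hc.comp (by fun_prop : Continuous fun t : ℝ => (t, t))
  have hanti : AntitoneOn (fun t => totalExcess node m u v t t) (Ioo 0 T) :=
    fun x hx y hy hxy => diagonal_antitone hc (T := T) (fun t k h1 h2 h3 =>
      h.totalExcess_rectangle_le hnode h' hφ hφm hφs hm hord h1 (by linarith) h3 h1
        (by linarith) h3) hx.1 hxy hy.2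
  -- The doubled inequality concerns interior times; continuity reaches `0` here and `T` through the
  -- closure below.
  have hin : ∀ r ∈ Ioo 0 T, totalExcess node m u v r r ≤ totalExcess node m u v 0 0 := by
    intro r hr
    refine ge_of_tendsto ((hd.tendsto 0).mono_left (nhdsWithin_le_nhds (s := Ioi 0))) ?_
    filter_upwards [Ioo_mem_nhdsGT hr.1] with s hs
    exact hanti ⟨hs.1, hs.2.trans hr.2⟩ hr hs.2.le
  have hcl : closure (Ioo 0 T) ⊆ {r | totalExcess node m u v r r ≤ totalExcess node m u v 0 0} :=
    closure_minimal hin (isClosed_le hd continuous_const)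
  rw [closure_Ioo hT.ne] at hcl
  exact hcl ht

end

/-! ### From the weak formulation to an integrated balance law. -/

/-- Integration by parts with the primitive of an integrable function. -/
theorem integral_primitive_mul_deriv {a b : ℝ} {h ζ : ℝ → ℝ} (hh : IntervalIntegrable h volume a b)
    (hζ : ContDiff ℝ ∞ ζ) :
    ∫ x in a..b, (∫ z in a..x, h z) * deriv ζ x
      = (∫ z in a..b, h z) * ζ b - ∫ x in a..b, h x * ζ x := by
  have h1 := hh.absolutelyContinuousOnInterval_intervalIntegral (c := a) (by simp)
  have h2 : AbsolutelyContinuousOnInterval ζ a b :=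
    ((hζ.of_le (by norm_num)).contDiffOn).absolutelyContinuousOnInterval
  rw [h1.integral_mul_deriv_eq_deriv_mul h2]
  simp only [intervalIntegral.integral_same, zero_mul, sub_zero]
  congr 1
  refine intervalIntegral.integral_congr_ae ?_
  filter_upwards [hh.ae_hasDerivAt_integral] with x hx hxab
  rw [(hx (uIoc_subset_uIcc hxab) a (by simp)).deriv]

theorem measurable_primitive {α : Type*} [MeasurableSpace α] {F : α → ℝ → ℝ}
    (hF : Measurable (Function.uncurry F)) (c : ℝ) :
    Measurable fun p : α × ℝ => ∫ x in c..p.2, F p.1 x := by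
  have hG : Measurable fun q : (α × ℝ) × ℝ => F q.1.1 q.2 :=
    hF.comp (by fun_prop : Measurable fun q : (α × ℝ) × ℝ => (q.1.1, q.2))
  unfold intervalIntegral
  refine Measurable.sub ?_ ?_
  · have h1 : MeasurableSet {q : (α × ℝ) × ℝ | q.2 ∈ Ioc c q.1.2} :=
      (measurableSet_lt measurable_const measurable_snd).inter
        (measurableSet_le measurable_snd measurable_fst.snd)
    have h2 := ((hG.indicator h1).stronglyMeasurable.integral_prod_right' (ν := volume)).measurable
    convert h2 using 2 with p
    rw [← integral_indicator measurableSet_Ioc]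
    rfl
  · have h1 : MeasurableSet {q : (α × ℝ) × ℝ | q.2 ∈ Ioc q.1.2 c} :=
      (measurableSet_lt measurable_fst.snd measurable_snd).inter
        (measurableSet_le measurable_snd measurable_const)
    have h2 := ((hG.indicator h1).stronglyMeasurable.integral_prod_right' (ν := volume)).measurable
    convert h2 using 2 with p
    rw [← integral_indicator measurableSet_Ioc]
    rfl

theorem intervalIntegral_swap_of_bounded_on {F : ℝ → ℝ → ℝ} (hF : Measurable (Function.uncurry F))
    {C a b c d : ℝ} (hC : ∀ x ∈ uIoc a b, ∀ y ∈ uIoc c d, |F x y| ≤ C) :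
    ∫ x in a..b, ∫ y in c..d, F x y = ∫ y in c..d, ∫ x in a..b, F x y := by
  refine intervalIntegral_intervalIntegral_swap ?_
  refine Measure.integrableOn_of_bounded (M := C) ?_ hF.aestronglyMeasurable
    (ae_restrict_of_forall_mem (measurableSet_uIoc.prod measurableSet_uIoc)
      fun p hp => hC _ hp.1 _ hp.2)
  rw [Measure.volume_eq_prod, Measure.prod_prod]
  simp [uIoc, ENNReal.mul_eq_top]

/-- The difference of a test function and a shift of it to the left is the derivative of a test
function. -/
theorem exists_testFunction_deriv_eq_sub_shift {η : ℝ → ℝ} (hη : ContDiff ℝ ∞ η)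
    (hc : HasCompactSupport η) {b c : ℝ} (hs : tsupport η ⊆ Iio b) (hc0 : 0 ≤ c) :
    ∃ Z : ℝ → ℝ, ContDiff ℝ ∞ Z ∧ HasCompactSupport Z ∧ tsupport Z ⊆ Iio b ∧
      ∀ x, deriv Z x = η x - η (x + c) := by
  obtain ⟨A, B, hB, hAB⟩ : ∃ A B, B < b ∧ ∀ x, η x ≠ 0 → x ∈ Icc A B := by
    rcases (tsupport η).eq_empty_or_nonempty with h0 | hne
    · refine ⟨0, b - 1, by linarith, fun x hx => ?_⟩
      have : x ∈ tsupport η := subset_tsupport _ hx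
      simp [h0] at this
    · obtain ⟨B, hBm, hB⟩ := IsCompact.exists_isGreatest hc hne
      obtain ⟨A, hAm, hA⟩ := IsCompact.exists_isLeast hc hne
      exact ⟨A, B, hs hBm, fun x hx => ⟨hA (subset_tsupport _ hx), hB (subset_tsupport _ hx)⟩⟩
  have hd0 : ∀ x, HasDerivAt (fun y => ∫ s in (0 : ℝ)..y, η s) (η x) x := fun x =>
    (hη.continuous.integral_hasStrictDerivAt 0 x).hasDerivAt
  have hP : ContDiff ℝ ∞ (fun y => ∫ s in (0 : ℝ)..y, η s) := by
    rw [contDiff_infty_iff_deriv]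
    refine ⟨fun x => (hd0 x).differentiableAt, ?_⟩
    rwa [show deriv (fun y => ∫ s in (0 : ℝ)..y, η s) = η from funext fun x => (hd0 x).deriv]
  -- The value at `x` is minus the integral of `η` over `[x, x+c]`, so it can be nonzero only if
  -- this interval meets `[A,B]`.
  have hZs : Function.support (fun x => (∫ s in (0 : ℝ)..x, η s) - ∫ s in (0 : ℝ)..x + c, η s) ⊆
      Icc (A - c) B := by
    intro x hx
    by_contra hxn
    apply hx
    change (∫ s in (0 : ℝ)..x, η s) - (∫ s in (0 : ℝ)..x + c, η s) = 0
    rw [intervalIntegral.integral_interval_sub_left (hη.continuous.intervalIntegrable _ _)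
      (hη.continuous.intervalIntegrable _ _)]
    rw [intervalIntegral.integral_zero_ae]
    refine Eventually.of_forall fun s hs => ?_
    rw [uIoc_of_ge (by linarith)] at hs
    by_contra hne
    have := hAB s hne
    exact hxn ⟨by linarith [this.1, hs.2], by linarith [this.2, hs.1]⟩
  have hZt := closure_minimal hZs isClosed_Icc
  refine ⟨fun x => (∫ s in (0 : ℝ)..x, η s) - ∫ s in (0 : ℝ)..x + c, η s,
    hP.sub (hP.comp (contDiff_id.add contDiff_const)),
    isCompact_Icc.of_isClosed_subset (isClosed_tsupport _) hZt,
    fun x hx => (hZt hx).2.trans_lt hB, fun x => ?_⟩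
  exact ((hd0 x).sub ((hd0 (x + c)).comp_add_const x c)).deriv

/-- The tests `Z` need not vanish at `a`. Shifting by `b - a` sends the second copy of `η` to the
left of `a`, so every `η` supported in `(a,b)` equals some `Z'` on `(a,b)`, without a mean-value
constraint. Hence no additive constant survives. -/
theorem ae_eq_zero_of_integral_mul_deriv_eq_zero {f : ℝ → ℝ} {a b : ℝ} (hab : a ≤ b)
    (hf : IntervalIntegrable f volume a b)
    (h : ∀ Z : ℝ → ℝ, ContDiff ℝ ∞ Z → HasCompactSupport Z → tsupport Z ⊆ Iio b →
      ∫ x in a..b, f x * deriv Z x = 0) : ∀ᵐ x, x ∈ Ioo a b → f x = 0 := by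
  have hfi : IntegrableOn f (Ioo a b) := by
    rwa [intervalIntegrable_iff_integrableOn_Ioo_of_le hab] at hf
  refine isOpen_Ioo.ae_eq_zero_of_integral_contDiff_smul_eq_zero hfi.locallyIntegrableOn ?_
  intro η hη hc hs
  obtain ⟨Z, hZ1, hZ2, hZ3, hZ4⟩ := exists_testFunction_deriv_eq_sub_shift hη hc
    (hs.trans Ioo_subset_Iio_self) (sub_nonneg.2 hab)
  have h0 := h Z hZ1 hZ2 hZ3
  rw [intervalIntegral.integral_of_le hab, integral_Ioc_eq_integral_Ioo] at h0
  rw [← h0, ← setIntegral_eq_integral_of_forall_compl_eq_zero (s := Ioo a b)]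
  · refine setIntegral_congr_fun measurableSet_Ioo fun x hx => ?_
    have : η (x + (b - a)) = 0 := by
      refine image_eq_zero_of_notMem_tsupport fun hm => ?_
      linarith [(hs hm).2, hx.1]
    simp only [hZ4, this, sub_zero, smul_eq_mul, mul_comm]
  · intro x hx
    rw [image_eq_zero_of_notMem_tsupport fun hm => hx (hs hm), zero_smul]

/-- Integrated form of a balance law given by tests against products of functions of one
variable. -/
theorem ae_integral_primitive_eq_of_weak_balance {a b T C : ℝ} (hab : a < b) (hT : 0 < T)
    {R G : ℝ → ℝ → ℝ} {R₀ : ℝ → ℝ} (hR : Measurable (Function.uncurry R))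
    (hG : Measurable (Function.uncurry G)) (hR₀ : Measurable R₀) (hRC : ∀ x t, |R x t| ≤ C)
    (hGC : ∀ x t, |G x t| ≤ C) (hR₀C : ∀ x, |R₀ x| ≤ C)
    (h : ∀ Z w : ℝ → ℝ, ContDiff ℝ ∞ Z → HasCompactSupport Z → tsupport Z ⊆ Iio b →
      ContDiff ℝ ∞ w → HasCompactSupport w → tsupport w ⊆ Iio T →
      (∫ t in (0 : ℝ)..T, deriv w t * ∫ x in a..b, R x t * Z x) + w 0 * (∫ x in a..b, R₀ x * Z x)
        - ∫ t in (0 : ℝ)..T, w t * ∫ x in a..b, G x t * deriv Z x = 0) :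
    ∀ᵐ t, t ∈ Ioo 0 T → ∀ x ∈ Icc a b,
      ∫ z in a..x, ∫ y in a..z, (R y t - R₀ y) = ∫ z in a..x, ∫ τ in (0 : ℝ)..t, G z τ := by
  -- Integration by parts in both variables turns the hypothesis into `∬ F Z' w' = 0`. As the tests
  -- are free at `x = a` and at `t = 0`, this forces `F = 0` almost everywhere, which includes the
  -- no-flux condition at `a` and the initial datum.
  set F : ℝ → ℝ → ℝ := fun x t => (∫ y in a..x, (R y t - R₀ y)) - ∫ τ in (0 : ℝ)..t, G x τ with hFd
  have hswap : Measurable fun p : ℝ × ℝ => (p.2, p.1) := by fun_prop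
  have hDm : Measurable (Function.uncurry fun t y => R y t - R₀ y) :=
    (hR.comp hswap).sub (hR₀.comp measurable_snd)
  have hDb : ∀ t y, |R y t - R₀ y| ≤ C + C := fun t y =>
    (abs_sub _ _).trans (add_le_add (hRC _ _) (hR₀C _))
  have hFm : Measurable (Function.uncurry F) :=
    ((measurable_primitive hDm a).comp hswap).sub (measurable_primitive hG 0)
  have hFm' : Measurable (Function.uncurry fun t x => F x t) := hFm.comp hswap
  have hFb : ∀ x ∈ Icc a b, ∀ t ∈ Icc 0 T, |F x t| ≤ (C + C) * (b - a) + C * T := by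
    intro x hx t ht
    have hC : 0 ≤ C := (abs_nonneg _).trans (hRC 0 0)
    refine (abs_sub _ _).trans (add_le_add ((abs_intervalIntegral_le (hDb t) a x).trans ?_)
      ((abs_intervalIntegral_le (hGC x) 0 t).trans ?_))
    · rw [abs_of_nonneg (by linarith [hx.1])]
      exact mul_le_mul_of_nonneg_left (by linarith [hx.2]) (by linarith)
    · rw [abs_of_nonneg (by linarith [ht.1])]
      exact mul_le_mul_of_nonneg_left (by linarith [ht.2]) hC
  have hFt : ∀ t c d, IntervalIntegrable (fun x => F x t) volume c d := by
    intro t c d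
    refine IntervalIntegrable.sub ?_ ?_
    · refine Continuous.intervalIntegrable (intervalIntegral.continuous_primitive (fun c d => ?_) a)
        _ _
      exact intervalIntegrable_of_measurable_of_bounded (hDm.of_uncurry_left (x := t)) (hDb t) c d
    · exact intervalIntegrable_of_measurable_of_bounded (measurable_intervalIntegral hG 0 t)
        (fun x => abs_intervalIntegral_le (hGC x) 0 t) c d
  have hdb : ∀ {ζ : ℝ → ℝ}, ContDiff ℝ ∞ ζ → HasCompactSupport ζ →
      ∃ K : ℝ, 0 ≤ K ∧ (∀ x, |deriv ζ x| ≤ K) ∧ ∀ x, |ζ x| ≤ K := by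
    intro ζ hζ hζc
    obtain ⟨K1, hK1⟩ := hζc.deriv.exists_bound_of_continuous (hζ.continuous_deriv (by norm_num))
    obtain ⟨K2, hK2⟩ := hζc.exists_bound_of_continuous hζ.continuous
    exact ⟨max K1 K2, (abs_nonneg _).trans ((hK1 0).trans (le_max_left _ _)),
      fun x => (hK1 x).trans (le_max_left _ _), fun x => (hK2 x).trans (le_max_right _ _)⟩
  have hz : ∀ {ζ : ℝ → ℝ} {c : ℝ}, tsupport ζ ⊆ Iio c → ζ c = 0 := fun hs =>
    image_eq_zero_of_notMem_tsupport fun hm => (mem_Iio.1 (hs hm)).false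
  have key : ∀ Z w : ℝ → ℝ, ContDiff ℝ ∞ Z → HasCompactSupport Z → tsupport Z ⊆ Iio b →
      ContDiff ℝ ∞ w → HasCompactSupport w → tsupport w ⊆ Iio T →
      ∫ t in (0 : ℝ)..T, deriv w t * ∫ x in a..b, F x t * deriv Z x = 0 := by
    intro Z w hZ hZc hZs hw hwc hws
    obtain ⟨K, hK0, hK1, hK2⟩ := hdb hZ hZc
    have hZdc : Continuous (deriv Z) := hZ.continuous_deriv (by norm_num)
    have hwdc : Continuous (deriv w) := hw.continuous_deriv (by norm_num)
    have hGZ : Measurable (Function.uncurry fun τ x => G x τ * deriv Z x) :=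
      (hG.comp hswap).mul (hZdc.measurable.comp measurable_snd)
    have hGZb : ∀ τ x, |G x τ * deriv Z x| ≤ C * K := fun τ x => (abs_mul _ _).trans_le
      (mul_le_mul (hGC _ _) (hK1 _) (abs_nonneg _) ((abs_nonneg _).trans (hGC 0 0)))
    have hRZ : Measurable (Function.uncurry fun τ x => R x τ * Z x) :=
      (hR.comp hswap).mul (hZ.continuous.measurable.comp measurable_snd)
    have hRZb : ∀ τ x, |R x τ * Z x| ≤ C * K := fun τ x => (abs_mul _ _).trans_le
      (mul_le_mul (hRC _ _) (hK2 _) (abs_nonneg _) ((abs_nonneg _).trans (hRC 0 0)))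
    have hR0Z : Measurable fun x => R₀ x * Z x := hR₀.mul hZ.continuous.measurable
    have hR0Zb : ∀ x, |R₀ x * Z x| ≤ C * K := fun x => (abs_mul _ _).trans_le
      (mul_le_mul (hR₀C _) (hK2 _) (abs_nonneg _) ((abs_nonneg _).trans (hRC 0 0)))
    have hGi : ∀ c d, IntervalIntegrable (fun τ => ∫ x in a..b, G x τ * deriv Z x) volume c d :=
      intervalIntegrable_of_measurable_of_bounded (measurable_intervalIntegral hGZ a b)
        fun τ => abs_intervalIntegral_le (hGZb τ) a b
    have hRi : ∀ c d, IntervalIntegrable (fun τ => ∫ x in a..b, R x τ * Z x) volume c d :=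
      intervalIntegrable_of_measurable_of_bounded (measurable_intervalIntegral hRZ a b)
        fun τ => abs_intervalIntegral_le (hRZb τ) a b
    have e1 : ∀ t, ∫ x in a..b, F x t * deriv Z x
        = - (∫ x in a..b, R x t * Z x) + (∫ x in a..b, R₀ x * Z x)
          - ∫ τ in (0 : ℝ)..t, ∫ x in a..b, G x τ * deriv Z x := by
      intro t
      have hDi : IntervalIntegrable (fun y => R y t - R₀ y) volume a b :=
        intervalIntegrable_of_measurable_of_bounded (hDm.of_uncurry_left (x := t)) (hDb t) a b
      have hi1 : IntervalIntegrable (fun x => (∫ y in a..x, (R y t - R₀ y)) * deriv Z x)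
          volume a b := by
        refine Continuous.intervalIntegrable ((intervalIntegral.continuous_primitive
          (fun c d => ?_) a).mul hZdc) _ _
        exact intervalIntegrable_of_measurable_of_bounded (hDm.of_uncurry_left (x := t)) (hDb t) c d
      have hi2 : IntervalIntegrable (fun x => (∫ τ in (0 : ℝ)..t, G x τ) * deriv Z x)
          volume a b :=
        (intervalIntegrable_of_measurable_of_bounded (measurable_intervalIntegral hG 0 t)
          (fun x => abs_intervalIntegral_le (hGC x) 0 t) a b).mul_continuousOn hZdc.continuousOn
      simp only [hFd, sub_mul]
      rw [intervalIntegral.integral_sub hi1 hi2, integral_primitive_mul_deriv hDi hZ, hz hZs,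
        mul_zero, zero_sub, intervalIntegral_swap_of_bounded hGZ hGZb]
      simp only [intervalIntegral.integral_mul_const, sub_mul]
      rw [intervalIntegral.integral_sub (intervalIntegrable_of_measurable_of_bounded
          (hRZ.of_uncurry_left (x := t)) (hRZb t) a b)
        (intervalIntegrable_of_measurable_of_bounded hR0Z hR0Zb a b)]
      ring
    have e2 : ∫ t in (0 : ℝ)..T, deriv w t * ∫ τ in (0 : ℝ)..t, ∫ x in a..b, G x τ * deriv Z x
        = - ∫ t in (0 : ℝ)..T, w t * ∫ x in a..b, G x t * deriv Z x := by
      have := integral_primitive_mul_deriv (hGi 0 T) hw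
      rw [hz hws, mul_zero, zero_sub] at this
      simp only [mul_comm (deriv w _), mul_comm (w _), this]
    have e3 : ∫ t in (0 : ℝ)..T, deriv w t = - w 0 := by
      rw [intervalIntegral.integral_deriv_eq_sub
        (fun x _ => (hw.differentiable (by norm_num)).differentiableAt)
        (hwdc.intervalIntegrable _ _), hz hws, zero_sub]
    have hh := h Z w hZ hZc hZs hw hwc hws
    have hj1 : IntervalIntegrable (fun t => deriv w t * ∫ x in a..b, R x t * Z x) volume 0 T :=
      (hRi 0 T).continuousOn_mul hwdc.continuousOn
    have hj2 : IntervalIntegrable (fun t => deriv w t * ∫ x in a..b, R₀ x * Z x) volume 0 T :=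
      (hwdc.intervalIntegrable _ _).mul_const _
    have hj3 : IntervalIntegrable (fun t => deriv w t *
        ∫ τ in (0 : ℝ)..t, ∫ x in a..b, G x τ * deriv Z x) volume 0 T :=
      (hwdc.mul (intervalIntegral.continuous_primitive hGi 0)).intervalIntegrable _ _
    have hj1' : IntervalIntegrable (fun t => -(deriv w t * ∫ x in a..b, R x t * Z x)) volume 0 T :=
      hj1.neg
    simp only [e1, mul_sub, mul_add, mul_neg]
    rw [intervalIntegral.integral_sub (hj1'.add hj2) hj3,
      intervalIntegral.integral_add hj1' hj2, intervalIntegral.integral_neg,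
      intervalIntegral.integral_mul_const, e2, e3]
    linarith
  have hzero : ∀ x ∈ Icc a b, ∀ᵐ t, t ∈ Ioo 0 T → ∫ z in a..x, F z t = 0 := by
    intro x hx
    have hsub : ∀ z ∈ uIoc a x, z ∈ Icc a b := fun z hzx => by
      rw [uIoc_of_le hx.1] at hzx
      exact ⟨hzx.1.le, hzx.2.trans hx.2⟩
    refine ae_eq_zero_of_integral_mul_deriv_eq_zero hT.le ?_ fun w hw hwc hws => ?_
    · rw [intervalIntegrable_iff_integrableOn_Ioc_of_le hT.le]
      refine Measure.integrableOn_of_bounded (M := ((C + C) * (b - a) + C * T) * |x - a|) (by simp)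
        (measurable_intervalIntegral hFm' a x).aestronglyMeasurable
        (ae_restrict_of_forall_mem measurableSet_Ioc fun t ht => ?_)
      exact intervalIntegral.norm_integral_le_of_norm_le_const fun z hzx =>
        hFb z (hsub z hzx) t ⟨ht.1.le, ht.2⟩
    · obtain ⟨K, hK0, hK1, -⟩ := hdb hw hwc
      have hwdc : Continuous (deriv w) := hw.continuous_deriv (by norm_num)
      have hFw : Measurable (Function.uncurry fun z t => F z t * deriv w t) :=
        hFm.mul (hwdc.measurable.comp measurable_snd)
      have hFwb : ∀ z ∈ Icc a b, ∀ t ∈ uIoc 0 T,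
          |F z t * deriv w t| ≤ ((C + C) * (b - a) + C * T) * K := fun z hzx t ht => by
        rw [uIoc_of_le hT.le] at ht
        have := hFb z hzx t ⟨ht.1.le, ht.2⟩
        exact (abs_mul _ _).trans_le (mul_le_mul this (hK1 _) (abs_nonneg _)
          ((abs_nonneg _).trans this))
      have hf0 : ∀ᵐ z, z ∈ Ioo a b → ∫ t in (0 : ℝ)..T, F z t * deriv w t = 0 := by
        refine ae_eq_zero_of_integral_mul_deriv_eq_zero hab.le ?_ fun Z hZ hZc hZs => ?_
        · rw [intervalIntegrable_iff_integrableOn_Ioc_of_le hab.le]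
          refine Measure.integrableOn_of_bounded
            (M := (((C + C) * (b - a) + C * T) * K) * |T - 0|) (by simp)
            (measurable_intervalIntegral hFw 0 T).aestronglyMeasurable
            (ae_restrict_of_forall_mem measurableSet_Ioc fun z hzx => ?_)
          exact intervalIntegral.norm_integral_le_of_norm_le_const fun t ht =>
            hFwb z ⟨hzx.1.le, hzx.2⟩ t ht
        · have hZdc : Continuous (deriv Z) := hZ.continuous_deriv (by norm_num)
          obtain ⟨K', hK'0, hK'1, -⟩ := hdb hZ hZc
          refine Eq.trans ?_ (key Z w hZ hZc hZs hw hwc hws)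
          simp only [← intervalIntegral.integral_mul_const, ← intervalIntegral.integral_const_mul]
          rw [intervalIntegral_swap_of_bounded_on
            (C := ((C + C) * (b - a) + C * T) * K * K')]
          · exact intervalIntegral.integral_congr fun t _ =>
              intervalIntegral.integral_congr fun z _ => by ring
          · exact hFw.mul (hZdc.measurable.comp measurable_fst)
          · intro z hzx t ht
            rw [uIoc_of_le hab.le] at hzx
            have := hFwb z ⟨hzx.1.le, hzx.2⟩ t ht
            exact (abs_mul _ _).trans_le (mul_le_mul this (hK'1 _) (abs_nonneg _)
              ((abs_nonneg _).trans this))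
      simp only [← intervalIntegral.integral_mul_const]
      rw [← intervalIntegral_swap_of_bounded_on hFw fun z hzx t ht => hFwb z (hsub z hzx) t ht,
        intervalIntegral.integral_zero_ae]
      filter_upwards [hf0, compl_mem_ae_iff.2 (measure_singleton b)] with z h1 h2 hzx
      rw [uIoc_of_le hx.1] at hzx
      exact h1 ⟨hzx.1, lt_of_le_of_ne (hzx.2.trans hx.2) h2⟩
  -- The primitive of `F(·,t)` is continuous in `x`, so rational end points suffice and the null set
  -- of times does not depend on `x`. This is why the conclusion is integrated once more in space.
  have hq : ∀ᵐ t, ∀ q : ℚ, (q : ℝ) ∈ Icc a b → t ∈ Ioo 0 T → ∫ z in a..(q : ℝ), F z t = 0 := by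
    rw [ae_all_iff]
    intro q
    by_cases hqm : (q : ℝ) ∈ Icc a b
    · filter_upwards [hzero q hqm] with t ht _ using ht
    · exact Eventually.of_forall fun t hh => absurd hh hqm
  filter_upwards [hq] with t ht htT x hx
  have hcont : Continuous fun x => ∫ z in a..x, F z t :=
    intervalIntegral.continuous_primitive (fun c d => hFt t c d) a
  have hcl : closure (Ioo a b ∩ range ((↑) : ℚ → ℝ)) ⊆ {x | ∫ z in a..x, F z t = 0} := by
    refine closure_minimal ?_ (isClosed_eq hcont continuous_const)
    rintro _ ⟨hy, q, rfl⟩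
    exact ht q (Ioo_subset_Icc_self hy) htT
  have hx0 : ∫ z in a..x, F z t = 0 := by
    refine hcl (closure_minimal
      (Rat.denseRange_cast.open_subset_closure_inter isOpen_Ioo) isClosed_closure ?_)
    rwa [closure_Ioo hab.ne]
  simp only [hFd] at hx0
  rw [intervalIntegral.integral_sub] at hx0
  · linarith
  · refine Continuous.intervalIntegrable (intervalIntegral.continuous_primitive (fun c d => ?_) a)
      _ _
    exact intervalIntegrable_of_measurable_of_bounded (hDm.of_uncurry_left (x := t)) (hDb t) c d
  · exact intervalIntegrable_of_measurable_of_bounded (measurable_intervalIntegral hG 0 t)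
      (fun x => abs_intervalIntegral_le (hGC x) 0 t) _ _

/-! ### Weak derivatives and regular representatives in space. -/

/-- The primitive of a test function with vanishing integral is a test function. -/
theorem exists_testFunction_deriv_eq {θ : ℝ → ℝ} (hθ : ContDiff ℝ ∞ θ) (hc : HasCompactSupport θ)
    {a b : ℝ} (hs : tsupport θ ⊆ Ioo a b) (hI : ∫ x in a..b, θ x = 0) :
    ∃ Z : ℝ → ℝ, ContDiff ℝ ∞ Z ∧ HasCompactSupport Z ∧ tsupport Z ⊆ Ioo a b ∧ deriv Z = θ := by
  rcases (tsupport θ).eq_empty_or_nonempty with h0 | hne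
  · refine ⟨fun _ => 0, contDiff_const, HasCompactSupport.zero, ?_, ?_⟩
    · simp [tsupport]
    · rw [tsupport_eq_empty_iff] at h0
      simp [h0, Pi.zero_def]
  obtain ⟨B, hBm, hB⟩ := IsCompact.exists_isGreatest hc hne
  obtain ⟨A, hAm, hA⟩ := IsCompact.exists_isLeast hc hne
  have hAB : ∀ x, θ x ≠ 0 → x ∈ Icc A B := fun x hx =>
    ⟨hA (subset_tsupport _ hx), hB (subset_tsupport _ hx)⟩
  have hd0 : ∀ x, HasDerivAt (fun y => ∫ s in a..y, θ s) (θ x) x := fun x =>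
    (hθ.continuous.integral_hasStrictDerivAt a x).hasDerivAt
  have hd : deriv (fun y => ∫ s in a..y, θ s) = θ := funext fun x => (hd0 x).deriv
  have hZs : Function.support (fun x => ∫ s in a..x, θ s) ⊆ Icc A B := by
    intro x hx
    by_contra hxn
    apply hx
    change (∫ s in a..x, θ s) = 0
    rw [mem_Icc, not_and_or, not_le, not_le] at hxn
    have hz : ∀ s, s < A ∨ B < s → θ s = 0 := fun s hs' => by
      by_contra hne
      rcases hs' with h' | h'
      · exact h'.not_ge (hAB s hne).1
      · exact h'.not_ge (hAB s hne).2
    rcases hxn with hxn | hxn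
    · rw [intervalIntegral.integral_zero_ae]
      exact Eventually.of_forall fun s hs' =>
        hz s (Or.inl (hs'.2.trans_lt (max_lt (hs hAm).1 hxn)))
    · rw [← intervalIntegral.integral_add_adjacent_intervals
        (hθ.continuous.intervalIntegrable a b) (hθ.continuous.intervalIntegrable b x), hI, zero_add,
        intervalIntegral.integral_zero_ae]
      exact Eventually.of_forall fun s hs' =>
        hz s (Or.inr ((lt_min (hs hBm).2 hxn).trans hs'.1))
  have hZt := closure_minimal hZs isClosed_Icc
  refine ⟨fun x => ∫ s in a..x, θ s, ?_,
    isCompact_Icc.of_isClosed_subset (isClosed_tsupport _) hZt,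
    hZt.trans (Icc_subset_Ioo (hs hAm).1 (hs hBm).2), hd⟩
  rw [contDiff_infty_iff_deriv, hd]
  exact ⟨fun x => (hd0 x).differentiableAt, hθ⟩

/-- A function with a weak derivative on an interval is a primitive of it. -/
theorem exists_ae_eq_primitive_of_isWeakDeriv {a b : ℝ} (hab : a < b) {f g : ℝ → ℝ}
    (hf : IntervalIntegrable f volume a b) (hg : IntervalIntegrable g volume a b)
    (h : IsWeakDeriv (Ioo a b) f g) :
    ∃ c : ℝ, ∀ᵐ x, x ∈ Ioo a b → f x = c + ∫ z in a..x, g z := by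
  set F : ℝ → ℝ := fun x => f x - ∫ z in a..x, g z with hF
  have hPc : ContinuousOn (fun x => ∫ z in a..x, g z) (uIcc a b) :=
    (hg.absolutelyContinuousOnInterval_intervalIntegral (c := a) (by simp)).continuousOn
  have hFi : IntervalIntegrable F volume a b := hf.sub hPc.intervalIntegrable
  have key : ∀ Z : ℝ → ℝ, ContDiff ℝ ∞ Z → HasCompactSupport Z → tsupport Z ⊆ Ioo a b →
      ∫ x in a..b, F x * deriv Z x = 0 := by
    intro Z hZ hZc hZs
    have hZdc : Continuous (deriv Z) := hZ.continuous_deriv (by norm_num)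
    have h1 := h Z hZ hZc hZs
    rw [← integral_Ioc_eq_integral_Ioo, ← integral_Ioc_eq_integral_Ioo,
      ← intervalIntegral.integral_of_le hab.le, ← intervalIntegral.integral_of_le hab.le] at h1
    have h2 := integral_primitive_mul_deriv hg hZ
    rw [image_eq_zero_of_notMem_tsupport (f := Z) (x := b) fun hm => lt_irrefl b (hZs hm).2] at h2
    simp only [hF, sub_mul]
    rw [intervalIntegral.integral_sub (hf.mul_continuousOn hZdc.continuousOn)
      (hPc.intervalIntegrable.mul_continuousOn hZdc.continuousOn), h1, h2]
    ring
  -- Du Bois-Reymond argument: `η - (∫η)ρ` has zero mean, so it is the derivative of a test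
  -- function. It follows that `F` is the constant `∫ F ρ` almost everywhere.
  obtain ⟨ρ, hρ, hρc, hρs, hρI⟩ : ∃ ρ : ℝ → ℝ, ContDiff ℝ ∞ ρ ∧ HasCompactSupport ρ ∧
      tsupport ρ ⊆ Ioo a b ∧ ∫ x in a..b, ρ x = 1 := by
    let B : ContDiffBump ((a + b) / 2) := ⟨(b - a) / 8, (b - a) / 4, by linarith, by linarith⟩
    have hs : tsupport (B.normed volume) ⊆ Ioo a b := by
      rw [B.tsupport_normed_eq, Real.closedBall_eq_Icc]
      change Icc ((a + b) / 2 - (b - a) / 4) ((a + b) / 2 + (b - a) / 4) ⊆ _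
      exact Icc_subset_Ioo (by linarith) (by linarith)
    refine ⟨B.normed volume, B.contDiff_normed, B.hasCompactSupport_normed, hs, ?_⟩
    rw [← B.integral_normed (μ := volume), intervalIntegral.integral_of_le hab.le]
    refine setIntegral_eq_integral_of_forall_compl_eq_zero fun x hx => ?_
    exact image_eq_zero_of_notMem_tsupport fun hm => hx (Ioo_subset_Ioc_self (hs hm))
  refine ⟨∫ x in a..b, F x * ρ x, ?_⟩
  have hconst : IntervalIntegrable (fun _ : ℝ => ∫ x in a..b, F x * ρ x) volume a b :=
    intervalIntegrable_const
  have hGi : IntegrableOn (fun x => F x - ∫ x in a..b, F x * ρ x) (Ioo a b) :=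
    (intervalIntegrable_iff_integrableOn_Ioo_of_le hab.le).1 (hFi.sub hconst)
  have hz := isOpen_Ioo.ae_eq_zero_of_integral_contDiff_smul_eq_zero hGi.locallyIntegrableOn ?_
  · filter_upwards [hz] with x hx hxab
    have := hx hxab
    simp only [hF] at this ⊢
    linarith
  intro η hη hc hs
  have hθ : ContDiff ℝ ∞ fun x => η x - (∫ x in a..b, η x) * ρ x := hη.sub (contDiff_const.mul hρ)
  have hθs : tsupport (fun x => η x - (∫ x in a..b, η x) * ρ x) ⊆ tsupport η ∪ tsupport ρ := by
    refine closure_minimal (fun x hx => ?_) ((isClosed_tsupport _).union (isClosed_tsupport _))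
    by_contra hn
    rw [mem_union, not_or] at hn
    apply hx
    simp [image_eq_zero_of_notMem_tsupport hn.1, image_eq_zero_of_notMem_tsupport hn.2]
  have hηi : IntervalIntegrable η volume a b := hη.continuous.intervalIntegrable _ _
  have hρi : IntervalIntegrable ρ volume a b := hρ.continuous.intervalIntegrable _ _
  obtain ⟨Z, hZ, hZc, hZs, hZd⟩ := exists_testFunction_deriv_eq hθ
    ((hc.union hρc).of_isClosed_subset (isClosed_tsupport _) hθs) (hθs.trans (union_subset hs hρs))
    (by rw [intervalIntegral.integral_sub hηi (hρi.const_mul _),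
          intervalIntegral.integral_const_mul, hρI]; ring)
  have h0 := key Z hZ hZc hZs
  rw [← setIntegral_eq_integral_of_forall_compl_eq_zero (s := Ioc a b) fun x hx => by
      rw [image_eq_zero_of_notMem_tsupport (f := η) fun hm => hx (Ioo_subset_Ioc_self (hs hm)),
        zero_smul], ← intervalIntegral.integral_of_le hab.le, ← h0, hZd]
  have hF1 : IntervalIntegrable (fun x => F x * η x) volume a b :=
    hFi.mul_continuousOn hη.continuous.continuousOn
  have hF2 : IntervalIntegrable (fun x => F x * ρ x) volume a b :=
    hFi.mul_continuousOn hρ.continuous.continuousOn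
  simp only [smul_eq_mul, mul_sub]
  rw [intervalIntegral.integral_sub (by simpa only [mul_comm] using hF1) (hηi.mul_const _),
    intervalIntegral.integral_sub hF1 (by
      simpa only [mul_left_comm, mul_comm, mul_assoc] using hF2.const_mul (∫ x in a..b, η x))]
  simp only [mul_left_comm (F _) _, intervalIntegral.integral_mul_const,
    intervalIntegral.integral_const_mul, mul_comm (η _) (F _)]

/-- If `φ ∘ f` has an integrable weak derivative, then `f` has a representative `r` for which
`φ ∘ r` is the primitive of that derivative on the closed interval. -/
theorem exists_regular_rep {a b : ℝ} (hab : a < b) {φ f g : ℝ → ℝ} (hφ : Continuous φ)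
    (hf : Measurable f) (hf01 : ∀ x, f x ∈ Icc (0 : ℝ) 1)
    (hg : IntervalIntegrable g volume a b)
    (h : IsWeakDeriv (Ioo a b) (fun x => φ (f x)) g) :
    ∃ r : ℝ → ℝ, (∀ x, r x ∈ Icc (0 : ℝ) 1) ∧
      (∀ᵐ x, x ∈ Ioo a b → φ (r x) = φ (f x)) ∧
      ∀ x ∈ Icc a b, φ (r x) - φ (r a) = ∫ z in a..x, g z := by
  have hcpt : IsCompact (φ '' Icc 0 1) := isCompact_Icc.image hφ
  obtain ⟨K, hK⟩ := hcpt.isBounded.exists_norm_le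
  have hfi : IntervalIntegrable (fun x => φ (f x)) volume a b :=
    intervalIntegrable_of_measurable_of_bounded (hφ.measurable.comp hf)
      (fun x => hK _ (mem_image_of_mem _ (hf01 x))) a b
  obtain ⟨c, hc⟩ := exists_ae_eq_primitive_of_isWeakDeriv hab hfi hg h
  have hPc : ContinuousOn (fun x => c + ∫ z in a..x, g z) (Icc a b) := by
    have := (hg.absolutelyContinuousOnInterval_intervalIntegral (c := a) (by simp)).continuousOn
    rw [uIcc_of_le hab.le] at this
    exact continuousOn_const.add this
  -- The continuous representative of `φ ∘ f` takes values in the compact set `φ([0,1])` almost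
  -- everywhere, hence on a dense set, hence everywhere on `[a,b]`. A saturation can then be chosen
  -- at every point.
  have hmem : ∀ x ∈ Icc a b, (c + ∫ z in a..x, g z) ∈ φ '' Icc 0 1 := by
    have hd : Dense {x | x ∈ Ioo a b → φ (f x) = c + ∫ z in a..x, g z} :=
      Measure.dense_of_ae hc
    have hsub : Icc a b ⊆ closure (Icc a b ∩ (fun x => c + ∫ z in a..x, g z) ⁻¹' (φ '' Icc 0 1)) := by
      refine (closure_Ioo hab.ne).symm.subset.trans ?_
      refine closure_minimal ((hd.open_subset_closure_inter isOpen_Ioo).trans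
        (closure_mono ?_)) isClosed_closure
      rintro x ⟨hx, hx2⟩
      exact ⟨Ioo_subset_Icc_self hx, by rw [mem_preimage, ← hx2 hx]; exact ⟨_, hf01 x, rfl⟩⟩
    rw [(hPc.preimage_isClosed_of_isClosed isClosed_Icc hcpt.isClosed).closure_eq] at hsub
    exact fun x hx => (hsub hx).2
  choose! r hr using hmem
  refine ⟨fun x => r (max a (min b x)), fun x => (hr _ ⟨le_max_left _ _,
    max_le hab.le (min_le_left _ _)⟩).1, ?_, ?_⟩
  · filter_upwards [hc] with x hx hxab
    rw [min_eq_right hxab.2.le, max_eq_right hxab.1.le, hx hxab,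
      (hr x (Ioo_subset_Icc_self hxab)).2]
  · intro x hx
    beta_reduce
    rw [min_eq_right hx.2, max_eq_right hx.1, min_eq_right hab.le, max_self, (hr x hx).2,
      (hr a (left_mem_Icc.2 hab.le)).2]
    simp

/-- Uniform continuity of the inverse of a strictly monotone continuous function on `[0,1]`. -/
theorem exists_modulus_of_strictMonoOn {φ : ℝ → ℝ} (hφ : Continuous φ)
    (hφs : StrictMonoOn φ (Icc 0 1)) {ε : ℝ} (hε : 0 < ε) :
    ∃ δ > 0, ∀ p ∈ Icc (0 : ℝ) 1, ∀ q ∈ Icc (0 : ℝ) 1, |φ p - φ q| < δ → |p - q| < ε := by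
  have hK : IsCompact ((Icc (0 : ℝ) 1 ×ˢ Icc (0 : ℝ) 1) ∩ {z : ℝ × ℝ | ε ≤ |z.1 - z.2|}) :=
    (isCompact_Icc.prod isCompact_Icc).inter_right (isClosed_le (by fun_prop) (by fun_prop))
  rcases eq_empty_or_nonempty ((Icc (0 : ℝ) 1 ×ˢ Icc (0 : ℝ) 1) ∩ {z : ℝ × ℝ | ε ≤ |z.1 - z.2|})
    with h0 | hne
  · refine ⟨1, one_pos, fun p hp q hq _ => ?_⟩
    by_contra hn
    exact h0.subset (show (p, q) ∈ _ from ⟨⟨hp, hq⟩, not_lt.1 hn⟩)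
  -- The modulus `δ` is the minimum of `|φ(p) - φ(q)|` over the compact set of pairs at distance at
  -- least `ε`, positive by injectivity.
  · obtain ⟨z, hz, hmin⟩ := hK.exists_isMinOn hne
      (by fun_prop : Continuous fun z : ℝ × ℝ => |φ z.1 - φ z.2|).continuousOn
    refine ⟨|φ z.1 - φ z.2|, abs_pos.2 (sub_ne_zero.2 fun he => ?_), fun p hp q hq hlt => ?_⟩
    · have := hφs.injOn hz.1.1 hz.1.2 he
      have h2 : ε ≤ |z.1 - z.2| := hz.2
      rw [this, sub_self, abs_zero] at h2
      linarith
    · by_contra hn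
      exact hlt.not_ge (isMinOn_iff.1 hmin (p, q) ⟨⟨hp, hq⟩, not_lt.1 hn⟩)

/-! ### The Kirchhoff functions and the capillary pressure graphs. -/

namespace Medium

variable {N : ℕ} (M : Medium N)

/-- The denominator of the global mobility never vanishes on `[0,1]`: the water mobility is positive
at `0` and the oil mobility is positive away from `0`. -/
theorem continuousOn_kirchhoff_integrand (i : Fin N) : ContinuousOn
    (fun a => M.globalMobility i a * derivWithin (M.capPressure i) (Icc 0 1) a) (Icc 0 1) := by
  refine ContinuousOn.mul ?_ ((M.capPressure_contDiffOn i).continuousOn_derivWithin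
    (uniqueDiffOn_Icc zero_lt_one) le_rfl)
  refine ContinuousOn.div ((M.oilMobility_continuousOn i).mul (M.waterMobility_continuousOn i))
    ((M.oilMobility_continuousOn i).add (M.waterMobility_continuousOn i)) fun s hs => ?_
  have h0 : (0 : ℝ) ∈ Icc (0 : ℝ) 1 := by simp
  have h1 : (1 : ℝ) ∈ Icc (0 : ℝ) 1 := by simp
  have ho := (M.oilMobility_strictMonoOn i).monotoneOn h0 hs hs.1
  have hw := (M.waterMobility_strictAntiOn i).antitoneOn hs h1 hs.2
  rw [M.oilMobility_zero] at ho
  rw [M.waterMobility_one] at hw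
  rcases hs.1.eq_or_lt with rfl | h
  · have := M.waterMobility_strictAntiOn i h0 h1 one_pos
    rw [M.waterMobility_one] at this
    linarith
  · have := M.oilMobility_strictMonoOn i h0 hs h
    rw [M.oilMobility_zero] at this
    linarith

theorem kirchhoff_integrand_pos (i : Fin N) {s : ℝ} (hs : s ∈ Ioo (0 : ℝ) 1) :
    0 < M.globalMobility i s * derivWithin (M.capPressure i) (Icc 0 1) s := by
  have h0 : (0 : ℝ) ∈ Icc (0 : ℝ) 1 := by simp
  have h1 : (1 : ℝ) ∈ Icc (0 : ℝ) 1 := by simp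
  have ho := M.oilMobility_strictMonoOn i h0 (Ioo_subset_Icc_self hs) hs.1
  have hw := M.waterMobility_strictAntiOn i (Ioo_subset_Icc_self hs) h1 hs.2
  rw [M.oilMobility_zero] at ho
  rw [M.waterMobility_one] at hw
  exact mul_pos (div_pos (mul_pos ho hw) (add_pos ho hw)) (M.capPressure_deriv_pos i s hs)

theorem kirchhoff_integrand_intervalIntegrable (i : Fin N) {s t : ℝ} (hs : s ∈ Icc (0 : ℝ) 1)
    (ht : t ∈ Icc (0 : ℝ) 1) : IntervalIntegrable
    (fun a => M.globalMobility i a * derivWithin (M.capPressure i) (Icc 0 1) a) volume s t :=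
  ((M.continuousOn_kirchhoff_integrand i).mono (uIcc_subset_Icc hs ht)).intervalIntegrable

theorem continuousOn_kirchhoff (i : Fin N) : ContinuousOn (M.kirchhoff i) (Icc 0 1) := by
  have := ((M.kirchhoff_integrand_intervalIntegrable i (s := 0) (t := 1) (by simp)
    (by simp)).absolutelyContinuousOnInterval_intervalIntegral (c := 0) (by simp)).continuousOn
  rwa [uIcc_of_le zero_le_one] at this

theorem strictMonoOn_kirchhoff (i : Fin N) : StrictMonoOn (M.kirchhoff i) (Icc 0 1) := by
  intro s hs t ht hst
  have h0 : (0 : ℝ) ∈ Icc (0 : ℝ) 1 := by simp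
  rw [← sub_pos, kirchhoff, kirchhoff, intervalIntegral.integral_interval_sub_left
    (M.kirchhoff_integrand_intervalIntegrable i h0 ht)
    (M.kirchhoff_integrand_intervalIntegrable i h0 hs)]
  exact intervalIntegral.intervalIntegral_pos_of_pos_on
    (M.kirchhoff_integrand_intervalIntegrable i hs ht)
    (fun x hx => M.kirchhoff_integrand_pos i ⟨hs.1.trans_lt hx.1, hx.2.trans_le ht.2⟩) hst

theorem strictMonoOn_capPressure (i : Fin N) : StrictMonoOn (M.capPressure i) (Icc 0 1) := by
  refine strictMonoOn_of_deriv_pos (convex_Icc 0 1) (M.capPressure_contDiffOn i).continuousOn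
    fun x hx => ?_
  rw [interior_Icc] at hx
  rw [← derivWithin_of_mem_nhds (Icc_mem_nhds hx.1 hx.2)]
  exact M.capPressure_deriv_pos i x hx

/-- The Kirchhoff function, extended by constants outside `[0,1]`. -/
noncomputable def kirchhoffExt (i : Fin N) : ℝ → ℝ :=
  IccExtend zero_le_one ((Icc (0 : ℝ) 1).domRestrict (M.kirchhoff i))

theorem kirchhoffExt_eq (i : Fin N) {s : ℝ} (hs : s ∈ Icc (0 : ℝ) 1) :
    M.kirchhoffExt i s = M.kirchhoff i s := IccExtend_of_mem _ _ hs

theorem continuous_kirchhoffExt (i : Fin N) : Continuous (M.kirchhoffExt i) :=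
  (M.continuousOn_kirchhoff i).domRestrict.Icc_extend'

theorem monotone_kirchhoffExt (i : Fin N) : Monotone (M.kirchhoffExt i) :=
  Monotone.IccExtend _ fun x y h => (M.strictMonoOn_kirchhoff i).monotoneOn x.2 y.2 h

theorem strictMonoOn_kirchhoffExt (i : Fin N) : StrictMonoOn (M.kirchhoffExt i) (Icc 0 1) :=
  fun s hs t ht h => by
    rw [M.kirchhoffExt_eq i hs, M.kirchhoffExt_eq i ht]
    exact M.strictMonoOn_kirchhoff i hs ht h

/-- Two pairs of saturations that are connected through the capillary pressures are ordered in the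
same way on both sides of an interface. -/
theorem le_of_lt_of_pressureGraph {i j : Fin N} {s s' r r' : ℝ}
    (h : (M.pressureGraph i s ∩ M.pressureGraph j r).Nonempty)
    (h' : (M.pressureGraph i s' ∩ M.pressureGraph j r').Nonempty) (hs : s ∈ Icc (0 : ℝ) 1)
    (hs' : s' ∈ Icc (0 : ℝ) 1) (hr : r ∈ Icc (0 : ℝ) 1) (hr' : r' ∈ Icc (0 : ℝ) 1)
    (hlt : s < s') : r ≤ r' := by
  -- If `x < y`, then `x` is not on the upper half-line at `1` and `y` is not on the lower half-line
  -- at `0`, so the pressures are separated by `π(x) < π(y)`. Opposite orders on the two sides of an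
  -- interface would order the common pressures both ways.
  have mono : ∀ k : Fin N, ∀ {x y p q : ℝ}, x ∈ Icc (0 : ℝ) 1 → y ∈ Icc (0 : ℝ) 1 →
      p ∈ M.pressureGraph k x → q ∈ M.pressureGraph k y → x < y → p < q := by
    intro k x y p q hx hy hp hq hxy
    have hm := M.strictMonoOn_capPressure k hx hy hxy
    have h1 : p ≤ M.capPressure k x := by
      rcases hp with ⟨_, _, hp⟩ | ⟨h0, hp⟩ | ⟨h0, _⟩
      · exact hp.le
      · rwa [h0]
      · linarith [hy.2]
    have h2 : M.capPressure k y ≤ q := by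
      rcases hq with ⟨_, _, hq⟩ | ⟨h0, _⟩ | ⟨h0, hq⟩
      · exact hq.ge
      · linarith [hx.1]
      · rwa [h0]
    linarith
  obtain ⟨p, hp1, hp2⟩ := h
  obtain ⟨q, hq1, hq2⟩ := h'
  by_contra hn
  exact lt_asymm (mono i hs hs' hp1 hq1 hlt) (mono j hr' hr hq2 hp2 (not_le.1 hn))

end Medium

/-! ### Continuity in time and extension from a dense set of times. -/

/-- The projection onto `[a,b]`. -/
noncomputable def clampIcc (a b x : ℝ) : ℝ := max a (min b x)

theorem clampIcc_mem {a b : ℝ} (hab : a ≤ b) (x : ℝ) : clampIcc a b x ∈ Icc a b :=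
  ⟨le_max_left _ _, max_le hab (min_le_left _ _)⟩

theorem clampIcc_of_mem {a b x : ℝ} (hx : x ∈ Icc a b) : clampIcc a b x = x := by
  rw [clampIcc, min_eq_right hx.2, max_eq_right hx.1]

theorem clampIcc_of_le {a b x : ℝ} (hab : a ≤ b) (hx : b ≤ x) : clampIcc a b x = b := by
  rw [clampIcc, min_eq_left hx, max_eq_right hab]

theorem clampIcc_of_ge {a b x : ℝ} (hx : x ≤ a) : clampIcc a b x = a :=
  max_eq_left ((min_le_right _ _).trans hx)

theorem continuous_clampIcc (a b : ℝ) : Continuous (clampIcc a b) := by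
  unfold clampIcc; fun_prop

theorem abs_clampIcc_sub_le (a b x y : ℝ) : |clampIcc a b x - clampIcc a b y| ≤ |x - y| := by
  unfold clampIcc
  refine (abs_max_sub_max_le_max _ _ _ _).trans (max_le (by simp) ?_)
  exact (abs_min_sub_min_le_max _ _ _ _).trans (max_le (by simp) le_rfl)

/-- Continuity in time of the saturation of a layer from the Lipschitz continuity in time of its
primitive. -/
theorem exists_modulus_space_time {a b m L : ℝ} (hab : a < b) (hm : 0 < m) (hL : 0 ≤ L)
    {φ : ℝ → ℝ} (hφ : Continuous φ) (hφs : StrictMonoOn φ (Icc 0 1)) {A : Set ℝ} {r : ℝ → ℝ → ℝ}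
    (hr : ∀ x t, r x t ∈ Icc (0 : ℝ) 1)
    (hlip : ∀ t ∈ A, ∀ x ∈ Icc a b, ∀ y ∈ Icc a b, |φ (r x t) - φ (r y t)| ≤ L * |x - y|)
    (hint : ∀ t ∈ A, ∀ s ∈ A, ∀ x ∈ Icc a b, ∀ y ∈ Icc a b,
      |∫ z in x..y, m * (r z t - r z s)| ≤ 2 * L * |t - s|) {ε : ℝ} (hε : 0 < ε) :
    ∃ δ > 0, ∀ t ∈ A, ∀ s ∈ A, ∀ x ∈ Icc a b, ∀ y ∈ Icc a b, |x - y| < δ → |t - s| < δ →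
      |r x t - r y s| < ε := by
  have hmod : ∀ η > 0, ∃ δ > 0, ∀ t ∈ A, ∀ x ∈ Icc a b, ∀ y ∈ Icc a b, |x - y| < δ →
      |r x t - r y t| < η := by
    intro η hη
    obtain ⟨δ, hδ, h⟩ := exists_modulus_of_strictMonoOn hφ hφs hη
    refine ⟨δ / (L + 1), by positivity, fun t ht x hx y hy hxy => h _ (hr x t) _ (hr y t) ?_⟩
    refine (hlip t ht x hx y hy).trans_lt ?_
    rw [lt_div_iff₀ (by positivity)] at hxy
    nlinarith [abs_nonneg (x - y)]
  have hcont : ∀ t ∈ A, ContinuousOn (fun z => r z t) (Icc a b) := by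
    intro t ht x hx
    rw [Metric.continuousWithinAt_iff]
    intro η hη
    obtain ⟨δ, hδ, h⟩ := hmod η hη
    exact ⟨δ, hδ, fun {y} hy hd => h t ht y hy x hx hd⟩
  obtain ⟨δ₁, hδ₁, h1⟩ := hmod (ε / 4) (by positivity)
  -- A window of length `k` containing `x` fits in `[a,b]` on the right or on the left of `x`, and
  -- on it the saturation varies by less than `ε/4` at each fixed time. A large time increment at
  -- `x` thus persists on the window, and the bound on its integral limits it.
  set k := min (b - a) δ₁ / 2 with hk
  have hk0 : 0 < k := by have := lt_min (sub_pos.2 hab) hδ₁; positivity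
  have hk1 : 2 * k ≤ b - a := by linarith [min_le_left (b - a) δ₁]
  have hk2 : 2 * k ≤ δ₁ := by linarith [min_le_right (b - a) δ₁]
  have hone : ∀ t ∈ A, ∀ s ∈ A, ∀ x ∈ Icc a b,
      m * (k * (r x t - r x s - ε / 2)) ≤ 2 * L * |t - s| := by
    intro t ht s hs x hx
    obtain ⟨c, hca, hcb, hcx⟩ : ∃ c, a ≤ c ∧ c + k ≤ b ∧ x ∈ Icc c (c + k) := by
      by_cases hxk : x + k ≤ b
      · exact ⟨x, hx.1, hxk, le_rfl, by linarith⟩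
      · exact ⟨x - k, by linarith, by linarith [hx.2], by linarith, by linarith⟩
    have hsub : Icc c (c + k) ⊆ Icc a b := Icc_subset_Icc hca hcb
    refine le_trans ?_ ((le_abs_self _).trans (hint t ht s hs c (hsub (left_mem_Icc.2 (by linarith)))
      (c + k) (hsub (right_mem_Icc.2 (by linarith)))))
    have hci : IntervalIntegrable (fun z => m * (r z t - r z s)) volume c (c + k) := by
      refine ContinuousOn.intervalIntegrable ?_
      rw [uIcc_of_le (by linarith)]
      exact continuousOn_const.mul (((hcont t ht).mono hsub).sub ((hcont s hs).mono hsub))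
    have := intervalIntegral.integral_mono_on (by linarith : c ≤ c + k)
      (intervalIntegrable_const (c := m * (r x t - r x s - ε / 2))) hci fun z hz => ?_
    · rw [intervalIntegral.integral_const, add_sub_cancel_left, smul_eq_mul] at this
      linarith
    · have hzx : |x - z| < δ₁ := by
        rw [abs_lt]; constructor <;> linarith [hz.1, hz.2, hcx.1, hcx.2]
      have e1 := abs_lt.1 (h1 t ht x hx z (hsub hz) hzx)
      have e2 := abs_lt.1 (h1 s hs x hx z (hsub hz) hzx)
      exact mul_le_mul_of_nonneg_left (by linarith) hm.le
  -- With this `δ` the integral bound is below `m k ε/4`. Adding the `ε/2` lost on the window gives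
  -- `3ε/4` for the time increment, and the space increment uses the last `ε/4`.
  refine ⟨min δ₁ (m * k * (ε / 4) / (2 * L + 1)), by positivity,
    fun t ht s hs x hx y hy hxy hts => ?_⟩
  have e1 := h1 t ht x hx y hy (hxy.trans_le (min_le_left _ _))
  have hts' := hts.trans_le (min_le_right _ _)
  rw [lt_div_iff₀ (by positivity)] at hts'
  have hts2 : 2 * L * |t - s| < m * k * (ε / 4) := by nlinarith [abs_nonneg (t - s)]
  have hmk : 0 < m * k := by positivity
  have e2 : r y t - r y s < 3 * ε / 4 := by
    have := (hone t ht s hs y hy).trans_lt hts2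
    rw [← mul_assoc] at this
    have := lt_of_mul_lt_mul_left this hmk.le
    linarith
  have e3 : r y s - r y t < 3 * ε / 4 := by
    have := (hone s hs t ht y hy).trans_lt (by rwa [abs_sub_comm])
    rw [← mul_assoc] at this
    have := lt_of_mul_lt_mul_left this hmk.le
    linarith
  rw [abs_lt] at e1 ⊢
  constructor <;> linarith [e1.1, e1.2]

/-- A saturation known at a dense set of times extends continuously to all times. -/
theorem exists_continuous_extension {a b m L T : ℝ} (hab : a < b) (hm : 0 < m) (hL : 0 ≤ L)
    (hT : 0 < T)
    {φ : ℝ → ℝ} (hφ : Continuous φ) (hφs : StrictMonoOn φ (Icc 0 1)) {A : Set ℝ}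
    (hAT : A ⊆ Icc 0 T) (hA : Icc 0 T ⊆ closure A) {r : ℝ → ℝ → ℝ}
    (hr : ∀ x t, r x t ∈ Icc (0 : ℝ) 1)
    (hlip : ∀ t ∈ A, ∀ x ∈ Icc a b, ∀ y ∈ Icc a b, |φ (r x t) - φ (r y t)| ≤ L * |x - y|)
    (hint : ∀ t ∈ A, ∀ s ∈ A, ∀ x ∈ Icc a b, ∀ y ∈ Icc a b,
      |∫ z in x..y, m * (r z t - r z s)| ≤ 2 * L * |t - s|) :
    ∃ U : ℝ → ℝ → ℝ, Continuous (Function.uncurry U) ∧ (∀ x t, U x t ∈ Icc (0 : ℝ) 1) ∧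
      (∀ t x y, |φ (U x t) - φ (U y t)| ≤ L * |x - y|) ∧
      (∀ x ∈ Icc a b, ∀ t ∈ A, U x t = r x t) ∧ ∀ x t, U x (clampIcc 0 T t) = U x t := by
  set B : Set (ℝ × ℝ) := Icc a b ×ˢ A with hB
  have hu : UniformContinuousOn (Function.uncurry r) B := by
    rw [Metric.uniformContinuousOn_iff]
    intro ε hε
    obtain ⟨δ, hδ, h⟩ := exists_modulus_space_time hab hm hL hφ hφs hr hlip hint hε
    refine ⟨δ, hδ, fun p hp q hq hpq => ?_⟩
    rw [Prod.dist_eq, max_lt_iff] at hpq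
    exact h p.2 hp.2 q.2 hq.2 p.1 hp.1 q.1 hq.1 hpq.1 hpq.2
  have hcl : Icc a b ×ˢ Icc 0 T ⊆ closure B := by
    rw [hB, closure_prod_eq, isClosed_Icc.closure_eq]
    exact prod_mono le_rfl hA
  have hext : ContinuousOn (extendFrom B (Function.uncurry r)) (Icc a b ×ˢ Icc 0 T) := by
    refine continuousOn_extendFrom hcl fun p hp => ?_
    have hne : (𝓝[B] p).NeBot := mem_closure_iff_nhdsWithin_neBot.1 (hcl hp)
    have hc : Cauchy (𝓝[B] p) := (cauchy_nhds).mono nhdsWithin_le_nhds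
    obtain ⟨y, hy⟩ := CompleteSpace.complete (hc.map_of_le hu inf_le_right)
    exact ⟨y, hy⟩
  have hcontU : Continuous fun p : ℝ × ℝ =>
      extendFrom B (Function.uncurry r) (clampIcc a b p.1, clampIcc 0 T p.2) := by
    refine hext.comp_continuous ?_ fun p => ⟨clampIcc_mem hab.le _, clampIcc_mem hT.le _⟩
    exact ((continuous_clampIcc a b).comp continuous_fst).prodMk
      ((continuous_clampIcc 0 T).comp continuous_snd)
  have hval : ∀ x ∈ Icc a b, ∀ t ∈ A, extendFrom B (Function.uncurry r)
      (clampIcc a b x, clampIcc 0 T t) = r x t := by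
    intro x hx t ht
    rw [clampIcc_of_mem hx, clampIcc_of_mem (hAT ht),
      extendFrom_extends hu.continuousOn _ ⟨hx, ht⟩]
    rfl
  have hidem : ∀ x t, extendFrom B (Function.uncurry r) (clampIcc a b x, clampIcc 0 T t) =
      extendFrom B (Function.uncurry r)
        (clampIcc a b (clampIcc a b x), clampIcc 0 T (clampIcc 0 T t)) := fun x t => by
    rw [clampIcc_of_mem (clampIcc_mem hab.le x), clampIcc_of_mem (clampIcc_mem hT.le t)]
  -- Bounds that are closed conditions in `t` pass from the dense set `A` to `[0,T]`, and by
  -- clamping to all real times.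
  have hclosed : ∀ P : Set ℝ, IsClosed P → A ⊆ P → ∀ t, clampIcc 0 T t ∈ P := fun P hP hAP t =>
    closure_minimal hAP hP (hA (clampIcc_mem hT.le t))
  refine ⟨fun x t => extendFrom B (Function.uncurry r) (clampIcc a b x, clampIcc 0 T t), hcontU,
    fun x t => ?_, fun t x y => ?_, hval, fun x t => ?_⟩
  · beta_reduce
    rw [hidem]
    refine hclosed {t | extendFrom B (Function.uncurry r)
      (clampIcc a b (clampIcc a b x), clampIcc 0 T t) ∈ Icc (0 : ℝ) 1} ?_ ?_ t
    · exact isClosed_Icc.preimage (hcontU.comp (by fun_prop : Continuous fun t : ℝ =>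
        (clampIcc a b x, t)))
    · intro t ht
      rw [mem_ofPred_eq, hval _ (clampIcc_mem hab.le x) t ht]
      exact hr _ _
  · have h2 : |φ (extendFrom B (Function.uncurry r) (clampIcc a b x, clampIcc 0 T t)) -
        φ (extendFrom B (Function.uncurry r) (clampIcc a b y, clampIcc 0 T t))| ≤
        L * |clampIcc a b x - clampIcc a b y| := by
      rw [hidem x t, hidem y t]
      refine hclosed {t | |φ (extendFrom B (Function.uncurry r)
        (clampIcc a b (clampIcc a b x), clampIcc 0 T t)) - φ (extendFrom B (Function.uncurry r)
        (clampIcc a b (clampIcc a b y), clampIcc 0 T t))| ≤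
        L * |clampIcc a b x - clampIcc a b y|} ?_ ?_ t
      · refine isClosed_le ?_ continuous_const
        exact ((hφ.comp (hcontU.comp (by fun_prop : Continuous fun t : ℝ =>
          (clampIcc a b x, t)))).sub (hφ.comp (hcontU.comp (by fun_prop : Continuous fun t : ℝ =>
          (clampIcc a b y, t))))).abs
      · intro t ht
        rw [mem_ofPred_eq, hval _ (clampIcc_mem hab.le x) t ht, hval _ (clampIcc_mem hab.le y) t ht]
        exact hlip t ht _ (clampIcc_mem hab.le x) _ (clampIcc_mem hab.le y)
    exact h2.trans (mul_le_mul_of_nonneg_left (abs_clampIcc_sub_le _ _ _ _) hL)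
  · beta_reduce
    rw [clampIcc_of_mem (clampIcc_mem hT.le t)]

/-- A continuous function is bounded by the bound of its mean values. -/
theorem abs_le_of_forall_abs_integral_le {a b K : ℝ} (hab : a < b) {h : ℝ → ℝ} (hh : Continuous h)
    (hK : ∀ x ∈ Icc a b, ∀ y ∈ Icc a b, |∫ z in x..y, h z| ≤ K * |y - x|) {x : ℝ}
    (hx : x ∈ Icc a b) : |h x| ≤ K := by
  have hin : Ioo a b ⊆ {x | |h x| ≤ K} := by
    intro x hx
    have hd := (hh.integral_hasStrictDerivAt a x).hasDerivAt
    have hK0 : 0 ≤ K := by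
      have := (abs_nonneg _).trans (hK a (left_mem_Icc.2 hab.le) b (right_mem_Icc.2 hab.le))
      exact nonneg_of_mul_nonneg_left this (abs_pos.2 (sub_ne_zero.2 hab.ne'))
    have := hd.hasFDerivAt.le_of_lip' hK0 ?_
    · simpa using this
    · filter_upwards [isOpen_Ioo.mem_nhds hx] with y hy
      rw [intervalIntegral.integral_interval_sub_left (hh.intervalIntegrable _ _)
        (hh.intervalIntegrable _ _)]
      exact hK x (Ioo_subset_Icc_self hx) y (Ioo_subset_Icc_self hy)
  have := closure_minimal hin (isClosed_le hh.abs continuous_const)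
  rw [closure_Ioo hab.ne] at this
  exact this hx

/-! ### Integrals from the left end of the domain. -/

section LayerSum

variable {N : ℕ}

/-- The integral over the part of the domain on the left of `x` of a function given layer by
layer. -/
noncomputable def layerSum (node : Fin (N + 1) → ℝ) (f : Fin N → ℝ → ℝ) (x : ℝ) : ℝ :=
  ∑ i, ∫ y in node i.castSucc..clampIcc (node i.castSucc) (node i.succ) x, f i y

variable {node : Fin (N + 1) → ℝ} {f g : Fin N → ℝ → ℝ}

theorem layerSum_left (hnode : StrictMono node) : layerSum node f (node 0) = 0 :=
  Finset.sum_eq_zero fun i _ => by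
    rw [clampIcc_of_ge (hnode.monotone (Fin.zero_le _)), intervalIntegral.integral_same]

theorem layerSum_of_last_le (hnode : StrictMono node) {x : ℝ} (hx : node (Fin.last N) ≤ x) :
    layerSum node f x = layerSum node f (node (Fin.last N)) :=
  Finset.sum_congr rfl fun i _ => by
    have h1 : node i.castSucc ≤ node i.succ := hnode.monotone (Fin.castSucc_lt_succ).le
    rw [clampIcc_of_le h1 ((hnode.monotone (Fin.le_last _)).trans hx),
      clampIcc_of_le h1 (hnode.monotone (Fin.le_last _))]

theorem layerSum_congr (hnode : StrictMono node)
    (h : ∀ i, ∀ᵐ y, y ∈ Ioo (node i.castSucc) (node i.succ) → f i y = g i y) (x : ℝ) :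
    layerSum node f x = layerSum node g x := by
  refine Finset.sum_congr rfl fun i _ => intervalIntegral.integral_congr_ae ?_
  have h1 : node i.castSucc ≤ node i.succ := hnode.monotone (Fin.castSucc_lt_succ).le
  filter_upwards [h i, compl_mem_ae_iff.2 (measure_singleton (node i.succ))] with y hy hy2 hyx
  rw [uIoc_of_le (clampIcc_mem h1 x).1] at hyx
  exact hy ⟨hyx.1, lt_of_le_of_ne (hyx.2.trans (clampIcc_mem h1 x).2) hy2⟩

/-- On the closed layer `i` the clamps of all other layers are constant, so only the term `i`
varies. -/
theorem layerSum_sub (hnode : StrictMono node) (i : Fin N)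
    (hf : IntervalIntegrable (f i) volume (node i.castSucc) (node i.succ)) {x y : ℝ}
    (hx : x ∈ Icc (node i.castSucc) (node i.succ)) (hy : y ∈ Icc (node i.castSucc) (node i.succ)) :
    layerSum node f y - layerSum node f x = ∫ z in x..y, f i z := by
  have h1 : node i.castSucc ≤ node i.succ := hnode.monotone (Fin.castSucc_lt_succ).le
  rw [layerSum, layerSum, ← Finset.sum_sub_distrib, Finset.sum_eq_single i]
  · rw [clampIcc_of_mem hx, clampIcc_of_mem hy, intervalIntegral.integral_interval_sub_left]
    · exact hf.mono_set (by rw [uIcc_of_le hy.1, uIcc_of_le h1]; exact Icc_subset_Icc_right hy.2)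
    · exact hf.mono_set (by rw [uIcc_of_le hx.1, uIcc_of_le h1]; exact Icc_subset_Icc_right hx.2)
  · intro j _ hji
    have h2 : node j.castSucc ≤ node j.succ := hnode.monotone (Fin.castSucc_lt_succ).le
    rcases lt_or_gt_of_ne hji with hlt | hlt
    · have h3 : node j.succ ≤ node i.castSucc := hnode.monotone (by
        rw [Fin.le_def, Fin.val_succ, Fin.val_castSucc]; exact hlt)
      rw [clampIcc_of_le h2 (h3.trans hx.1), clampIcc_of_le h2 (h3.trans hy.1), sub_self]
    · have h3 : node i.succ ≤ node j.castSucc := hnode.monotone (by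
        rw [Fin.le_def, Fin.val_succ, Fin.val_castSucc]; exact hlt)
      rw [clampIcc_of_ge (hx.2.trans h3), clampIcc_of_ge (hy.2.trans h3), sub_self]
  · simp

theorem continuous_layerSum (hf : ∀ i c d, IntervalIntegrable (f i) volume c d) :
    Continuous (layerSum node f) :=
  continuous_finsetSum _ fun i _ =>
    (intervalIntegral.continuous_primitive (hf i) _).comp (continuous_clampIcc _ _)

theorem continuous_layerSum_uncurry {k : Fin N → ℝ → ℝ → ℝ}
    (hk : ∀ i, Continuous (Function.uncurry (k i))) :
    Continuous fun p : ℝ × ℝ => layerSum node (fun i y => k i y p.2) p.1 := by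
  refine continuous_finsetSum _ fun i _ => ?_
  refine intervalIntegral.continuous_parametric_intervalIntegral_of_continuous ?_
    ((continuous_clampIcc _ _).comp continuous_fst)
  exact (hk i).comp (by fun_prop : Continuous fun q : (ℝ × ℝ) × ℝ => (q.2, q.1.2))

theorem integral_indicator_Ioo {a c d x : ℝ} (hac : a ≤ c) (hax : a ≤ x) (h : ℝ → ℝ) :
    ∫ y in a..x, (Ioo c d).indicator h y = ∫ y in c..clampIcc c d x, h y := by
  have he : (Ioo c d).indicator h =ᵐ[volume] (Ioc c d).indicator h :=
    indicator_ae_eq_of_ae_eq_set Ioo_ae_eq_Ioc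
  rw [intervalIntegral.integral_congr_ae (he.mono fun y hy _ => hy),
    intervalIntegral.integral_of_le hax, setIntegral_indicator measurableSet_Ioc, Ioc_inter_Ioc,
    intervalIntegral.integral_of_le (show c ≤ clampIcc c d x from le_max_left _ _),
    max_eq_right hac]
  congr 2
  rw [clampIcc]
  rcases le_total c (min d x) with h1 | h1
  · rw [max_eq_right h1, min_comm]
  · rw [max_eq_left h1, Ioc_self, Ioc_eq_empty (by rw [min_comm]; exact h1.not_gt)]

theorem integral_sum_indicator (hnode : StrictMono node)
    (hf : ∀ i c d, IntervalIntegrable (f i) volume c d) {x : ℝ} (hx : node 0 ≤ x) :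
    ∫ y in node 0..x, ∑ i, (Ioo (node i.castSucc) (node i.succ)).indicator (f i) y
      = layerSum node f x := by
  rw [intervalIntegral.integral_finsetSum fun i _ => ?_]
  · exact Finset.sum_congr rfl fun i _ =>
      integral_indicator_Ioo (hnode.monotone (Fin.zero_le _)) hx (f i)
  · rw [intervalIntegrable_iff]
    exact (intervalIntegrable_iff.1 (hf i _ _)).indicator measurableSet_Ioo

end LayerSum

/-! ### Construction of a flow from the balance law. -/

theorem Icc_subset_closure_of_ae {a b : ℝ} (hab : a < b) {A : Set ℝ}
    (h : ∀ᵐ t, t ∈ Ioo a b → t ∈ A) : Icc a b ⊆ closure A := by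
  rw [← closure_Ioo hab.ne]
  refine closure_minimal (((Measure.dense_of_ae h).open_subset_closure_inter isOpen_Ioo).trans
    (closure_mono ?_)) isClosed_closure
  rintro x ⟨hx, hx2⟩
  exact hx2 hx

/-- Continuity properties of the time integral of the flux through a point. -/
theorem potential_bounds {a c b L : ℝ} (hac : a ≤ c) (hcb : c < b) {G w : ℝ → ℝ → ℝ}
    (hG : Measurable (Function.uncurry G)) (hGL : ∀ x t, |G x t| ≤ L)
    (hG0 : ∀ x, c < x → ∀ t, G x t = 0) {A : Set ℝ} (hw : ∀ t, Continuous (w t))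
    (hwc : ∀ t, ∀ x, c ≤ x → w t x = w t c)
    (hbal : ∀ t ∈ A, ∀ x ∈ Icc a b, ∫ z in a..x, w t z = ∫ z in a..x, ∫ τ in (0 : ℝ)..t, G z τ) :
    (∀ t ∈ A, ∀ s ∈ A, ∀ x ∈ Icc a b, |w t x - w s x| ≤ L * |t - s|) ∧
      (∀ t ∈ A, ∀ x ∈ Icc a b, |w t x| ≤ L * |t|) ∧ ∀ t ∈ A, w t c = 0 := by
  have hab : a < b := hac.trans_lt hcb
  have hGt : ∀ t c d, IntervalIntegrable (fun z => ∫ τ in (0 : ℝ)..t, G z τ) volume c d := fun t =>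
    intervalIntegrable_of_measurable_of_bounded (measurable_intervalIntegral hG 0 t)
      fun z => abs_intervalIntegral_le (hGL z) 0 t
  have hGz : ∀ z c d, IntervalIntegrable (G z) volume c d := fun z =>
    intervalIntegrable_of_measurable_of_bounded (hG.of_uncurry_left (x := z)) (hGL z)
  have hbal' : ∀ t ∈ A, ∀ x ∈ Icc a b, ∀ y ∈ Icc a b,
      ∫ z in x..y, w t z = ∫ z in x..y, ∫ τ in (0 : ℝ)..t, G z τ := by
    intro t ht x hx y hy
    rw [← intervalIntegral.integral_interval_sub_left ((hw t).intervalIntegrable a y)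
      ((hw t).intervalIntegrable a x), hbal t ht x hx, hbal t ht y hy,
      intervalIntegral.integral_interval_sub_left (hGt t a y) (hGt t a x)]
  refine ⟨fun t ht s hs x hx => ?_, fun t ht x hx => ?_, fun t ht => ?_⟩
  · refine abs_le_of_forall_abs_integral_le hab ((hw t).sub (hw s)) (fun x hx y hy => ?_) hx
    simp only [Pi.sub_apply]
    rw [intervalIntegral.integral_sub ((hw t).intervalIntegrable _ _)
      ((hw s).intervalIntegrable _ _), hbal' t ht x hx y hy, hbal' s hs x hx y hy,
      ← intervalIntegral.integral_sub (hGt t x y) (hGt s x y)]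
    refine abs_intervalIntegral_le (fun z => ?_) x y
    rw [intervalIntegral.integral_interval_sub_left (hGz z 0 t) (hGz z 0 s)]
    exact abs_intervalIntegral_le (hGL z) s t
  · refine abs_le_of_forall_abs_integral_le hab (hw t) (fun x hx y hy => ?_) hx
    rw [hbal' t ht x hx y hy]
    refine abs_intervalIntegral_le (fun z => ?_) x y
    have := abs_intervalIntegral_le (hGL z) 0 t
    rwa [sub_zero] at this
  -- Beyond `c` the flux vanishes and `w t` is constant, so the balance on `[c,b]` reads `(b - c) w
  -- t c = 0`. This is the no-flux condition at the right end.
  · have h1 := hbal' t ht c ⟨hac, hcb.le⟩ b (right_mem_Icc.2 hab.le)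
    have h2 : ∫ z in c..b, w t z = ∫ z in c..b, w t c :=
      intervalIntegral.integral_congr fun z hz => by
        rw [uIcc_of_le hcb.le] at hz
        exact hwc t z hz.1
    have h3 : ∫ z in c..b, ∫ τ in (0 : ℝ)..t, G z τ = 0 := by
      refine intervalIntegral.integral_zero_ae (Eventually.of_forall fun z hz => ?_)
      rw [uIoc_of_le hcb.le] at hz
      simp [hG0 z hz.1]
    rw [h2, h3, intervalIntegral.integral_const, smul_eq_mul] at h1
    exact (mul_eq_zero.1 h1).resolve_left (sub_ne_zero.2 hcb.ne')

/-- A bounded solution of the balance law with bounded flux is a flow. -/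
theorem exists_isFlow {N : ℕ} {node : Fin (N + 1) → ℝ} (hnode : StrictMono node) {T L : ℝ}
    (hT : 0 < T) (hL : 0 ≤ L) {m : Fin N → ℝ} (hm : ∀ i, 0 < m i) {φ : Fin N → ℝ → ℝ}
    (hφ : ∀ i, Continuous (φ i)) (hφs : ∀ i, StrictMonoOn (φ i) (Icc 0 1)) {u G : ℝ → ℝ → ℝ}
    {u₀ : ℝ → ℝ} (hu : Measurable (Function.uncurry u)) (hu01 : ∀ x t, u x t ∈ Icc (0 : ℝ) 1)
    (hu₀ : Measurable u₀) (hu₀01 : ∀ x, u₀ x ∈ Icc (0 : ℝ) 1)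
    (hG : Measurable (Function.uncurry G)) (hGL : ∀ x t, |G x t| ≤ L)
    (hG0 : ∀ x, node (Fin.last N) < x → ∀ t, G x t = 0)
    (hweak : ∀ i, ∀ᵐ t, t ∈ Ioo 0 T → IsWeakDeriv (Ioo (node i.castSucc) (node i.succ))
      (fun x => φ i (u x t)) (fun x => G x t))
    (hbal : ∀ᵐ t, t ∈ Ioo 0 T → ∀ x ∈ Icc (node 0) (node (Fin.last N) + 1),
      ∫ z in node 0..x, layerSum node (fun i y => m i * (u y t - u₀ y)) z
        = ∫ z in node 0..x, ∫ τ in (0 : ℝ)..t, G z τ) :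
    ∃ (U : Fin N → ℝ → ℝ → ℝ) (W : ℝ → ℝ → ℝ), IsFlow node T m L φ U W ∧
      (∀ i, ∀ᵐ t, t ∈ Ioo 0 T →
        ∀ᵐ x, x ∈ Ioo (node i.castSucc) (node i.succ) → U i x t = u x t) ∧
      ∀ i, ∀ᵐ x, x ∈ Ioo (node i.castSucc) (node i.succ) → U i x 0 = u₀ x := by
  have hlen : ∀ i : Fin N, node i.castSucc < node i.succ := fun i => hnode (Fin.castSucc_lt_succ)
  have hl0 : ∀ i : Fin N, node 0 ≤ node i.castSucc := fun i => hnode.monotone (Fin.zero_le _)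
  have hlN : ∀ i : Fin N, node i.succ ≤ node (Fin.last N) := fun i =>
    hnode.monotone (Fin.le_last _)
  have h0N : node 0 ≤ node (Fin.last N) := hnode.monotone (Fin.zero_le _)
  -- The good times: full measure in `(0,T)`, hence dense in `[0,T]`. Everything is proved first on
  -- `A` and then extended by continuity.
  set A : Set ℝ := {t | t ∈ Ioo 0 T ∧ (∀ i, IsWeakDeriv (Ioo (node i.castSucc) (node i.succ))
      (fun x => φ i (u x t)) (fun x => G x t)) ∧ ∀ x ∈ Icc (node 0) (node (Fin.last N) + 1),
      ∫ z in node 0..x, layerSum node (fun i y => m i * (u y t - u₀ y)) z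
        = ∫ z in node 0..x, ∫ τ in (0 : ℝ)..t, G z τ} with hAdef
  have hAae : ∀ᵐ t, t ∈ Ioo 0 T → t ∈ A := by
    filter_upwards [hbal, ae_all_iff.2 hweak] with t h1 h2 ht
    exact ⟨ht, fun i => h2 i ht, h1 ht⟩
  have hAT : A ⊆ Icc 0 T := fun t ht => Ioo_subset_Icc_self ht.1
  have hAcl : Icc 0 T ⊆ closure A := Icc_subset_closure_of_ae hT hAae
  have hGt : ∀ t c d, IntervalIntegrable (fun x => G x t) volume c d := fun t =>
    intervalIntegrable_of_measurable_of_bounded (hG.of_uncurry_right (y := t)) fun x => hGL x t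
  have hut : ∀ t c d, IntervalIntegrable (fun x => u x t) volume c d := fun t =>
    intervalIntegrable_of_measurable_of_bounded (hu.of_uncurry_right (y := t)) (C := 1) fun x => by
      rw [abs_of_nonneg (hu01 x t).1]; exact (hu01 x t).2
  have hu0i : ∀ c d, IntervalIntegrable u₀ volume c d :=
    intervalIntegrable_of_measurable_of_bounded hu₀ (C := 1) fun x => by
      rw [abs_of_nonneg (hu₀01 x).1]; exact (hu₀01 x).2
  have hmi : ∀ i t c d, IntervalIntegrable (fun y => m i * (u y t - u₀ y)) volume c d :=
    fun i t c d => ((hut t c d).sub (hu0i c d)).const_mul _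
  set w : ℝ → ℝ → ℝ := fun t => layerSum node (fun i y => m i * (u y t - u₀ y)) with hwdef
  obtain ⟨hw1, hw2, hw3⟩ := potential_bounds (A := A) h0N (lt_add_one (node (Fin.last N))) hG hGL
    hG0 (w := w) (fun t => continuous_layerSum fun i => hmi i t)
    (fun t x hx => layerSum_of_last_le hnode hx) (fun t ht => ht.2.2)
  have hmemN : ∀ (i : Fin N) {x : ℝ}, x ∈ Icc (node i.castSucc) (node i.succ) →
      x ∈ Icc (node 0) (node (Fin.last N) + 1) := fun i x hx =>
    ⟨(hl0 i).trans hx.1, (hx.2.trans (hlN i)).trans (lt_add_one _).le⟩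
  have hrex : ∀ (i : Fin N) (t : ℝ), ∃ r : ℝ → ℝ, (∀ x, r x ∈ Icc (0 : ℝ) 1) ∧ (t ∈ A →
      (∀ᵐ x, x ∈ Ioo (node i.castSucc) (node i.succ) → r x = u x t) ∧
      ∀ x ∈ Icc (node i.castSucc) (node i.succ),
        φ i (r x) - φ i (r (node i.castSucc)) = ∫ z in node i.castSucc..x, G z t) := by
    intro i t
    by_cases ht : t ∈ A
    · obtain ⟨r, hr1, hr2, hr3⟩ := exists_regular_rep (hlen i) (hφ i)
        (hu.of_uncurry_right (y := t)) (fun x => hu01 x t) (hGt t _ _) (ht.2.1 i)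
      exact ⟨r, hr1, fun _ => ⟨hr2.mono fun x hx hxi => (hφs i).injOn (hr1 x) (hu01 x t) (hx hxi),
        hr3⟩⟩
    · exact ⟨fun _ => 0, fun _ => by simp, fun h => absurd h ht⟩
  choose r hr01 hr using hrex
  have hrlip : ∀ i, ∀ t ∈ A, ∀ x ∈ Icc (node i.castSucc) (node i.succ),
      ∀ y ∈ Icc (node i.castSucc) (node i.succ), |φ i (r i t x) - φ i (r i t y)| ≤ L * |x - y| := by
    intro i t ht x hx y hy
    have h1 := (hr i t ht).2 x hx
    have h2 := (hr i t ht).2 y hy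
    have : φ i (r i t x) - φ i (r i t y) = ∫ z in y..x, G z t := by
      rw [← intervalIntegral.integral_interval_sub_left (hGt t _ _) (hGt t (node i.castSucc) _),
        ← h1, ← h2]
      ring
    rw [this]
    exact abs_intervalIntegral_le (fun z => hGL z t) y x
  have hdiff : ∀ i, ∀ t, ∀ x ∈ Icc (node i.castSucc) (node i.succ),
      ∀ y ∈ Icc (node i.castSucc) (node i.succ),
      w t y - w t x = ∫ z in x..y, m i * (u z t - u₀ z) := fun i t x hx y hy =>
    layerSum_sub hnode i (hmi i t _ _) hx hy
  have hsubset : ∀ (i : Fin N) {x y : ℝ}, x ∈ Icc (node i.castSucc) (node i.succ) →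
      y ∈ Icc (node i.castSucc) (node i.succ) →
      ∀ᵐ z, z ∈ uIoc x y → z ∈ Ioo (node i.castSucc) (node i.succ) := by
    intro i x y hx hy
    filter_upwards [compl_mem_ae_iff.2 (measure_singleton (node i.succ))] with z hz hzx
    exact ⟨(le_min hx.1 hy.1).trans_lt hzx.1, lt_of_le_of_ne (hzx.2.trans (max_le hx.2 hy.2)) hz⟩
  -- The integral is a difference of increments of `w` at the two end points, each at most `L|t -
  -- s|`; this is the origin of the factor `2L`.
  have hrint : ∀ i, ∀ t ∈ A, ∀ s ∈ A, ∀ x ∈ Icc (node i.castSucc) (node i.succ),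
      ∀ y ∈ Icc (node i.castSucc) (node i.succ),
      |∫ z in x..y, m i * (r i t z - r i s z)| ≤ 2 * L * |t - s| := by
    intro i t ht s hs x hx y hy
    have h1 : ∫ z in x..y, m i * (r i t z - r i s z)
        = (w t y - w s y) - (w t x - w s x) := by
      have : (w t y - w s y) - (w t x - w s x) = (w t y - w t x) - (w s y - w s x) := by ring
      rw [this, hdiff i t x hx y hy, hdiff i s x hx y hy,
        ← intervalIntegral.integral_sub (hmi i t _ _) (hmi i s _ _)]
      refine intervalIntegral.integral_congr_ae ?_
      filter_upwards [(hr i t ht).1, (hr i s hs).1, hsubset i hx hy] with z h1 h2 h3 hz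
      rw [h1 (h3 hz), h2 (h3 hz)]
      ring
    rw [h1]
    have e1 := hw1 t ht s hs y (hmemN i hy)
    have e2 := hw1 t ht s hs x (hmemN i hx)
    exact (abs_sub _ _).trans (by linarith)
  have hUex : ∀ i : Fin N, ∃ U : ℝ → ℝ → ℝ, Continuous (Function.uncurry U) ∧
      (∀ x t, U x t ∈ Icc (0 : ℝ) 1) ∧ (∀ t x y, |φ i (U x t) - φ i (U y t)| ≤ L * |x - y|) ∧
      (∀ x ∈ Icc (node i.castSucc) (node i.succ), ∀ t ∈ A, U x t = r i t x) ∧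
      ∀ x t, U x (clampIcc 0 T t) = U x t := fun i =>
    exists_continuous_extension (hlen i) (hm i) hL hT (hφ i) (hφs i) hAT hAcl
      (r := fun x t => r i t x) (fun x t => hr01 i t x) (hrlip i) (hrint i)
  choose U hUc hU01 hUlip hUr hUcl using hUex
  have hUu : ∀ i, ∀ t ∈ A,
      ∀ᵐ x, x ∈ Ioo (node i.castSucc) (node i.succ) → U i x t = u x t := by
    intro i t ht
    filter_upwards [(hr i t ht).1] with x hx hxi
    rw [hUr i x (Ioo_subset_Icc_self hxi) t ht, hx hxi]
  have hUx : ∀ i t, Continuous fun x => U i x t := fun i t =>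
    (hUc i).comp (by fun_prop : Continuous fun x : ℝ => (x, t))
  -- For good times the integral of `m(U(t) - u₀)` is at most `2L|t|`. By density this holds at `t =
  -- 0`, where all primitives of `m(U(0) - u₀)` therefore vanish.
  have hU0 : ∀ i, ∀ᵐ x, x ∈ Ioo (node i.castSucc) (node i.succ) → U i x 0 = u₀ x := by
    intro i
    have hUi : ∀ t c d, IntervalIntegrable (fun z => m i * (U i z t - u₀ z)) volume c d :=
      fun t c d => (((hUx i t).intervalIntegrable c d).sub (hu0i c d)).const_mul _
    have := ae_eq_zero_of_forall_intervalIntegral_eq_zero (hUi 0 (node i.castSucc) (node i.succ)) ?_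
    · filter_upwards [this] with x hx hxi
      have := (mul_eq_zero.1 (hx hxi)).resolve_left (hm i).ne'
      linarith
    intro x hx
    have hleft := left_mem_Icc.2 (hlen i).le
    have hcI : Continuous fun t => ∫ z in node i.castSucc..x, m i * (U i z t - u₀ z) := by
      have : (fun t => ∫ z in node i.castSucc..x, m i * (U i z t - u₀ z)) = fun t =>
          m i * ((∫ z in node i.castSucc..x, U i z t) - ∫ z in node i.castSucc..x, u₀ z) := by
        funext t
        rw [intervalIntegral.integral_const_mul, intervalIntegral.integral_sub
          ((hUx i t).intervalIntegrable _ _) (hu0i _ _)]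
      rw [this]
      refine continuous_const.mul (Continuous.sub ?_ continuous_const)
      have hsw : Continuous (Function.uncurry fun t z => U i z t) :=
        (hUc i).comp (by fun_prop : Continuous fun q : ℝ × ℝ => (q.2, q.1))
      exact intervalIntegral.continuous_parametric_intervalIntegral_of_continuous' hsw _ _
    have hAsub : A ⊆ {t | |∫ z in node i.castSucc..x, m i * (U i z t - u₀ z)| ≤ 2 * L * |t|} := by
      intro t ht
      have : ∫ z in node i.castSucc..x, m i * (U i z t - u₀ z)
          = w t x - w t (node i.castSucc) := by
        rw [hdiff i t _ hleft x hx]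
        refine intervalIntegral.integral_congr_ae ?_
        filter_upwards [hUu i t ht, hsubset i hleft hx] with z h1 h2 hz
        rw [h1 (h2 hz)]
      rw [mem_ofPred_eq, this]
      have e1 := hw2 t ht x (hmemN i hx)
      have e2 := hw2 t ht _ (hmemN i hleft)
      exact (abs_sub _ _).trans (by linarith)
    have h0 := closure_minimal hAsub (isClosed_le hcI.abs (by fun_prop))
      (hAcl (left_mem_Icc.2 hT.le))
    rw [mem_ofPred_eq, abs_zero, mul_zero] at h0
    exact abs_nonpos_iff.1 h0
  -- `W` is built from the continuous representatives, so it is continuous in both variables; at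
  -- good times it coincides with `w`.
  set W : ℝ → ℝ → ℝ := fun x t => layerSum node (fun i y => m i * (U i y t - U i y 0)) x with hWdef
  have hWc : Continuous (Function.uncurry W) := by
    refine continuous_layerSum_uncurry (k := fun i y t => m i * (U i y t - U i y 0)) fun i => ?_
    exact continuous_const.mul ((hUc i).sub
      ((hUc i).comp (by fun_prop : Continuous fun q : ℝ × ℝ => (q.1, (0 : ℝ)))))
  have hWt : ∀ x, Continuous (W x) := fun x =>
    hWc.comp (by fun_prop : Continuous fun t : ℝ => (x, t))
  have hWw : ∀ t ∈ A, ∀ x, W x t = w t x := by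
    intro t ht x
    refine layerSum_congr hnode (fun i => ?_) x
    filter_upwards [hUu i t ht, hU0 i] with y h1 h2 hy
    rw [h1 hy, h2 hy]
  have hWcl : ∀ x t, W x (clampIcc 0 T t) = W x t := fun x t => by simp only [hWdef, hUcl]
  have hWlip : ∀ x ∈ Icc (node 0) (node (Fin.last N) + 1), ∀ t s,
      |W x t - W x s| ≤ L * |t - s| := by
    intro x hx t s
    have hsub : A ×ˢ A ⊆ {p : ℝ × ℝ | |W x p.1 - W x p.2| ≤ L * |p.1 - p.2|} := by
      rintro ⟨t, s⟩ ⟨ht, hs⟩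
      rw [mem_ofPred_eq, hWw t ht, hWw s hs]
      exact hw1 t ht s hs x hx
    have hcl := closure_minimal hsub (isClosed_le
      (((hWt x).comp continuous_fst).sub ((hWt x).comp continuous_snd)).abs (by fun_prop))
    rw [closure_prod_eq] at hcl
    have := hcl (show (clampIcc 0 T t, clampIcc 0 T s) ∈ _ from
      ⟨hAcl (clampIcc_mem hT.le t), hAcl (clampIcc_mem hT.le s)⟩)
    rw [mem_ofPred_eq, hWcl, hWcl] at this
    exact this.trans (mul_le_mul_of_nonneg_left (abs_clampIcc_sub_le _ _ _ _) hL)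
  refine ⟨U, W, ⟨fun i => ⟨hUc i, hU01 i, hUlip i, hWc, fun x hx => hWlip x (hmemN i hx), ?_, ?_⟩,
    fun t => layerSum_left hnode, fun t => ?_⟩, fun i => ?_, hU0⟩
  · intro t _ x hx
    refine layerSum_sub hnode i ?_ (left_mem_Icc.2 (hlen i).le) hx
    exact (continuous_const.mul ((hUx i t).sub (hUx i 0))).intervalIntegrable _ _
  · intro t ht x hx
    have hleft := left_mem_Icc.2 (hlen i).le
    have hUt : ∀ x, Continuous fun τ => φ i (U i x τ) := fun x =>
      (hφ i).comp ((hUc i).comp (by fun_prop : Continuous fun τ : ℝ => (x, τ)))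
    have hsw : Continuous (Function.uncurry fun t z => W z t) :=
      hWc.comp (by fun_prop : Continuous fun q : ℝ × ℝ => (q.2, q.1))
    have hc1 : Continuous fun t => ∫ z in node i.castSucc..x, W z t :=
      intervalIntegral.continuous_parametric_intervalIntegral_of_continuous' hsw _ _
    have hc2 : Continuous fun t =>
        ∫ τ in (0 : ℝ)..t, (φ i (U i x τ) - φ i (U i (node i.castSucc) τ)) :=
      intervalIntegral.continuous_primitive
        (fun c d => ((hUt x).sub (hUt _)).intervalIntegrable c d) 0
    -- Both sides are continuous in `t`, so a good `t` suffices. There, the balance at the two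
    -- points and Fubini reduce the claim to `φ(U)` being, for almost every `τ`, a space primitive
    -- of `G(·,τ)`.
    refine closure_minimal (fun t ht => ?_) (isClosed_eq hc1 hc2) (hAcl ht)
    rw [mem_ofPred_eq]
    have hGi : ∀ c d, IntervalIntegrable (fun z => ∫ τ in (0 : ℝ)..t, G z τ) volume c d :=
      intervalIntegrable_of_measurable_of_bounded (measurable_intervalIntegral hG 0 t)
        fun z => abs_intervalIntegral_le (hGL z) 0 t
    have hwt : ∀ c d, IntervalIntegrable (w t) volume c d := fun c d =>
      (continuous_layerSum fun i => hmi i t).intervalIntegrable c d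
    rw [intervalIntegral.integral_congr fun z _ => hWw t ht z,
      ← intervalIntegral.integral_interval_sub_left (hwt (node 0) _) (hwt (node 0) _),
      ht.2.2 x (hmemN i hx), ht.2.2 _ (hmemN i hleft),
      intervalIntegral.integral_interval_sub_left (hGi _ _) (hGi _ _),
      intervalIntegral_swap_of_bounded hG hGL]
    refine intervalIntegral.integral_congr_ae ?_
    filter_upwards [hAae, compl_mem_ae_iff.2 (measure_singleton T)] with τ h1 h2 hτ
    rw [uIoc_of_le ht.1.1.le] at hτ
    have hτA : τ ∈ A := h1 ⟨hτ.1, hτ.2.trans_lt ht.1.2⟩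
    rw [hUr i x hx τ hτA, hUr i _ hleft τ hτA]
    exact ((hr i τ hτA).2 x hx).symm
  · rw [← hWcl]
    refine closure_minimal (fun t ht => ?_) (isClosed_eq (hWt _) continuous_const)
      (hAcl (clampIcc_mem hT.le t))
    rw [mem_ofPred_eq, hWw t ht]
    exact hw3 t ht
  · filter_upwards [hAae] with t ht htT
    exact hUu i t (ht htT)

/-! ### Bounded measurable representatives and integrals over cylinders. -/

theorem exists_bounded_measurable_rep {α : Type*} [MeasurableSpace α] {μ : Measure α} {f : α → ℝ}
    (hf : AEStronglyMeasurable f μ) {a b : ℝ} (hab : a ≤ b) (h : ∀ᵐ p ∂μ, f p ∈ Icc a b) :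
    ∃ f' : α → ℝ, Measurable f' ∧ (∀ p, f' p ∈ Icc a b) ∧ ∀ᵐ p ∂μ, f' p = f p := by
  refine ⟨fun p => clampIcc a b (hf.mk f p),
    (continuous_clampIcc a b).measurable.comp hf.stronglyMeasurable_mk.measurable,
    fun p => clampIcc_mem hab _, ?_⟩
  filter_upwards [h, hf.ae_eq_mk] with p h1 h2
  rw [← h2, clampIcc_of_mem h1]

theorem exists_bound_of_memLp_top {α : Type*} [MeasurableSpace α] {μ : Measure α} {f : α → ℝ}
    (hf : MemLp f ⊤ μ) : ∃ C : ℝ, 0 ≤ C ∧ ∀ᵐ p ∂μ, |f p| ≤ C := by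
  have h1 := hf.2
  rw [eLpNorm_exponent_top] at h1
  refine ⟨(eLpNormEssSup f μ).toReal, ENNReal.toReal_nonneg, ?_⟩
  filter_upwards [ae_le_eLpNormEssSup (f := f) (μ := μ)] with p hp
  have := ENNReal.toReal_mono h1.ne hp
  rwa [toReal_enorm] at this

theorem ae_ae_of_ae_cylinder {I J : Set ℝ} (hI : MeasurableSet I) (hJ : MeasurableSet J)
    {P : ℝ × ℝ → Prop} (h : ∀ᵐ p ∂(volume.restrict (I ×ˢ J)), P p) :
    ∀ᵐ t, t ∈ J → ∀ᵐ x, x ∈ I → P (x, t) := by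
  rw [Measure.volume_eq_prod, ← Measure.prod_restrict] at h
  have h2 := Measure.ae_ae_of_ae_prod
    (Measure.measurePreserving_swap.quasiMeasurePreserving.ae h)
  rw [ae_restrict_iff' hJ] at h2
  filter_upwards [h2] with t ht htJ
  exact (ae_restrict_iff' hI).1 (ht htJ)

theorem ae_cylinder_of_ae_ae {I J : Set ℝ} (hI : MeasurableSet I) (hJ : MeasurableSet J)
    {P : ℝ × ℝ → Prop} (hP : MeasurableSet {p | P p})
    (h : ∀ᵐ t, t ∈ J → ∀ᵐ x, x ∈ I → P (x, t)) : ∀ᵐ p ∂(volume.restrict (I ×ˢ J)), P p := by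
  rw [Measure.volume_eq_prod, ← Measure.prod_restrict]
  have h2 : ∀ᵐ q ∂((volume.restrict J).prod (volume.restrict I)), P q.swap := by
    rw [Measure.ae_prod_iff_ae_ae (p := fun q : ℝ × ℝ => P q.swap)
      (hP.preimage measurable_swap), ae_restrict_iff' hJ]
    filter_upwards [h] with t ht htJ
    exact (ae_restrict_iff' hI).2 (ht htJ)
  exact Measure.measurePreserving_swap.quasiMeasurePreserving.ae h2

theorem IsWeakDeriv.congr_ae {I : Set ℝ} {f f' g g' : ℝ → ℝ} (h : IsWeakDeriv I f g)
    (hI : MeasurableSet I) (hf : ∀ᵐ x, x ∈ I → f x = f' x) (hg : ∀ᵐ x, x ∈ I → g x = g' x) :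
    IsWeakDeriv I f' g' := by
  intro ζ h1 h2 h3
  have h := h ζ h1 h2 h3
  rw [setIntegral_congr_ae hI (g := fun x => f' x * deriv ζ x)
      (hf.mono fun x hx hxI => by rw [hx hxI]),
    setIntegral_congr_ae hI (f := fun x => g x * ζ x) (g := fun x => g' x * ζ x)
      (hg.mono fun x hx hxI => by rw [hx hxI])] at h
  exact h

theorem integral_cylinder {a b c d C : ℝ} (hab : a ≤ b) (hcd : c ≤ d) {F : ℝ → ℝ → ℝ}
    (hF : Measurable (Function.uncurry F)) (hC : ∀ x t, |F x t| ≤ C) :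
    ∫ p in Ioo a b ×ˢ Ioo c d, F p.1 p.2 = ∫ t in c..d, ∫ x in a..b, F x t := by
  have hi : Integrable (fun p : ℝ × ℝ => F p.1 p.2)
      ((volume.restrict (Ioo a b)).prod (volume.restrict (Ioo c d))) :=
    Integrable.of_bound hF.aestronglyMeasurable C (Eventually.of_forall fun p => hC _ _)
  rw [Measure.volume_eq_prod, ← Measure.prod_restrict, integral_prod_symm _ hi,
    intervalIntegral.integral_of_le hcd, integral_Ioc_eq_integral_Ioo]
  refine integral_congr_ae (Eventually.of_forall fun t => ?_)
  change ∫ x in Ioo a b, F x t = ∫ x in a..b, F x t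
  rw [intervalIntegral.integral_of_le hab, integral_Ioc_eq_integral_Ioo]

/-! ### Gluing functions given layer by layer. -/

section Patch

variable {N : ℕ} {node : Fin (N + 1) → ℝ}

/-- The function on the domain given by `f i` on the layer `i`. -/
noncomputable def patch (node : Fin (N + 1) → ℝ) (f : Fin N → ℝ → ℝ) (x : ℝ) : ℝ :=
  ∑ i, (Ioo (node i.castSucc) (node i.succ)).indicator (f i) x

theorem patch_of_mem (hnode : StrictMono node) {f : Fin N → ℝ → ℝ} {i : Fin N} {x : ℝ}
    (hx : x ∈ Ioo (node i.castSucc) (node i.succ)) : patch node f x = f i x := by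
  rw [patch, Finset.sum_eq_single i, indicator_of_mem hx]
  · intro j _ hji
    refine indicator_of_notMem (fun hxj => ?_) _
    rcases lt_or_gt_of_ne hji with hlt | hlt
    · have h3 : node j.succ ≤ node i.castSucc := hnode.monotone (by
        rw [Fin.le_def, Fin.val_succ, Fin.val_castSucc]; exact hlt)
      linarith [hx.1, hxj.2]
    · have h3 : node i.succ ≤ node j.castSucc := hnode.monotone (by
        rw [Fin.le_def, Fin.val_succ, Fin.val_castSucc]; exact hlt)
      linarith [hx.2, hxj.1]
  · simp

theorem patch_of_forall_notMem {f : Fin N → ℝ → ℝ} {x : ℝ}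
    (hx : ∀ i : Fin N, x ∉ Ioo (node i.castSucc) (node i.succ)) : patch node f x = 0 :=
  Finset.sum_eq_zero fun i _ => indicator_of_notMem (hx i) _

theorem patch_mem (hnode : StrictMono node) {f : Fin N → ℝ → ℝ} {S : Set ℝ} {x : ℝ} (h0 : 0 ∈ S)
    (hf : ∀ i, f i x ∈ S) : patch node f x ∈ S := by
  by_cases h : ∃ i : Fin N, x ∈ Ioo (node i.castSucc) (node i.succ)
  · obtain ⟨i, hi⟩ := h
    rw [patch_of_mem hnode hi]
    exact hf i
  · rw [patch_of_forall_notMem (not_exists.1 h)]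
    exact h0

theorem patch_mul (f : Fin N → ℝ → ℝ) (k : ℝ → ℝ) (x : ℝ) :
    patch node f x * k x = patch node (fun i y => f i y * k y) x := by
  rw [patch, patch, Finset.sum_mul]
  exact Finset.sum_congr rfl fun i _ => by simp only [indicator_apply]; split_ifs <;> simp

theorem measurable_patch {f : Fin N → ℝ → ℝ} (hf : ∀ i, Measurable (f i)) :
    Measurable (patch node f) :=
  Finset.measurable_fun_sum _ fun i _ => (hf i).indicator measurableSet_Ioo

theorem measurable_patch_uncurry {f : Fin N → ℝ → ℝ → ℝ}
    (hf : ∀ i, Measurable (Function.uncurry (f i))) :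
    Measurable (Function.uncurry fun x t => patch node (fun i y => f i y t) x) := by
  unfold patch
  refine Finset.measurable_fun_sum (M := ℝ) (f := fun (i : Fin N) (p : ℝ × ℝ) =>
    (Ioo (node i.castSucc) (node i.succ)).indicator (fun y => f i y p.2) p.1) _ fun i _ => ?_
  exact (hf i).indicator (s := {p : ℝ × ℝ | p.1 ∈ Ioo (node i.castSucc) (node i.succ)})
    (measurable_fst measurableSet_Ioo)

theorem integral_patch (hnode : StrictMono node) {f : Fin N → ℝ → ℝ}
    (hf : ∀ i c d, IntervalIntegrable (f i) volume c d) {b : ℝ} (hb : node (Fin.last N) ≤ b) :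
    ∫ x in node 0..b, patch node f x = ∑ i : Fin N, ∫ x in node i.castSucc..node i.succ, f i x := by
  unfold patch
  rw [integral_sum_indicator hnode hf ((hnode.monotone (Fin.zero_le _)).trans hb)]
  exact Finset.sum_congr rfl fun i _ => by
    rw [clampIcc_of_le (hnode.monotone (Fin.castSucc_lt_succ).le)
      ((hnode.monotone (Fin.le_last _)).trans hb)]

theorem sum_integral_cylinder (hnode : StrictMono node) {T C b : ℝ} (hT : 0 ≤ T)
    (hb : node (Fin.last N) ≤ b) {F : Fin N → ℝ → ℝ → ℝ}
    (hF : ∀ i, Measurable (Function.uncurry (F i))) (hC : ∀ i x t, |F i x t| ≤ C) :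
    ∑ i : Fin N, ∫ p in Ioo (node i.castSucc) (node i.succ) ×ˢ Ioo 0 T, F i p.1 p.2
      = ∫ t in (0 : ℝ)..T, ∫ x in node 0..b, patch node (fun i y => F i y t) x := by
  have hFt : ∀ i t c d, IntervalIntegrable (fun y => F i y t) volume c d := fun i t =>
    intervalIntegrable_of_measurable_of_bounded ((hF i).of_uncurry_right (y := t)) fun x => hC i x t
  have hsw : ∀ i, Measurable (Function.uncurry fun t y => F i y t) := fun i =>
    (hF i).comp measurable_swap
  simp only [integral_patch hnode (hFt · _) hb]
  rw [intervalIntegral.integral_finsetSum fun i _ =>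
    intervalIntegrable_of_measurable_of_bounded (measurable_intervalIntegral (hsw i) _ _)
      (fun t => abs_intervalIntegral_le (fun x => hC i x t) _ _) _ _]
  exact Finset.sum_congr rfl fun i _ =>
    integral_cylinder (hnode.monotone (Fin.castSucc_lt_succ).le) hT (hF i) (hC i)

end Patch

theorem isTestFunction_mul {T : ℝ} {Z w : ℝ → ℝ} (hZ : ContDiff ℝ ∞ Z) (hZc : HasCompactSupport Z)
    (hw : ContDiff ℝ ∞ w) (hwc : HasCompactSupport w) (hws : tsupport w ⊆ Iio T) :
    IsTestFunction T fun p => Z p.1 * w p.2 := by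
  have hsub : tsupport (fun p : ℝ × ℝ => Z p.1 * w p.2) ⊆ tsupport Z ×ˢ tsupport w := by
    refine closure_minimal (fun p hp => ?_) ((isClosed_tsupport _).prod (isClosed_tsupport _))
    have := mul_ne_zero_iff.1 hp
    exact ⟨subset_tsupport _ this.1, subset_tsupport _ this.2⟩
  exact ⟨(hZ.comp contDiff_fst).mul (hw.comp contDiff_snd),
    (hZc.prod hwc).of_isClosed_subset (isClosed_tsupport _) hsub,
    hsub.trans (prod_mono (subset_univ _) hws)⟩

theorem patch_sub {N : ℕ} {node : Fin (N + 1) → ℝ} (f g : Fin N → ℝ → ℝ) (x : ℝ) :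
    patch node f x - patch node g x = patch node (fun i y => f i y - g i y) x := by
  rw [patch, patch, patch, ← Finset.sum_sub_distrib]
  exact Finset.sum_congr rfl fun i _ => by simp only [indicator_apply]; split_ifs <;> simp

theorem exists_bound_testFunction {ζ : ℝ → ℝ} (hζ : ContDiff ℝ ∞ ζ) (hζc : HasCompactSupport ζ) :
    ∃ K : ℝ, (∀ x, |deriv ζ x| ≤ K) ∧ ∀ x, |ζ x| ≤ K := by
  obtain ⟨K1, hK1⟩ := hζc.deriv.exists_bound_of_continuous (hζ.continuous_deriv (by norm_num))
  obtain ⟨K2, hK2⟩ := hζc.exists_bound_of_continuous hζ.continuous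
  exact ⟨max K1 K2, fun x => (hK1 x).trans (le_max_left _ _),
    fun x => (hK2 x).trans (le_max_right _ _)⟩

theorem abs_mul_le_of_le {x y A B : ℝ} (hx : |x| ≤ A) (hy : |y| ≤ B) : |x * y| ≤ A * B :=
  (abs_mul x y).trans_le (mul_le_mul hx hy (abs_nonneg y) ((abs_nonneg x).trans hx))

/-! ### From weak solutions to flows. -/

namespace Medium

variable {N : ℕ} {M : Medium N}

theorem layer_subset_domain (i : Fin N) : M.layer i ⊆ M.domain :=
  Ioo_subset_Ioo (M.node_strictMono.monotone (Fin.zero_le _))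
    (M.node_strictMono.monotone (Fin.le_last _))

theorem layerCylinder_subset_cylinder (T : ℝ) (i : Fin N) : M.layerCylinder T i ⊆ M.cylinder T :=
  prod_mono (layer_subset_domain i) le_rfl

instance (T : ℝ) (i : Fin N) : IsFiniteMeasure (volume.restrict (M.layerCylinder T i)) :=
  ⟨by
    rw [Measure.restrict_apply_univ, layerCylinder, layer, Measure.volume_eq_prod,
      Measure.prod_prod]
    simp [ENNReal.mul_lt_top_iff]⟩

/-- The weak formulation for test functions in product form, for bounded measurable
representatives. -/
theorem weak_formulation_patch {T L : ℝ} (hT : 0 < T) {u₀ u₀' : ℝ → ℝ}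
    {u u' : ℝ × ℝ → ℝ} (hu : M.IsWeakSolution T u₀ u) {g g' : Fin N → ℝ × ℝ → ℝ}
    (hg : ∀ i, MemLp (g i) ⊤ (volume.restrict (M.layerCylinder T i)) ∧
      IsWeakSpaceDeriv (M.layer i) T (fun p => M.kirchhoff i (u p)) (g i))
    (hu'm : Measurable u') (hu'1 : ∀ p, |u' p| ≤ 1)
    (hu' : ∀ i, ∀ᵐ p ∂(volume.restrict (M.layerCylinder T i)), u' p = u p)
    (hu₀m : Measurable u₀') (hu₀1 : ∀ x, |u₀' x| ≤ 1)
    (hu₀' : ∀ i, ∀ᵐ x, x ∈ M.layer i → u₀' x = u₀ x)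
    (hg'm : ∀ i, Measurable (g' i)) (hg'L : ∀ i p, |g' i p| ≤ L)
    (hg' : ∀ i, ∀ᵐ p ∂(volume.restrict (M.layerCylinder T i)), g' i p = g i p)
    {Z w : ℝ → ℝ} (hZ : ContDiff ℝ ∞ Z) (hZc : HasCompactSupport Z) (hw : ContDiff ℝ ∞ w)
    (hwc : HasCompactSupport w) (hws : tsupport w ⊆ Iio T) {b : ℝ}
    (hb : M.node (Fin.last N) ≤ b) :
    (∫ t in (0 : ℝ)..T, deriv w t * ∫ x in M.node 0..b,
        patch M.node (fun i y => M.porosity i * u' (y, t)) x * Z x)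
      + w 0 * (∫ x in M.node 0..b, patch M.node (fun i y => M.porosity i * u₀' y) x * Z x)
      - ∫ t in (0 : ℝ)..T, w t * ∫ x in M.node 0..b,
        patch M.node (fun i y => g' i (y, t)) x * deriv Z x = 0 := by
  -- The bounded flux is square integrable since the cylinder has finite measure, so it may be used
  -- in the weak formulation.
  have hwf := hu.weak_formulation g (fun i => ⟨(hg i).1.mono_exponent le_top, (hg i).2⟩) _
    (isTestFunction_mul hZ hZc hw hwc hws)
  obtain ⟨K, hK1, hK2⟩ := exists_bound_testFunction hZ hZc
  obtain ⟨J, hJ1, hJ2⟩ := exists_bound_testFunction hw hwc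
  have hZdm : Measurable (deriv Z) := measurable_deriv Z
  have hwdm : Measurable (deriv w) := measurable_deriv w
  have hZm : Measurable Z := hZ.continuous.measurable
  have hwm : Measurable w := hw.continuous.measurable
  have hpor : ∀ i, |M.porosity i| ≤ 1 := fun i => by
    rw [abs_of_pos (M.porosity_mem i).1]; exact (M.porosity_mem i).2.le
  have e1 : ∑ i, ∫ p in M.layerCylinder T i,
      M.porosity i * u p * deriv (fun t => Z p.1 * w t) p.2
      = ∫ t in (0 : ℝ)..T, deriv w t * ∫ x in M.node 0..b,
        patch M.node (fun i y => M.porosity i * u' (y, t)) x * Z x := by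
    have h1 := sum_integral_cylinder M.node_strictMono hT.le hb
      (F := fun i x t => M.porosity i * u' (x, t) * (Z x * deriv w t)) (C := 1 * 1 * (K * J))
      (fun i => ((hu'm.const_mul _).mul ((hZm.comp measurable_fst).mul
        (hwdm.comp measurable_snd)))) (fun i x t =>
        abs_mul_le_of_le (abs_mul_le_of_le (hpor i) (hu'1 _)) (abs_mul_le_of_le (hK2 x) (hJ1 t)))
    have h2 : ∀ t x, patch M.node (fun i y => M.porosity i * u' (y, t) * (Z y * deriv w t)) x
        = deriv w t * (patch M.node (fun i y => M.porosity i * u' (y, t)) x * Z x) := by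
      intro t x
      rw [← patch_mul (fun i y => M.porosity i * u' (y, t)) fun y => Z y * deriv w t]
      ring
    simp only [h2, intervalIntegral.integral_const_mul] at h1
    rw [← h1]
    refine Finset.sum_congr rfl fun i _ => ?_
    refine integral_congr_ae ((hu' i).mono fun p hp => ?_)
    simp only [deriv_const_mul_field, hp, Prod.mk.eta]
  have e3 : ∑ i, ∫ p in M.layerCylinder T i, g i p * deriv (fun x => Z x * w p.2) p.1
      = ∫ t in (0 : ℝ)..T, w t * ∫ x in M.node 0..b,
        patch M.node (fun i y => g' i (y, t)) x * deriv Z x := by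
    have h1 := sum_integral_cylinder M.node_strictMono hT.le hb
      (F := fun i x t => g' i (x, t) * (deriv Z x * w t)) (C := L * (K * J))
      (fun i => ((hg'm i).mul ((hZdm.comp measurable_fst).mul
        (hwm.comp measurable_snd)))) (fun i x t =>
        abs_mul_le_of_le (hg'L i _) (abs_mul_le_of_le (hK1 x) (hJ2 t)))
    have h2 : ∀ t x, patch M.node (fun i y => g' i (y, t) * (deriv Z y * w t)) x
        = w t * (patch M.node (fun i y => g' i (y, t)) x * deriv Z x) := by
      intro t x
      rw [← patch_mul (fun i y => g' i (y, t)) fun y => deriv Z y * w t]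
      ring
    simp only [h2, intervalIntegral.integral_const_mul] at h1
    rw [← h1]
    refine Finset.sum_congr rfl fun i _ => ?_
    refine integral_congr_ae ((hg' i).mono fun p hp => ?_)
    simp only [deriv_mul_const_field, hp, Prod.mk.eta]
  have e2 : ∑ i, ∫ x in M.layer i, M.porosity i * u₀ x * (Z x * w 0)
      = w 0 * (∫ x in M.node 0..b, patch M.node (fun i y => M.porosity i * u₀' y) x * Z x) := by
    have hi : ∀ (i : Fin N) c d, IntervalIntegrable (fun x => M.porosity i * u₀' x * Z x)
        volume c d := fun i =>
      intervalIntegrable_of_measurable_of_bounded ((hu₀m.const_mul _).mul hZm) (C := 1 * 1 * K)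
        fun x => abs_mul_le_of_le (abs_mul_le_of_le (hpor i) (hu₀1 x)) (hK2 x)
    simp only [patch_mul]
    rw [integral_patch M.node_strictMono hi hb, Finset.mul_sum]
    refine Finset.sum_congr rfl fun i _ => ?_
    rw [intervalIntegral.integral_of_le (M.node_strictMono (Fin.castSucc_lt_succ)).le,
      integral_Ioc_eq_integral_Ioo, ← integral_const_mul]
    refine setIntegral_congr_ae measurableSet_Ioo ((hu₀' i).mono fun x hx hxi => ?_)
    rw [hx hxi]
    ring
  rw [← e1, ← e2, ← e3]
  exact hwf

/-- A weak solution with bounded flux is represented by a flow. -/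
theorem IsWeakSolution.exists_isFlow {T : ℝ} (hT : 0 < T) {u₀ : ℝ → ℝ} {u : ℝ × ℝ → ℝ}
    (hu₀ : M.IsInitialDatum u₀) (hu : M.IsWeakSolution T u₀ u) (hflux : M.HasBoundedFlux T u) :
    ∃ L₀ : ℝ, ∀ L, L₀ ≤ L → ∃ (U : Fin N → ℝ → ℝ → ℝ) (W : ℝ → ℝ → ℝ),
      IsFlow M.node T M.porosity L M.kirchhoffExt U W ∧
      (∀ i, ∀ᵐ p ∂(volume.restrict (M.layerCylinder T i)), U i p.1 p.2 = u p) ∧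
      ∀ i, ∀ᵐ x, x ∈ M.layer i → U i x 0 = u₀ x := by
  choose g hg using hflux
  choose C hC0 hC using fun i => exists_bound_of_memLp_top (hg i).1
  -- The sum bounds the flux of every layer. Any larger `L` is allowed, so that two solutions can
  -- share one constant.
  refine ⟨∑ i, C i, fun L hL => ?_⟩
  have hCL : ∀ i, C i ≤ L := fun i =>
    (Finset.single_le_sum (fun j _ => hC0 j) (Finset.mem_univ i)).trans hL
  have hL0 : 0 ≤ L := (Finset.sum_nonneg fun i _ => hC0 i).trans hL
  obtain ⟨u', hu'm, hu'01, hu'u⟩ :=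
    exists_bounded_measurable_rep hu.aestronglyMeasurable zero_le_one hu.mem_Icc
  obtain ⟨u₀', hu₀m, hu₀01, hu₀u⟩ := exists_bounded_measurable_rep hu₀.1 zero_le_one hu₀.2
  choose g' hg'm hg'L hg'g using fun i => exists_bounded_measurable_rep (hg i).1.1
    (neg_le_self hL0) ((hC i).mono fun p hp => abs_le.1 (hp.trans (hCL i)))
  have hu' : ∀ i, ∀ᵐ p ∂(volume.restrict (M.layerCylinder T i)), u' p = u p := fun i =>
    ae_mono (Measure.restrict_mono (layerCylinder_subset_cylinder T i) le_rfl) hu'u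
  have hu₀' : ∀ i, ∀ᵐ x, x ∈ M.layer i → u₀' x = u₀ x := fun i => by
    have := (ae_restrict_iff' (show MeasurableSet M.domain from measurableSet_Ioo)).1 hu₀u
    exact this.mono fun x hx hxi => hx (layer_subset_domain i hxi)
  have hu'1 : ∀ p, |u' p| ≤ 1 := fun p => by
    rw [abs_of_nonneg (hu'01 p).1]; exact (hu'01 p).2
  have hu₀1 : ∀ x, |u₀' x| ≤ 1 := fun x => by
    rw [abs_of_nonneg (hu₀01 x).1]; exact (hu₀01 x).2
  have hpor : ∀ i, |M.porosity i| ≤ 1 := fun i => by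
    rw [abs_of_pos (M.porosity_mem i).1]; exact (M.porosity_mem i).2.le
  have habs : ∀ {c : ℝ}, 0 ≤ c → (0 : ℝ) ∈ {y : ℝ | |y| ≤ c} := fun hc => by simpa using hc
  set G : ℝ → ℝ → ℝ := fun x t => patch M.node (fun i y => g' i (y, t)) x with hGdef
  have hGm : Measurable (Function.uncurry G) :=
    measurable_patch_uncurry (f := fun i y t => g' i (y, t)) hg'm
  have hGL : ∀ x t, |G x t| ≤ L := fun x t => patch_mem M.node_strictMono (S := {y | |y| ≤ L})
    (habs hL0) fun i => abs_le.2 (hg'L i _)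
  have hG0 : ∀ x, M.node (Fin.last N) < x → ∀ t, G x t = 0 := fun x hx t =>
    patch_of_forall_notMem fun i hxi =>
      (hx.trans hxi.2).not_ge (M.node_strictMono.monotone (Fin.le_last _))
  have hRm : Measurable (Function.uncurry fun x t =>
      patch M.node (fun i y => M.porosity i * u' (y, t)) x) :=
    measurable_patch_uncurry (f := fun i y t => M.porosity i * u' (y, t))
      fun i => hu'm.const_mul _
  have hweak : ∀ i, ∀ᵐ t, t ∈ Ioo 0 T → IsWeakDeriv (M.layer i)
      (fun x => M.kirchhoffExt i (u' (x, t))) (fun x => G x t) := by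
    intro i
    have h1 := (ae_restrict_iff' measurableSet_Ioo).1 (hg i).2
    filter_upwards [h1, ae_ae_of_ae_cylinder measurableSet_Ioo measurableSet_Ioo (hu' i),
      ae_ae_of_ae_cylinder measurableSet_Ioo measurableSet_Ioo (hg'g i)] with t h1 h2 h3 ht
    refine (h1 ht).congr_ae measurableSet_Ioo ?_ ?_
    · filter_upwards [h2 ht] with x hx hxi
      rw [M.kirchhoffExt_eq i (hu'01 _), hx hxi]
    · filter_upwards [h3 ht] with x hx hxi
      exact (hx hxi).symm.trans
        (patch_of_mem M.node_strictMono (f := fun i y => g' i (y, t)) hxi).symm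
  -- The data vanish to the right of the domain, and the interval is prolonged by `1`. The tests
  -- then need not vanish at the last node, as in the weak formulation, and the no-flux condition
  -- there is retained.
  have hbal := ae_integral_primitive_eq_of_weak_balance (a := M.node 0)
    (b := M.node (Fin.last N) + 1) (C := max 1 L)
    ((M.node_strictMono.monotone (Fin.zero_le _)).trans_lt (lt_add_one _)) hT hRm hGm
    (R₀ := patch M.node fun i y => M.porosity i * u₀' y)
    (measurable_patch fun i => hu₀m.const_mul _)
    (fun x t => patch_mem M.node_strictMono (S := {y | |y| ≤ max 1 L})
      (habs (by positivity)) fun i => (abs_mul_le_of_le (hpor i) (hu'1 _)).trans (by simp))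
    (fun x t => (hGL x t).trans (le_max_right _ _))
    (fun x => patch_mem M.node_strictMono (S := {y | |y| ≤ max 1 L})
      (habs (by positivity)) fun i => (abs_mul_le_of_le (hpor i) (hu₀1 _)).trans (by simp))
    fun Z w hZ hZc _ hw hwc hws => weak_formulation_patch hT hu hg hu'm hu'1 hu' hu₀m hu₀1 hu₀'
      hg'm (fun i p => abs_le.2 (hg'L i p)) hg'g hZ hZc hw hwc hws (lt_add_one _).le
  have hmi : ∀ t (i : Fin N) c d,
      IntervalIntegrable (fun y => M.porosity i * (u' (y, t) - u₀' y)) volume c d := fun t i =>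
    intervalIntegrable_of_measurable_of_bounded
      (((hu'm.comp (by fun_prop : Measurable fun y : ℝ => (y, t))).sub hu₀m).const_mul _)
      (C := 1 * (1 + 1)) fun x => abs_mul_le_of_le (hpor i)
        ((abs_sub _ _).trans (add_le_add (hu'1 _) (hu₀1 _)))
  obtain ⟨U, W, hflow, hU, hU0⟩ := CapillaryFlow.exists_isFlow M.node_strictMono hT hL0
    (fun i => (M.porosity_mem i).1) M.continuous_kirchhoffExt M.strictMonoOn_kirchhoffExt
    (u := fun x t => u' (x, t)) hu'm (fun x t => hu'01 _) hu₀m hu₀01 hGm hGL hG0 hweak (by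
      filter_upwards [hbal] with t ht htT x hx
      rw [← ht htT x hx]
      refine intervalIntegral.integral_congr fun z hz => ?_
      rw [uIcc_of_le hx.1] at hz
      simp only [patch_sub, ← mul_sub]
      exact (integral_sum_indicator M.node_strictMono (hmi t) hz.1).symm)
  refine ⟨U, W, hflow, fun i => ?_, fun i => ?_⟩
  · have hUm : Measurable fun p : ℝ × ℝ => U i p.1 p.2 := (hflow.layer i).cont.measurable
    have := ae_cylinder_of_ae_ae (I := M.layer i) (J := Ioo 0 T) (P := fun p => U i p.1 p.2 = u' p)
      measurableSet_Ioo measurableSet_Ioo (measurableSet_eq_fun hUm hu'm) (hU i)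
    filter_upwards [this, hu' i] with p h1 h2
    exact h1.trans h2
  · filter_upwards [hU0 i, hu₀' i] with x h1 h2 hx
    exact (h1 hx).trans (h2 hx)

end Medium

/-! ### Traces, interface conditions and continuity in `L¹`. -/

theorem exists_mem_Ioo_of_notMem_range {N : ℕ} {node : Fin (N + 1) → ℝ} {x : ℝ}
    (hx : x ∈ Ioo (node 0) (node (Fin.last N))) (hn : x ∉ range node) :
    ∃ i : Fin N, x ∈ Ioo (node i.castSucc) (node i.succ) := by
  by_contra! h
  have : ∀ k : Fin (N + 1), node k < x := by
    intro k
    induction k using Fin.induction with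
    | zero => exact hx.1
    | succ i ih =>
      refine lt_of_le_of_ne (not_lt.1 fun hlt => h i ⟨ih, hlt⟩) fun he => hn ⟨_, he⟩
  exact (this (Fin.last N)).not_gt hx.2

namespace Medium

variable {N : ℕ} {M : Medium N}

/-- The saturation trace of a profile with a continuous representative. -/
theorem IsSaturationTrace.eq {i : Fin N} {f r : ℝ → ℝ} {x s : ℝ} (h : M.IsSaturationTrace i f x s)
    (hr : Continuous r) (hr01 : ∀ y, r y ∈ Icc (0 : ℝ) 1) (hrf : ∀ᵐ y, y ∈ M.layer i → r y = f y)
    (hx : x ∈ Icc (M.node i.castSucc) (M.node i.succ)) : s = r x := by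
  obtain ⟨hs, F, hF, hFf, hFx⟩ := h
  have hne : M.node i.castSucc ≠ M.node i.succ := (M.node_strictMono (Fin.castSucc_lt_succ)).ne
  rw [layer, closure_Ioo hne] at hF
  have hae : F =ᵐ[volume.restrict (Icc (M.node i.castSucc) (M.node i.succ))]
      fun y => M.kirchhoffExt i (r y) := by
    rw [← restrict_Ioo_eq_restrict_Icc]
    filter_upwards [hFf, (ae_restrict_iff' (show MeasurableSet (M.layer i) from
      measurableSet_Ioo)).2 hrf] with y h1 h2
    rw [h1, M.kirchhoffExt_eq i (hr01 y), h2]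
  have := Measure.eqOn_Icc_of_ae_eq volume hne hae hF
    ((M.continuous_kirchhoffExt i).comp hr).continuousOn hx
  beta_reduce at this
  rw [hFx, M.kirchhoffExt_eq i (hr01 x)] at this
  exact (M.strictMonoOn_kirchhoff i).injOn hs (hr01 x) this

/-- The saturation traces of the weak solution are the point values of the continuous
representatives at the node (`IsSaturationTrace.eq`), so the transmission condition holds for these
values. -/
theorem IsWeakSolution.ae_pressureGraph_nonempty {T : ℝ} {u₀ : ℝ → ℝ} {u : ℝ × ℝ → ℝ}
    (hu : M.IsWeakSolution T u₀ u) {U : Fin N → ℝ → ℝ → ℝ}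
    (hUc : ∀ i, Continuous (Function.uncurry (U i))) (hU01 : ∀ i x t, U i x t ∈ Icc (0 : ℝ) 1)
    (hU : ∀ i, ∀ᵐ p ∂(volume.restrict (M.layerCylinder T i)), U i p.1 p.2 = u p) {i j : Fin N}
    (hij : i.succ = j.castSucc) :
    ∀ᵐ t, t ∈ Ioo 0 T → (M.pressureGraph i (U i (M.node i.succ) t) ∩
      M.pressureGraph j (U j (M.node i.succ) t)).Nonempty := by
  have h1 := (ae_restrict_iff' measurableSet_Ioo).1 (hu.transmission i j hij)
  filter_upwards [h1, ae_ae_of_ae_cylinder measurableSet_Ioo measurableSet_Ioo (hU i),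
    ae_ae_of_ae_cylinder measurableSet_Ioo measurableSet_Ioo (hU j)] with t h1 h2 h3 ht
  obtain ⟨s, r, hs, hr, hne⟩ := h1 ht
  have hc : ∀ k, Continuous fun x => U k x t := fun k =>
    (hUc k).comp (by fun_prop : Continuous fun x : ℝ => (x, t))
  have hlen : ∀ k : Fin N, M.node k.castSucc ≤ M.node k.succ := fun k =>
    (M.node_strictMono (Fin.castSucc_lt_succ)).le
  rw [hs.eq (hc i) (fun y => hU01 i y t) (h2 ht) (right_mem_Icc.2 (hlen i)),
    hr.eq (hc j) (fun y => hU01 j y t) (h3 ht) (by rw [hij]; exact left_mem_Icc.2 (hlen j))] at hne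
  exact hne

/-- The transmission conditions hold for almost every `t` for `U` and almost every `s` for `V`,
hence jointly for almost every pair. Comparison of the pressure graphs does not require equal times.
-/
theorem isOrderedAtInterfaces {T : ℝ} {U V : Fin N → ℝ → ℝ → ℝ}
    (hU01 : ∀ i x t, U i x t ∈ Icc (0 : ℝ) 1) (hV01 : ∀ i x t, V i x t ∈ Icc (0 : ℝ) 1)
    (hU : ∀ i j : Fin N, i.succ = j.castSucc → ∀ᵐ t, t ∈ Ioo 0 T →
      (M.pressureGraph i (U i (M.node i.succ) t) ∩
        M.pressureGraph j (U j (M.node i.succ) t)).Nonempty)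
    (hV : ∀ i j : Fin N, i.succ = j.castSucc → ∀ᵐ t, t ∈ Ioo 0 T →
      (M.pressureGraph i (V i (M.node i.succ) t) ∩
        M.pressureGraph j (V j (M.node i.succ) t)).Nonempty) :
    IsOrderedAtInterfaces M.node T U V := by
  intro i j hij
  rw [Measure.volume_eq_prod]
  filter_upwards [Measure.quasiMeasurePreserving_fst.ae (hU i j hij),
    Measure.quasiMeasurePreserving_snd.ae (hV i j hij)] with p h1 h2 hp1 hp2
  exact ⟨M.le_of_lt_of_pressureGraph (h1 hp1) (h2 hp2) (hU01 _ _ _) (hV01 _ _ _) (hU01 _ _ _)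
    (hV01 _ _ _), M.le_of_lt_of_pressureGraph (h2 hp2) (h1 hp1) (hV01 _ _ _) (hU01 _ _ _)
    (hV01 _ _ _) (hU01 _ _ _)⟩

/-- Continuous saturations of the layers form a representative that is continuous in time. -/
theorem isTimeContinuousRep_patch {T : ℝ} {u : ℝ × ℝ → ℝ} {U : Fin N → ℝ → ℝ → ℝ}
    (hUc : ∀ i, Continuous (Function.uncurry (U i))) (hU01 : ∀ i x t, U i x t ∈ Icc (0 : ℝ) 1)
    (hU : ∀ i, ∀ᵐ p ∂(volume.restrict (M.layerCylinder T i)), U i p.1 p.2 = u p) :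
    M.IsTimeContinuousRep T u fun p => patch M.node (fun i y => U i y p.2) p.1 := by
  have hUx : ∀ i t, Continuous fun x => U i x t := fun i t =>
    (hUc i).comp (by fun_prop : Continuous fun x : ℝ => (x, t))
  have hUt : ∀ i x, Continuous fun t => U i x t := fun i x =>
    (hUc i).comp (by fun_prop : Continuous fun t : ℝ => (x, t))
  have hm : ∀ t, Measurable fun x => patch M.node (fun i y => U i y t) x := fun t =>
    measurable_patch fun i => (hUx i t).measurable
  have h01 : ∀ x t, patch M.node (fun i y => U i y t) x ∈ Icc (0 : ℝ) 1 := fun x t =>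
    patch_mem M.node_strictMono (by simp) fun i => hU01 i x t
  have hfin : IsFiniteMeasure (volume.restrict M.domain) := ⟨by simp [domain]⟩
  have hct : ∀ x, Continuous fun t => patch M.node (fun i y => U i y t) x := by
    intro x
    by_cases h : ∃ i : Fin N, x ∈ Ioo (M.node i.castSucc) (M.node i.succ)
    · obtain ⟨i, hi⟩ := h
      simp only [patch_of_mem M.node_strictMono hi]
      exact hUt i x
    · simp only [patch_of_forall_notMem (not_exists.1 h)]
      exact continuous_const
  refine ⟨?_, fun t _ => ?_, fun t₀ _ => ?_⟩
  · have hcyl : ∀ i, ∀ᵐ p : ℝ × ℝ, p ∈ M.layerCylinder T i → U i p.1 p.2 = u p := fun i =>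
      (ae_restrict_iff' (show MeasurableSet (M.layerCylinder T i) from
        measurableSet_Ioo.prod measurableSet_Ioo)).1 (hU i)
    have hr : ∀ᵐ p : ℝ × ℝ, p.1 ∉ range M.node := by
      rw [Measure.volume_eq_prod]
      exact Measure.quasiMeasurePreserving_fst.ae
        ((finite_range M.node).measure_zero volume |> compl_mem_ae_iff.2)
    rw [EventuallyEq, ae_restrict_iff' (show MeasurableSet (M.cylinder T) from
      measurableSet_Ioo.prod measurableSet_Ioo)]
    filter_upwards [ae_all_iff.2 hcyl, hr] with p h1 h2 hp
    obtain ⟨i, hi⟩ := exists_mem_Ioo_of_notMem_range hp.1 h2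
    rw [patch_of_mem M.node_strictMono hi]
    exact h1 i ⟨hi, hp.2⟩
  · exact Integrable.of_bound (hm t).aestronglyMeasurable 1 (Eventually.of_forall fun x => by
      rw [Real.norm_of_nonneg (h01 x t).1]; exact (h01 x t).2)
  · have h := tendsto_integral_filter_of_dominated_convergence (μ := volume.restrict M.domain)
      (l := 𝓝[Icc 0 T] t₀)
      (F := fun t x => |patch M.node (fun i y => U i y t) x - patch M.node (fun i y => U i y t₀) x|)
      (f := fun _ => 0) (fun _ => (1 : ℝ))
      (Eventually.of_forall fun t => ((hm t).sub (hm t₀)).abs.aestronglyMeasurable)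
      (Eventually.of_forall fun t => Eventually.of_forall fun x => by
        rw [Real.norm_of_nonneg (abs_nonneg _), abs_le]
        have h1 := h01 x t
        have h2 := h01 x t₀
        constructor <;> linarith [h1.1, h1.2, h2.1, h2.2])
      (integrable_const _) (Eventually.of_forall fun x => by
        have : Continuous fun t =>
          |patch M.node (fun i y => U i y t) x - patch M.node (fun i y => U i y t₀) x| :=
          ((hct x).sub continuous_const).abs
        have h0 := (this.tendsto t₀).mono_left (nhdsWithin_le_nhds (s := Icc 0 T))
        simpa using h0)
    simpa using h

theorem sum_integral_posPart_eq (U V : Fin N → ℝ → ℝ → ℝ) {f g : ℝ → ℝ} {t : ℝ}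
    (hf : ∀ i, ∀ᵐ x, x ∈ M.layer i → U i x t = f x)
    (hg : ∀ i, ∀ᵐ x, x ∈ M.layer i → V i x t = g x) :
    ∑ i, ∫ x in M.layer i, M.porosity i * (f x - g x)⁺ = totalExcess M.node M.porosity U V t t := by
  refine Finset.sum_congr rfl fun i _ => ?_
  rw [excess, intervalIntegral.integral_of_le (M.node_strictMono (Fin.castSucc_lt_succ)).le,
    integral_Ioc_eq_integral_Ioo]
  refine setIntegral_congr_ae measurableSet_Ioo ?_
  filter_upwards [hf i, hg i] with x h1 h2 hx
  rw [h1 hx, h2 hx, one_mul, posPart_def]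

end Medium

end CapillaryFlow

/-! ### Conclusion. -/

theorem theorem5p1 {N : ℕ} (hN : 1 ≤ N) (M : CapillaryFlow.Medium N) {T : ℝ} (hT : 0 < T)
    {u₀ v₀ : ℝ → ℝ} (hu₀ : M.IsInitialDatum u₀) (hv₀ : M.IsInitialDatum v₀)
    {u v : ℝ × ℝ → ℝ} (hu : M.IsWeakSolution T u₀ u) (hv : M.IsWeakSolution T v₀ v)
    (hu_flux : M.HasBoundedFlux T u) (hv_flux : M.HasBoundedFlux T v) :
    ∃ U V : ℝ × ℝ → ℝ, M.IsTimeContinuousRep T u U ∧ M.IsTimeContinuousRep T v V ∧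
      ∀ t ∈ Icc 0 T,
        (∑ i, ∫ x in M.layer i, M.porosity i * (U (x, t) - V (x, t))⁺ ≤
          ∑ i, ∫ x in M.layer i, M.porosity i * (u₀ x - v₀ x)⁺) ∧
        (∑ i, ∫ x in M.layer i, M.porosity i * (U (x, t) - V (x, t))⁻ ≤
          ∑ i, ∫ x in M.layer i, M.porosity i * (u₀ x - v₀ x)⁻) := by
  obtain ⟨L₁, hL₁⟩ := hu.exists_isFlow hT hu₀ hu_flux
  obtain ⟨L₂, hL₂⟩ := hv.exists_isFlow hT hv₀ hv_flux
  -- The comparison of two flows requires a common flux bound.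
  obtain ⟨U, W, hUW, hUu, hU0⟩ := hL₁ (max L₁ L₂) (le_max_left _ _)
  obtain ⟨V, X, hVX, hVv, hV0⟩ := hL₂ (max L₁ L₂) (le_max_right _ _)
  have hUc := fun i => (hUW.layer i).cont
  have hVc := fun i => (hVX.layer i).cont
  have hU01 := fun i => (hUW.layer i).mem
  have hV01 := fun i => (hVX.layer i).mem
  have hUp := fun i j hij => hu.ae_pressureGraph_nonempty hUc hU01 hUu (i := i) (j := j) hij
  have hVp := fun i j hij => hv.ae_pressureGraph_nonempty hVc hV01 hVv (i := i) (j := j) hij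
  have hpatch : ∀ (F : Fin N → ℝ → ℝ → ℝ) (t : ℝ) (i : Fin N), ∀ᵐ x, x ∈ M.layer i →
      F i x t = CapillaryFlow.patch M.node (fun i y => F i y t) x := fun F t i =>
    Eventually.of_forall fun x hx =>
      (CapillaryFlow.patch_of_mem M.node_strictMono (f := fun i y => F i y t) hx).symm
  have hm : ∀ i, 0 ≤ M.porosity i := fun i => (M.porosity_mem i).1.le
  refine ⟨fun p => CapillaryFlow.patch M.node (fun i y => U i y p.2) p.1,
    fun p => CapillaryFlow.patch M.node (fun i y => V i y p.2) p.1,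
    CapillaryFlow.Medium.isTimeContinuousRep_patch hUc hU01 hUu,
    CapillaryFlow.Medium.isTimeContinuousRep_patch hVc hV01 hVv, fun t ht => ⟨?_, ?_⟩⟩
  · rw [CapillaryFlow.Medium.sum_integral_posPart_eq U V (hpatch U t) (hpatch V t),
      CapillaryFlow.Medium.sum_integral_posPart_eq U V hU0 hV0]
    exact hUW.totalExcess_le M.node_strictMono hT hVX M.continuous_kirchhoffExt
      M.monotone_kirchhoffExt M.strictMonoOn_kirchhoffExt hm
      (CapillaryFlow.Medium.isOrderedAtInterfaces hU01 hV01 hUp hVp) ht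
  -- The negative part of `U - V` is the positive part of `V - U`, and the hypotheses are symmetric
  -- in the two solutions.
  · simp only [← posPart_neg, neg_sub]
    rw [CapillaryFlow.Medium.sum_integral_posPart_eq V U (hpatch V t) (hpatch U t),
      CapillaryFlow.Medium.sum_integral_posPart_eq V U hV0 hU0]
    exact hVX.totalExcess_le M.node_strictMono hT hUW M.continuous_kirchhoffExt
      M.monotone_kirchhoffExt M.strictMonoOn_kirchhoffExt hm
      (CapillaryFlow.Medium.isOrderedAtInterfaces hV01 hU01 hVp hUp) ht
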